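/- Let $\mathcal X$ be a compact connected Riemannian manifold of dimension $d\ge 1$ (possibly with boundary), with Riemannian distance $\mathrm{dist}$ and Riemannian volume $\mathrm{Leb}$, also written $|\cdot|$. Let $T:\mathcal X\to\mathcal X$ be measurable and let $\mu$ be a $T$-invariant Borel probability measure. Let $\mathcal C_1$ be a Banach space of ($\mu$-classes of) real measurable functions on $\mathcal X$, and assume the following. * (Summable decay of correlations against $L^1$.) There are numbers $\rho_n$ with $\sum_{n\ge1}\rho_n<\infty$ such that for all $\phi\in\mathcal C_1$, $\psi\in L^1(\mu)$ and $n\ge 1$ the functions $\phi$ and $\phi\cdot\psi\circ T^n$ are integrable and $\left|\int\phi\,(\psi\circ T^n)\,d\mu-\int\phi\,d\mu\int\psi\,d\mu\right|\le\rho_n\|\phi\|_{\mathcal C_1}\|\psi\|_{L^1(\mu)}$. * (Indicators.) For all $k\in\mathbb N$ and $A\in\mathbb R$ there is $K$ such that $\mathbf 1_B\in\mathcal C_1$ and $\|\mathbf 1_B\|_{\mathcal C_1}\le K$ for every Borel set $B\subset\mathcal X$ that has at most $k$ connected components and satisfies $|\{x:\mathrm{dist}(x,\partial B)<\varepsilon\}|\le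 A\varepsilon$ for all $0<\varepsilon\le 1$. Let $\zeta$ be an interior point of $\mathcal X$ that is periodic with prime period $p$, such that $T$ is continuous at every point of the orbit of $\zeta$. Assume that $\zeta$ is hyperbolic repelling: $T^p$ is $C^1$ near $\zeta$ and all complex eigenvalues of $DT^p_\zeta$ have modulus $>1$ (the expansion need not be uniform in all directions). Assume that $\mu$ is absolutely continuous with respect to $\mathrm{Leb}$ with a density $h$ such that $h(\zeta)>0$ and $\lim_{\varepsilon\to0}|B_\varepsilon(\zeta)|^{-1}\int_{B_\varepsilon(\zeta)}|h-h(\zeta)|\,d\mathrm{Leb}=0$. Let $\varphi(x)=g(\mathrm{dist}(x,\zeta))$ be measurable, where $g:[0,\infty)\to\mathbb R\cup\{+\infty\}$ is strictly decreasing on some $[0,\delta]$, $\delta>0$, and $g(r)\le g(\delta)$ for $r\ge\delta$. Put $X_j=\varphi\circ T^j$. Let $u_n:(0,\infty)\to\mathbb R$ be continuous and strictly decreasing with $n\,\mu(X_0>u_n(\tau))\to\tau$ for every $\tau>0$, put $u_n^{-1}(z)=\inf\{\tau>0:u_n(\tau)<z\}\in[0,\infty]$, and let $$N_n=\sum_{j\ge0,\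 u_n^{-1}(X_j)<\infty}\delta_{(j/n,\;u_n^{-1}(X_j))}$$ be the two-dimensional empirical rare events point process on $[0,\infty)^2$, defined on $(\mathcal X,\mu)$. Fix orthonormal coordinates $\Phi_\zeta:\mathbb R^d\to T_\zeta\mathcal X$, let $|B_r|$ be the volume of a Euclidean ball of radius $r$ in $\mathbb R^d$, and let $$N^\dagger=\sum_{i,j\ge1}\sum_{\ell\ge0}\delta_{\left(T_{i,j},\ |B_{R_{i,j,\ell}}|\right)},\qquad R_{i,j,\ell}=\left\|(U_{i,j}/|B_1|)^{1/d}\,(DT_\zeta^{p})^{\ell}\,\Phi_\zeta(V_{i,j})\right\|,\qquad T_{i,j}=\sum_{k=1}^{j}\bar T_{i,k},$$ where $\bar T_{i,j}\sim\mathrm{Exp}(\theta)$ with $\theta=1-|\det DT^p_\zeta|^{-1}$, $U_{i,j}$ is uniform on $(i-1,i]$, $V_{i,j}$ is uniform on the unit sphere of $\mathbb R^d$, and all the variables $\bar T_{i,j},U_{i,j},V_{i,j}$ are independent; if $d=2$, one may take $V_{i,j}=(\cos\Theta_{i,j},\sin\Theta_{i,j})$ with $\Theta_{i,j}$ uniform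 on $[0,2\pi)$. Then $N_n$ ($n\ge1$) and $N^\dagger$ are point processes on $[0,\infty)^2$ (measurable, and almost surely Radon point measures), and $N_n$ converges weakly to $N^\dagger$: $\mathbb E\,F(N_n)\to\mathbb E\,F(N^\dagger)$ for every bounded $F$ on the space of Radon point measures on $[0,\infty)^2$ that is continuous in the vague topology. -/

import Mathlib

open MeasureTheory ProbabilityTheory Filter Topology Set
open scoped NNReal ENNReal Manifold Bundle BoundedContinuousFunction CompactlySupported

noncomputable section

namespace REPP

/-! ### Point measures, point processes and their weak convergence -/

section PointProcesses

variable {E : Type*} [TopologicalSpace E] [MeasurableSpace E]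

/-- `m` is finite on compact sets and is a finite or countable sum of Dirac masses
(points may be repeated). -/
def IsRadonPointMeasure (m : Measure E) : Prop :=
  (∀ K : Set E, IsCompact K → m K < ∞) ∧
    ∃ (S : Set ℕ) (x : ℕ → E), m = Measure.sum fun i : S => Measure.dirac (x i)

variable (E) in
/-- The space `M_p(E)` of Radon point measures on `E`. -/
def PointMeasure : Type _ := {m : Measure E // IsRadonPointMeasure m}

namespace PointMeasure

/-- The σ-algebra generated by the evaluations `m ↦ m F`, `F` Borel. -/
instance : MeasurableSpace (PointMeasure E) :=
  MeasurableSpace.comap (fun m : PointMeasure E => (m.1 : Measure E)) inferInstance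

/-- The vague topology: the coarsest one for which `m ↦ ∫ f dm` is continuous for every
continuous compactly supported `f`. -/
instance : TopologicalSpace (PointMeasure E) :=
  TopologicalSpace.induced (fun (m : PointMeasure E) (f : C_c(E, ℝ)) => ∫ x, f x ∂m.1)
    inferInstance

end PointMeasure

theorem isRadonPointMeasure_zero [Nonempty E] : IsRadonPointMeasure (0 : Measure E) :=
  ⟨fun K _ => by simp, ∅, fun _ => Classical.arbitrary E, by
    simp⟩

open Classical in
/-- A Radon point measure seen as an element of `M_p(E)`. The default value `0` for other measures
plays no role: it is only used for processes that are almost surely Radon point measures. -/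
def toPointMeasure [Nonempty E] (m : Measure E) : PointMeasure E :=
  if h : IsRadonPointMeasure m then ⟨m, h⟩ else ⟨0, isRadonPointMeasure_zero⟩

/-- `N` is (up to a null set) a measurable map from the probability space into `M_p(E)`. -/
def IsPointProcess [Nonempty E] {Ω : Type*} [MeasurableSpace Ω] (P : Measure Ω)
    (N : Ω → Measure E) : Prop :=
  (∀ᵐ ω ∂P, IsRadonPointMeasure (N ω)) ∧ AEMeasurable (fun ω => toPointMeasure (N ω)) P

/-- Weak convergence `N_n ⇒ N` of point processes: convergence of the expectation of every
bounded function on `M_p(E)` that is continuous for the vague topology. -/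
def ConvergesWeakly [Nonempty E] {Ω₁ Ω₂ : Type*} [MeasurableSpace Ω₁] [MeasurableSpace Ω₂]
    (P₁ : Measure Ω₁) (Nn : ℕ → Ω₁ → Measure E) (P₂ : Measure Ω₂) (N : Ω₂ → Measure E) : Prop :=
  ∀ F : PointMeasure E →ᵇ ℝ,
    Tendsto (fun n => ∫ ω, F (toPointMeasure (Nn n ω)) ∂P₁) atTop
      (𝓝 (∫ ω, F (toPointMeasure (N ω)) ∂P₂))

end PointProcesses

/-! ### The empirical process -/

/-- The inverse of a continuous strictly decreasing level function `u : (0,∞) → ℝ`. It equals `τ`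
at `u τ`; at a value above all levels it is `0`, and at a value which exceeds no level it is `∞`.
For `0 < τ₁ < τ₂` one has `τ₁ ≤ levelInv u z < τ₂` if and only if `u τ₂ < z ≤ u τ₁`. -/
def levelInv (u : ℝ → ℝ) (z : EReal) : ℝ≥0∞ :=
  ⨅ τ ∈ {τ : ℝ≥0 | 0 < τ ∧ (u τ : EReal) < z}, (τ : ℝ≥0∞)

/-- The two-dimensional process `∑_j δ_(j/n, uₙ⁻¹(X_j))` on `[0,∞)²`, with `X_j = φ ∘ T^j`. -/
def empiricalREPP {X : Type*} (T : X → X) (φ : X → EReal) (u : ℕ → ℝ → ℝ) (n : ℕ) (x : X) :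
    Measure (ℝ≥0 × ℝ≥0) :=
  Measure.sum fun j : {j : ℕ | levelInv (u n) (φ (T^[j] x)) ≠ ∞} =>
    Measure.dirac (((j : ℕ) : ℝ≥0) / (n : ℝ≥0), (levelInv (u n) (φ (T^[(j : ℕ)] x))).toNNReal)

/-! ### Standing assumptions -/

/-- `g : [0,∞) → ℝ ∪ {+∞}` is strictly decreasing on a neighbourhood `[0, δ]` of `0` and does not
exceed `g δ` beyond it. So `0` is its global maximum, and the sets `{x | g (dist x ζ) > s}` with
`g δ ≤ s < g 0` are balls around `ζ`. -/
def IsPeakFunction (g : ℝ≥0 → EReal) : Prop :=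
  (∀ r, g r ≠ ⊥) ∧ ∃ δ : ℝ≥0, 0 < δ ∧ StrictAntiOn g (Iic δ) ∧ ∀ r, δ ≤ r → g r ≤ g δ

/-- Continuous strictly decreasing levels `uₙ(τ)`, `τ > 0`, with `n μ(φ > uₙ(τ)) → τ`. -/
structure IsLevelSequence {X : Type*} [MeasurableSpace X] (μ : Measure X) (φ : X → EReal)
    (u : ℕ → ℝ → ℝ) : Prop where
  continuousOn : ∀ n, ContinuousOn (u n) (Ioi 0)
  strictAntiOn : ∀ n, StrictAntiOn (u n) (Ioi 0)
  tendsto : ∀ τ : ℝ, 0 < τ →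
    Tendsto (fun n : ℕ => (n : ℝ) * μ.real {x | (u n τ : EReal) < φ x}) atTop (𝓝 τ)

/-- `μ` is absolutely continuous with respect to `Leb`, with a density that is positive at `ζ` and
has `ζ` as a Lebesgue point. -/
def HasRegularDensityAt {X : Type*} [PseudoMetricSpace X] [MeasurableSpace X]
    (Leb μ : Measure X) (ζ : X) : Prop :=
  ∃ h : X → ℝ≥0, Measurable h ∧ μ = Leb.withDensity (fun x => (h x : ℝ≥0∞)) ∧ 0 < h ζ ∧
    Tendsto (fun ε : ℝ => (∫⁻ x in Metric.ball ζ ε, ‖(h x : ℝ) - (h ζ : ℝ)‖ₑ ∂Leb) /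
      Leb (Metric.ball ζ ε)) (𝓝[>] 0) (𝓝 0)

section Decay

variable {X : Type*} [MeasurableSpace X] {μ : Measure X}
  {C₁ : Type*} [NormedAddCommGroup C₁] [NormedSpace ℝ C₁]

/-- Decay of correlations of the observables in `C₁` against `L¹(μ)` at rate `ρ`; the space `C₁` of
(classes of) measurable functions is given by a linear map `ι` into the measurable functions
modulo `μ`-null sets. -/
def DecayAgainstL1 (T : X → X) (ι : C₁ →ₗ[ℝ] (X →ₘ[μ] ℝ)) (ρ : ℕ → ℝ) : Prop :=
  ∀ (φ : C₁) (ψ : X → ℝ), Integrable ψ μ → ∀ n : ℕ, 1 ≤ n →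
    Integrable (ι φ) μ ∧ Integrable (fun x => ι φ x * ψ (T^[n] x)) μ ∧
    |∫ x, ι φ x * ψ (T^[n] x) ∂μ - (∫ x, ι φ x ∂μ) * ∫ x, ψ x ∂μ|
      ≤ ρ n * (‖φ‖ * ∫ x, |ψ x| ∂μ)

/-- A Borel set with at most `k` connected components, whose boundary has an `ε`-neighbourhood of
volume at most `A * ε` for all `0 < ε ≤ 1`. -/
structure IsTameSet {X : Type*} [PseudoMetricSpace X] [MeasurableSpace X] (Leb : Measure X)
    (k : ℕ) (A : ℝ) (B : Set X) : Prop where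
  measurableSet : MeasurableSet B
  components : ENat.card (ConnectedComponents B) ≤ k
  boundary : ∀ ε : ℝ, 0 < ε → ε ≤ 1 →
    Leb (Metric.thickening ε (frontier B)) ≤ ENNReal.ofReal (A * ε)

/-- `C₁` contains the indicators of tame sets, with norms that are bounded as long as the number of
components and the size of the boundary are. -/
def ControlsIndicators [PseudoMetricSpace X] (Leb : Measure X)
    (ι : C₁ →ₗ[ℝ] (X →ₘ[μ] ℝ)) : Prop :=
  ∀ (k : ℕ) (A : ℝ), ∃ K : ℝ, ∀ B : Set X, IsTameSet Leb k A B →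
    ∃ φ : C₁, (ι φ : X → ℝ) =ᵐ[μ] B.indicator 1 ∧ ‖φ‖ ≤ K

end Decay

section Periodic

variable {F : Type*} [NormedAddCommGroup F] [NormedSpace ℝ F]
  {H : Type*} [TopologicalSpace H] (I : ModelWithCorners ℝ F H)
  {X : Type*} [TopologicalSpace X] [ChartedSpace H X]

/-- For a periodic point `ζ` of prime period `p`, the derivative `DT^p_ζ` on the tangent space
at `ζ` (the spaces tangent at `T^p ζ` and at `ζ` are the same). -/
def returnDeriv (T : X → X) (ζ : X) : TangentSpace I ζ →ₗ[ℝ] TangentSpace I ζ :=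
  (show F →L[ℝ] F from mfderiv I I (T^[Function.minimalPeriod T ζ]) ζ).toLinearMap

/-- `ζ` is a periodic hyperbolic repelling point: with `p` its prime period, `T^p` is `C¹` near `ζ`
and all complex eigenvalues of `DT^p_ζ` have modulus greater than one. -/
structure IsRepellingPeriodicPt [FiniteDimensional ℝ F] (T : X → X) (ζ : X) : Prop where
  periodic : ζ ∈ Function.periodicPts T
  contMDiffAt : ContMDiffAt I I 1 (T^[Function.minimalPeriod T ζ]) ζ
  expanding : ∀ z : ℂ,
    ((LinearMap.charpoly (show F →ₗ[ℝ] F from returnDeriv I T ζ)).map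
      (algebraMap ℝ ℂ)).IsRoot z → 1 < ‖z‖

/-- `θ = 1 - |det DT^p_ζ|⁻¹`. -/
def extremalIndex (T : X → X) (ζ : X) : ℝ :=
  1 - |LinearMap.det (returnDeriv I T ζ)|⁻¹

end Periodic

/-! ### The limit process -/

/-- The volume of the `d`-dimensional Euclidean ball whose radius is the distance to the origin of
`(w / |B₁|)^(1/d) L^ℓ (Φ v)`; here `Φ` gives Euclidean coordinates on the tangent space `V`, on
which `L` acts. For `ℓ = 0` and a unit vector `v` this is `w`. -/
def pileHeight {d : ℕ} {V : Type*} [NormedAddCommGroup V] [NormedSpace ℝ V]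
    (Φ : EuclideanSpace ℝ (Fin d) ≃ₗᵢ[ℝ] V) (L : V →ₗ[ℝ] V) (w : ℝ)
    (v : EuclideanSpace ℝ (Fin d)) (ℓ : ℕ) : ℝ≥0 :=
  (volume (Metric.ball (0 : EuclideanSpace ℝ (Fin d))
    (dist ((w / volume.real (Metric.ball (0 : EuclideanSpace ℝ (Fin d)) 1)) ^ (1 / (d : ℝ)) •
      (L ^ ℓ) (Φ v)) 0))).toNNReal

/-- The process `N† = ∑_(i,j) ∑_ℓ δ_(T_ij, pileHeight_ℓ(U_ij, V_ij))`, where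
`T_ij = T̄_i0 + ⋯ + T̄_ij` and `V_ij` is a unit vector. All indices start from `0`. -/
def limitREPP {d : ℕ} {V : Type*} [NormedAddCommGroup V] [NormedSpace ℝ V]
    (Φ : EuclideanSpace ℝ (Fin d) ≃ₗᵢ[ℝ] V) (L : V →ₗ[ℝ] V) {Ω : Type*}
    (Tbar U : ℕ → ℕ → Ω → ℝ) (dir : ℕ → ℕ → Ω → EuclideanSpace ℝ (Fin d)) (ω : Ω) :
    Measure (ℝ≥0 × ℝ≥0) :=
  Measure.sum fun q : ℕ × ℕ × ℕ =>
    Measure.dirac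
      ((∑ k ∈ Finset.range (q.2.1 + 1), Tbar q.1 k ω).toNNReal,
        pileHeight Φ L (U q.1 q.2.1 ω) (dir q.1 q.2.1 ω) q.2.2)

/-- `T̄_ij ~ Exp(θ)`, `U_ij` is uniform on `(i, i+1]` (`i ≥ 0`), and `D_ij` takes values in some
space `S` and has the law `κ`; all these variables are independent. -/
structure IsMarkFamily {Ω : Type*} [MeasurableSpace Ω] (P : Measure Ω) {S : Type*}
    [MeasurableSpace S] (θ : ℝ) (κ : Measure S) (Tbar U : ℕ → ℕ → Ω → ℝ)
    (D : ℕ → ℕ → Ω → S) : Prop where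
  measurable_time : ∀ i j, Measurable (Tbar i j)
  measurable_unif : ∀ i j, Measurable (U i j)
  measurable_dir : ∀ i j, Measurable (D i j)
  law_time : ∀ i j, P.map (Tbar i j) = expMeasure θ
  law_unif : ∀ i j, pdf.IsUniform (U i j) (Ioc (i : ℝ) (i + 1)) P volume
  law_dir : ∀ i j, P.map (D i j) = κ
  /-- The triples with different indices are independent, ... -/
  indep_triples : iIndepFun (fun (q : ℕ × ℕ) (ω : Ω) =>
    (Tbar q.1 q.2 ω, U q.1 q.2 ω, D q.1 q.2 ω)) P
  /-- ... and the three members of each triple are independent. -/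
  indep_time : ∀ i j, IndepFun (Tbar i j) (fun ω => (U i j ω, D i j ω)) P
  indep_dir : ∀ i j, IndepFun (U i j) (D i j) P

/-- The uniform law on the unit sphere of `ℝ^d`. -/
def uniformSphere (d : ℕ) : Measure (Metric.sphere (0 : EuclideanSpace ℝ (Fin d)) 1) :=
  cond (volume : Measure (EuclideanSpace ℝ (Fin d))).toSphere univ

/-- The uniform law on `[0, 2π)`. -/
def uniformAngle : Measure ℝ := cond volume (Ico 0 (2 * Real.pi))

/-- The vector `(cos Θ, sin Θ)`, used for `d = 2`. -/
def angleVec (d : ℕ) (t : ℝ) : EuclideanSpace ℝ (Fin d) :=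
  WithLp.toLp 2 fun k : Fin d => if (k : ℕ) = 0 then Real.cos t else Real.sin t

end REPP

end

noncomputable section

namespace REPP

/-! ### Laplace functionals and weak convergence of point processes -/

section Laplace

set_option linter.unusedSectionVars false

variable {E : Type*} [TopologicalSpace E] [T2Space E] [LocallyCompactSpace E]
  [SecondCountableTopology E]

/-! Convergence is proved for Laplace functionals. Let f ≥ 0 be continuous with compact support,
vanishing for times ≥ A. Both E exp(-∫ f dN†) and the limit of E exp(-∫ f dN_n) are shown to be
exp(-θ ∫_0^A Λ(s) ds), where Λ(s) = ∫ (1 - exp(-∑_ℓ f(s, |B_‖L^ℓ v‖|))) dv over ℝ^d (`pileIntegral`)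
and L is DT^p at ζ in orthonormal coordinates (`returnMap`). By `convergesWeakly_of_laplace` this is
enough: the exponentials of countably many test functions embed the space of point measures in a
Hilbert cube, where Stone–Weierstrass and the portmanteau theorem apply, so that neither tightness
nor a complete metric on the space of point measures is needed.

Geometry. A linear change of the manifold chart is isometric to first order at ζ
(`normalChart_bilipschitz`). After dilation by the scale at which μ has mass of order 1/n, n μ
converges to Lebesgue measure because ζ is a Lebesgue point of the density (`tendsto_mass`), T^p
becomes L on bounded sets, and returns at fixed times not divisible by p disappear. The height of a
point becomes the volume of the ball whose boundary passes through its rescaled position, since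
superlevel sets of the observable near ζ are balls and their masses are prescribed by the levels
(`eventually_height_close`). Finally, preimages of cubes have indicators of bounded norm in C₁. All
this is recorded in `IsScalingChart`; the rest of the argument sees the manifold only through this
structure.

Empirical side. Let E_k be the mean of exp(-weights collected from time k on). By invariance,
E_{k+1} - E_k is the integral of (1 - exp(-weight at k)) times the factor of the times strictly
between k and k + t, times the factor from k + t on (`integral_tailFactor_succ_sub`). Choose gaps
t_n → ∞ with t_n = o(n) and n ρ_{t_n} → 0 (`exists_gap`). Summability of ρ makes late returns before
t_n rare (`eventually_sum_returns_le`), so the first two factors are those of a linear orbit, and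
decay of correlations on a partition into small cubes decouples the last one
(`eventually_integral_close`). Hence n (E_{k+1} - E_k) ≈ λ(k/n) E_{k+1}, a discrete linear
differential equation solved by an exponential.

The extremal index appears in the rate λ. The contribution of a visit at v telescopes into a pile
quantity at L v minus one at v; integrating over v and substituting L v yields λ → (1 - 1/|det L|) Λ
= θ Λ (`pileRate_eq`). The repelling hypothesis enters through |det L| > 1, which also makes the
number of visits of a linear orbit to a ball integrable, whatever the expansion in individual
directions.

Limit side. In row i, with rate q_i, the function G(s) = exp(-θ ∫_s^A q_i) solves the renewal
equation for exponential waiting times (`integral_poissonFactor`), so the accumulated weight times G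
at the current arrival is a martingale (`integral_mul_rowFactor`) and the row has Laplace functional
G(0). The variables U and V are polar coordinates with ball volume as radial variable, so the laws
of the starting points of the rows add up to Lebesgue measure (`sum_rowLaw`), the q_i add up to Λ,
and the product over the rows is the same exponential (`integral_exp_neg`). -/

/-- A countable family of nonnegative test functions which approximates all of them, uniformly with
a controlled support. -/
theorem exists_countable_testFunctions :
    ∃ D : Set C_c(E, ℝ), D.Countable ∧ (∀ f ∈ D, 0 ≤ f) ∧
      ∀ f : C_c(E, ℝ), 0 ≤ f → ∃ χ ∈ D, ∀ δ > 0, ∃ g ∈ D, ∀ x, |f x - g x| ≤ δ * χ x := by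
  classical
  let K := CompactExhaustion.choice E
  let S : ℕ → Set C(E, ℝ) := fun m => {c | 0 ≤ c ∧ ∀ x, x ∉ K m → c x = 0}
  have hS : ∀ m (c : S m), HasCompactSupport (c : C(E, ℝ)) := fun m c =>
    HasCompactSupport.intro (K.isCompact m) fun x hx => c.2.2 x hx
  -- In the compact-open topology `C(E, ℝ)` is second countable, so approximants can be taken inside
  -- `S m`, which keeps their supports in `K m`.
  have hdense : ∀ m, ∃ s : Set (S m), s.Countable ∧ Dense s := fun m =>
    TopologicalSpace.exists_countable_dense (S m)
  choose s hsc hsd using hdense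
  have hχ : ∀ m, ∃ χ : C_c(E, ℝ), 0 ≤ χ ∧ ∀ x ∈ K m, χ x = 1 := fun m => by
    obtain ⟨f, hf1, -, hfc, hf01⟩ := exists_continuous_one_zero_of_isCompact (K.isCompact m)
      isClosed_empty (disjoint_empty _)
    exact ⟨⟨f, hfc⟩, fun x => (hf01 x).1, fun x hx => hf1 hx⟩
  choose χ hχ0 hχ1 using hχ
  refine ⟨(⋃ m, (fun c : S m => (⟨(c : C(E, ℝ)), hS m c⟩ : C_c(E, ℝ))) '' s m) ∪ range χ,
    (countable_iUnion fun m => (hsc m).image _).union (countable_range χ), ?_, ?_⟩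
  · rintro f (hf | ⟨m, rfl⟩)
    · obtain ⟨m, c, -, rfl⟩ := mem_iUnion.1 hf
      exact fun x => c.2.1 x
    · exact hχ0 m
  · intro f hf
    obtain ⟨m, hm⟩ : ∃ m, tsupport f ⊆ K m := K.exists_superset_of_isCompact f.hasCompactSupport
    have hfS : (f.toContinuousMap : C(E, ℝ)) ∈ S m :=
      ⟨hf, fun x hx => image_eq_zero_of_notMem_tsupport fun h => hx (hm h)⟩
    refine ⟨χ m, Or.inr ⟨m, rfl⟩, fun δ hδ => ?_⟩
    have hunif := (ContinuousMap.tendsto_iff_forall_isCompact_tendstoUniformlyOn (f := f.toContinuousMap)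
      (F := fun c : C(E, ℝ) => c) (p := 𝓝 f.toContinuousMap)).1 tendsto_id (K m) (K.isCompact m)
    have hnear : ∀ᶠ c : C(E, ℝ) in 𝓝 f.toContinuousMap, ∀ x ∈ K m, dist (f x) (c x) < δ :=
      Metric.tendstoUniformlyOn_iff.1 hunif δ hδ
    have hnear' : ∀ᶠ c : S m in 𝓝 ⟨f.toContinuousMap, hfS⟩,
        ∀ x ∈ K m, dist (f x) ((c : C(E, ℝ)) x) < δ :=
      (continuous_subtype_val.continuousAt (x := (⟨f.toContinuousMap, hfS⟩ : S m))).eventually hnear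
    obtain ⟨c, hcs, hc⟩ := (mem_closure_iff_nhds.1 (hsd m ⟨f.toContinuousMap, hfS⟩) _ hnear')
    refine ⟨⟨c, hS m c⟩, Or.inl (mem_iUnion.2 ⟨m, c, hc, rfl⟩), fun x => ?_⟩
    by_cases hx : x ∈ K m
    · rw [hχ1 m x hx, mul_one]
      exact (hcs x hx).le
    · have h1 : f x = 0 := hfS.2 x hx
      have h2 : (c : C(E, ℝ)) x = 0 := c.2.2 x hx
      simp only [CompactlySupportedContinuousMap.coe_mk, h1, h2, sub_zero, abs_zero]
      exact mul_nonneg hδ.le (hχ0 m x)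

variable [MeasurableSpace E] [BorelSpace E]

theorem PointMeasure.integrable (m : PointMeasure E) (f : C_c(E, ℝ)) : Integrable f m.1 := by
  have : IsFiniteMeasureOnCompacts m.1 := ⟨fun {K} hK => m.2.1 K hK⟩
  exact f.continuous.integrable_of_hasCompactSupport f.hasCompactSupport

theorem PointMeasure.measurable_integral {f : C_c(E, ℝ)} (hf : 0 ≤ f) :
    Measurable fun m : PointMeasure E => ∫ x, f x ∂m.1 := by
  have h : (fun m : PointMeasure E => ∫ x, f x ∂m.1) =
      fun m : PointMeasure E => (∫⁻ x, ENNReal.ofReal (f x) ∂m.1).toReal := by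
    ext m
    exact integral_eq_lintegral_of_nonneg_ae (ae_of_all _ hf)
      f.continuous.aestronglyMeasurable
  rw [h]
  exact ((Measure.measurable_lintegral
    f.continuous.measurable.ennreal_ofReal).comp (comap_measurable _)).ennreal_toReal

/-- The embedding of the space of point measures into a Hilbert cube by the values of
`m ↦ exp (-∫ f dm)`. -/
def laplaceEmbedding (D : Set C_c(E, ℝ)) (hD : ∀ f ∈ D, 0 ≤ f) (m : PointMeasure E) :
    D → unitInterval := fun f =>
  ⟨Real.exp (-∫ x, (f : C_c(E, ℝ)) x ∂m.1), (Real.exp_pos _).le, by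
    rw [Real.exp_le_one_iff, neg_nonpos]
    exact integral_nonneg (hD f f.2)⟩

theorem measurable_laplaceEmbedding (D : Set C_c(E, ℝ)) (hD : ∀ f ∈ D, 0 ≤ f) :
    Measurable (laplaceEmbedding D hD) :=
  measurable_pi_lambda _ fun f => (Measurable.subtype_mk
    (Real.measurable_exp.comp (PointMeasure.measurable_integral (hD f f.2)).neg))

theorem continuous_laplaceEmbedding (D : Set C_c(E, ℝ)) (hD : ∀ f ∈ D, 0 ≤ f) :
    Continuous (laplaceEmbedding D hD) := by
  refine continuous_pi fun f => Continuous.subtype_mk (Real.continuous_exp.comp ?_) _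
  have h : Continuous fun (m : PointMeasure E) (f : C_c(E, ℝ)) => ∫ x, f x ∂m.1 :=
    continuous_induced_dom
  exact ((continuous_apply (f : C_c(E, ℝ))).comp h).neg

/-- For g in `D` the integral is minus the logarithm of a coordinate. For other f ≥ 0 it is
approximated with error at most δ ∫ χ dm, and ∫ χ dm is locally bounded in the pulled-back topology
because χ itself belongs to `D`. -/
theorem isInducing_laplaceEmbedding (D : Set C_c(E, ℝ)) (hD : ∀ f ∈ D, 0 ≤ f)
    (happ : ∀ f : C_c(E, ℝ), 0 ≤ f → ∃ χ ∈ D, ∀ δ > 0, ∃ g ∈ D, ∀ x, |f x - g x| ≤ δ * χ x) :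
    IsInducing (laplaceEmbedding D hD) := by
  refine ⟨le_antisymm (continuous_iff_le_induced.1 (continuous_laplaceEmbedding D hD)) ?_⟩
  refine (continuous_iff_le_induced (t₁ := TopologicalSpace.induced (laplaceEmbedding D hD) _)).1 ?_
  let tt : TopologicalSpace (PointMeasure E) :=
    TopologicalSpace.induced (laplaceEmbedding D hD) inferInstance
  have hcoord : ∀ g ∈ D, @Continuous _ _ tt _ fun m : PointMeasure E => ∫ x, g x ∂m.1 := by
    intro g hg
    have h1 : @Continuous _ _ tt _ (laplaceEmbedding D hD) := continuous_induced_dom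
    have h2 : @Continuous _ _ tt _ fun m : PointMeasure E =>
        ((laplaceEmbedding D hD m ⟨g, hg⟩ : unitInterval) : ℝ) :=
      continuous_subtype_val.comp ((continuous_apply _).comp h1)
    have h3 := (Continuous.log h2 fun m => (Real.exp_pos _).ne').neg
    refine h3.congr fun m => ?_
    simp [laplaceEmbedding]
  have hpos : ∀ f : C_c(E, ℝ), 0 ≤ f →
      @Continuous _ _ tt _ fun m : PointMeasure E => ∫ x, f x ∂m.1 := by
    intro f hf
    obtain ⟨χ, hχ, h⟩ := happ f hf
    have hbd : ∀ δ > 0, ∀ g ∈ D, (∀ x, |f x - g x| ≤ δ * χ x) → ∀ m : PointMeasure E,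
        |∫ x, f x ∂m.1 - ∫ x, g x ∂m.1| ≤ δ * ∫ x, χ x ∂m.1 := by
      intro δ hδ g hg hfg m
      rw [← integral_sub (m.integrable f) (m.integrable g), ← integral_const_mul]
      exact (abs_integral_le_integral_abs).trans (integral_mono_of_nonneg
        (ae_of_all _ fun _ => abs_nonneg _) ((m.integrable χ).const_mul δ) (ae_of_all _ hfg))
    rw [continuous_iff_continuousAt]
    intro m₀
    rw [Metric.continuousAt_iff']
    intro ε hε
    set c := ∫ x, χ x ∂m₀.1 with hc
    have hc0 : 0 ≤ c := integral_nonneg (hD χ hχ)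
    -- Near `m₀` the integral of χ stays below c + 1, so each of the two replacements of f by g
    -- costs less than ε / 3.
    obtain ⟨g, hg, hfg⟩ := h (ε / (3 * (c + 1))) (by positivity)
    have hg' := Metric.continuousAt_iff'.1 ((hcoord g hg).continuousAt (x := m₀)) (ε / 3) (by positivity)
    have hχ' := Metric.continuousAt_iff'.1 ((hcoord χ hχ).continuousAt (x := m₀)) 1 one_pos
    filter_upwards [hg', hχ'] with m h1 h2
    rw [Real.dist_eq] at h1 h2 ⊢
    have h3 := hbd _ (by positivity) g hg hfg m
    have h4 := hbd _ (by positivity) g hg hfg m₀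
    have h5 : ε / (3 * (c + 1)) * ∫ x, χ x ∂m.1 < ε / 3 := by
      have : ∫ x, χ x ∂m.1 < c + 1 := by linarith [(abs_lt.1 h2).2]
      calc _ < ε / (3 * (c + 1)) * (c + 1) := by gcongr
        _ = ε / 3 := by field_simp
    have h6 : ε / (3 * (c + 1)) * c < ε / 3 := by
      calc _ < ε / (3 * (c + 1)) * (c + 1) := by gcongr; linarith
        _ = ε / 3 := by field_simp
    rw [abs_lt] at h1 ⊢
    rw [abs_le] at h3 h4
    constructor <;> linarith
  refine continuous_pi fun f => ?_
  let fp : C_c(E, ℝ) := f ⊔ 0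
  let fm : C_c(E, ℝ) := (-f) ⊔ 0
  have h1 := (hpos fp fun x => le_max_right _ _).sub (hpos fm fun x => le_max_right _ _)
  refine h1.congr fun m => ?_
  change ∫ x, fp x ∂m.1 - ∫ x, fm x ∂m.1 = _
  rw [← integral_sub (m.integrable fp) (m.integrable fm)]
  refine integral_congr_ae (ae_of_all _ fun x => ?_)
  change max (f x) 0 - max (-f x) 0 = f x
  rcases le_total 0 (f x) with h | h
  · rw [max_eq_left h, max_eq_right (by linarith)]; ring
  · rw [max_eq_right h, max_eq_left (by linarith)]; ring

/-- Every open set is the preimage of an open subset of a countable product of intervals under a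
measurable map. -/
instance : OpensMeasurableSpace (PointMeasure E) := by
  obtain ⟨D, hDc, hD, happ⟩ := exists_countable_testFunctions (E := E)
  have : Countable D := hDc.to_subtype
  refine ⟨MeasurableSpace.generateFrom_le fun s hs => ?_⟩
  obtain ⟨t, ht, rfl⟩ := (isInducing_laplaceEmbedding D hD happ).isOpen_iff.1 hs
  exact measurable_laplaceEmbedding D hD ht.measurableSet

/-- Monomials span the algebra generated by the coordinates, which is uniformly dense by
Stone–Weierstrass since the cube is compact. -/
theorem tendsto_integral_of_laplace_cube {ι : Type*} [Countable ι]
    (ν : ℕ → ProbabilityMeasure (ι → unitInterval)) (ν' : ProbabilityMeasure (ι → unitInterval))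
    (h : ∀ G ∈ Submonoid.closure (range fun (i : ι) =>
        (⟨fun y => (y i : ℝ), by fun_prop⟩ : C(ι → unitInterval, ℝ))),
      Tendsto (fun n => ∫ y, G y ∂(ν n : Measure (ι → unitInterval))) atTop
        (𝓝 (∫ y, G y ∂(ν' : Measure (ι → unitInterval))))) :
    Tendsto ν atTop (𝓝 ν') := by
  set coord : ι → C(ι → unitInterval, ℝ) := fun i => ⟨fun y => (y i : ℝ), by fun_prop⟩ with hcoord
  have hint : ∀ (G : C(ι → unitInterval, ℝ)) (κ : ProbabilityMeasure (ι → unitInterval)),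
      Integrable G (κ : Measure (ι → unitInterval)) := fun G κ =>
    (BoundedContinuousFunction.mkOfCompact G).integrable _
  have hspan : ∀ G ∈ Submodule.span ℝ (Submonoid.closure (range coord) : Set C(ι → unitInterval, ℝ)),
      Tendsto (fun n => ∫ y, G y ∂(ν n : Measure (ι → unitInterval))) atTop
        (𝓝 (∫ y, G y ∂(ν' : Measure (ι → unitInterval)))) := by
    intro G hG
    induction hG using Submodule.span_induction with
    | mem G hG => exact h G hG
    | zero => simp
    | add G₁ G₂ _ _ h₁ h₂ =>
      have : ∀ κ : ProbabilityMeasure (ι → unitInterval),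
          ∫ y, (G₁ + G₂) y ∂(κ : Measure (ι → unitInterval)) =
            ∫ y, G₁ y ∂(κ : Measure (ι → unitInterval)) +
            ∫ y, G₂ y ∂(κ : Measure (ι → unitInterval)) :=
        fun κ => integral_add (hint G₁ κ) (hint G₂ κ)
      simp only [this]
      exact h₁.add h₂
    | smul a G _ h₁ =>
      have : ∀ κ : ProbabilityMeasure (ι → unitInterval),
          ∫ y, (a • G) y ∂(κ : Measure (ι → unitInterval)) =
            a * ∫ y, G y ∂(κ : Measure (ι → unitInterval)) :=
        fun κ => integral_const_mul a _
      simp only [this]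
      exact h₁.const_mul a
  have hsep : (Algebra.adjoin ℝ (range coord)).SeparatesPoints := by
    intro y z hyz
    obtain ⟨i, hi⟩ := Function.ne_iff.1 hyz
    exact ⟨coord i, ⟨coord i, Algebra.subset_adjoin (mem_range_self i), rfl⟩,
      fun h => hi (Subtype.ext h)⟩
  have hdense := ContinuousMap.subalgebra_topologicalClosure_eq_top_of_separatesPoints _ hsep
  refine ProbabilityMeasure.tendsto_iff_forall_integral_tendsto.2 fun F => ?_
  rw [Metric.tendsto_atTop]
  intro ε hε
  have hF : F.toContinuousMap ∈ (Algebra.adjoin ℝ (range coord)).topologicalClosure := by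
    rw [hdense]; exact Algebra.mem_top
  obtain ⟨G, hG, hFG⟩ := Metric.mem_closure_iff.1 hF (ε / 3) (by positivity)
  have hG' : G ∈ Submodule.span ℝ (Submonoid.closure (range coord) : Set C(ι → unitInterval, ℝ)) := by
    rw [← Algebra.adjoin_eq_span]; exact hG
  have hbd : ∀ κ : ProbabilityMeasure (ι → unitInterval),
      |∫ y, F y ∂(κ : Measure (ι → unitInterval)) - ∫ y, G y ∂(κ : Measure (ι → unitInterval))|
        ≤ ε / 3 := by
    intro κ
    rw [← integral_sub (F.integrable (κ : Measure (ι → unitInterval))) (hint G κ)]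
    have h1 : ∀ y, ‖F y - G y‖ ≤ ε / 3 := fun y =>
      (ContinuousMap.dist_apply_le_dist (f := F.toContinuousMap) (g := G) y).trans hFG.le
    have h2 := norm_integral_le_of_norm_le_const (μ := (κ : Measure (ι → unitInterval)))
      (ae_of_all _ h1)
    simpa using h2
  obtain ⟨N, hN⟩ := Metric.tendsto_atTop.1 (hspan G hG') (ε / 3) (by positivity)
  refine ⟨N, fun n hn => ?_⟩
  have h1 := hbd (ν n)
  have h2 := hbd ν'
  have h3 := hN n hn
  rw [Real.dist_eq] at h3 ⊢
  rw [abs_lt] at h3 ⊢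
  rw [abs_le] at h1 h2
  constructor <;> linarith

theorem toPointMeasure_val [Nonempty E] {m : Measure E} (hm : IsRadonPointMeasure m) :
    (toPointMeasure m).1 = m := by
  have : toPointMeasure m = ⟨m, hm⟩ := dif_pos hm
  rw [this]

theorem integral_map_toPointMeasure [Nonempty E] {Ω : Type*} [MeasurableSpace Ω] {P : Measure Ω}
    {M : Ω → Measure E} (hM : IsPointProcess P M) {G : PointMeasure E → ℝ} (hG : Measurable G)
    {f : C_c(E, ℝ)} (hGf : ∀ m : PointMeasure E, G m = Real.exp (-∫ x, f x ∂m.1)) :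
    ∫ m, G m ∂(P.map fun ω => toPointMeasure (M ω)) = ∫ ω, Real.exp (-∫ x, f x ∂(M ω)) ∂P := by
  rw [integral_map hM.2 hG.aestronglyMeasurable]
  refine integral_congr_ae ?_
  filter_upwards [hM.1] with ω hω
  rw [hGf, toPointMeasure_val hω]

/-- Convergence of the Laplace functionals implies weak convergence of point processes. -/
theorem convergesWeakly_of_laplace [Nonempty E] {Ω₁ Ω₂ : Type*} [MeasurableSpace Ω₁]
    [MeasurableSpace Ω₂] {P₁ : Measure Ω₁} [IsProbabilityMeasure P₁] {P₂ : Measure Ω₂}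
    [IsProbabilityMeasure P₂] {Nn : ℕ → Ω₁ → Measure E} {N : Ω₂ → Measure E}
    (hNn : ∀ n, 1 ≤ n → IsPointProcess P₁ (Nn n)) (hN : IsPointProcess P₂ N)
    (h : ∀ f : C_c(E, ℝ), 0 ≤ f →
      Tendsto (fun n => ∫ ω, Real.exp (-∫ x, f x ∂(Nn n ω)) ∂P₁) atTop
        (𝓝 (∫ ω, Real.exp (-∫ x, f x ∂(N ω)) ∂P₂))) :
    ConvergesWeakly P₁ Nn P₂ N := by
  obtain ⟨D, hDc, hD, happ⟩ := exists_countable_testFunctions (E := E)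
  have : Countable D := hDc.to_subtype
  set Ψ := laplaceEmbedding D hD with hΨ
  have hΨm : Measurable Ψ := measurable_laplaceEmbedding D hD
  -- Only the indices n ≥ 1 are known to give point processes (for n = 0 the convention j / 0 = 0
  -- puts all points at time 0), hence the shift by one.
  let κ : ℕ → ProbabilityMeasure (PointMeasure E) := fun n =>
    ⟨P₁.map fun ω => toPointMeasure (Nn (n + 1) ω),
      Measure.isProbabilityMeasure_map (hNn (n + 1) (by omega)).2⟩
  let κ' : ProbabilityMeasure (PointMeasure E) :=
    ⟨P₂.map fun ω => toPointMeasure (N ω), Measure.isProbabilityMeasure_map hN.2⟩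
  -- The product of the exponentials of f₁ and f₂ is that of f₁ + f₂, so monomials in the
  -- coordinates are again Laplace functionals.
  have hmono : ∀ G ∈ Submonoid.closure (range fun (i : D) =>
        (⟨fun y => (y i : ℝ), by fun_prop⟩ : C(D → unitInterval, ℝ))),
      ∃ f : C_c(E, ℝ), 0 ≤ f ∧ ∀ m : PointMeasure E, G (Ψ m) = Real.exp (-∫ x, f x ∂m.1) := by
    intro G hG
    induction hG using Submonoid.closure_induction with
    | mem G hG =>
      obtain ⟨i, rfl⟩ := hG
      exact ⟨i, hD i i.2, fun m => rfl⟩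
    | one => exact ⟨0, le_rfl, fun m => by simp⟩
    | mul G₁ G₂ _ _ h₁ h₂ =>
      obtain ⟨f₁, hf₁, h₁⟩ := h₁
      obtain ⟨f₂, hf₂, h₂⟩ := h₂
      refine ⟨f₁ + f₂, fun x => add_nonneg (hf₁ x) (hf₂ x), fun m => ?_⟩
      have : ∫ x, (f₁ + f₂) x ∂m.1 = ∫ x, f₁ x ∂m.1 + ∫ x, f₂ x ∂m.1 :=
        integral_add (m.integrable f₁) (m.integrable f₂)
      rw [ContinuousMap.mul_apply, h₁, h₂, this, neg_add, Real.exp_add]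
  have hcube : Tendsto (fun n => (κ n).map hΨm.aemeasurable) atTop
      (𝓝 (κ'.map hΨm.aemeasurable)) := by
    refine tendsto_integral_of_laplace_cube _ _ fun G hG => ?_
    obtain ⟨f, hf, hGf⟩ := hmono G hG
    have h2 := (tendsto_add_atTop_iff_nat 1).2 (h f hf)
    have hGm : Measurable fun m => G (Ψ m) := G.continuous.measurable.comp hΨm
    have e : ∀ κ₀ : ProbabilityMeasure (PointMeasure E),
        ∫ y, G y ∂((κ₀.map hΨm.aemeasurable : ProbabilityMeasure _) : Measure (D → unitInterval)) =
          ∫ m, G (Ψ m) ∂(κ₀ : Measure (PointMeasure E)) := fun κ₀ => by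
      rw [ProbabilityMeasure.toMeasure_map]
      exact integral_map hΨm.aemeasurable G.continuous.aestronglyMeasurable
    have e2 : ∫ m, G (Ψ m) ∂(κ' : Measure (PointMeasure E)) = _ :=
      integral_map_toPointMeasure hN hGm hGf
    have e3 : ∀ n, ∫ m, G (Ψ m) ∂(κ n : Measure (PointMeasure E)) = _ := fun n =>
      integral_map_toPointMeasure (hNn (n + 1) (by omega)) hGm hGf
    simpa only [e, e2, e3] using h2
  have hκ : Tendsto κ atTop (𝓝 κ') := by
    -- The portmanteau criterion for open sets pulls back along an inducing map, so nothing has to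
    -- be known about the image of the embedding.
    refine tendsto_of_forall_isOpen_le_liminf_nat' fun G hG => ?_
    obtain ⟨t, ht, rfl⟩ := (isInducing_laplaceEmbedding D hD happ).isOpen_iff.1 hG
    have h1 := ProbabilityMeasure.le_liminf_measure_open_of_tendsto hcube ht
    have e : ∀ κ₀ : ProbabilityMeasure (PointMeasure E),
        ((κ₀.map hΨm.aemeasurable : ProbabilityMeasure _) : Measure (D → unitInterval)) t =
          (κ₀ : Measure (PointMeasure E)) (Ψ ⁻¹' t) := fun κ₀ => by
      rw [ProbabilityMeasure.toMeasure_map, Measure.map_apply hΨm ht.measurableSet]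
    simpa only [e] using h1
  intro F
  have h3 := ProbabilityMeasure.tendsto_iff_forall_integral_tendsto.1 hκ F
  refine (tendsto_add_atTop_iff_nat 1).1 ?_
  have e4 : ∫ m, F m ∂(κ' : Measure (PointMeasure E)) = ∫ ω, F (toPointMeasure (N ω)) ∂P₂ :=
    integral_map hN.2 F.continuous.measurable.aestronglyMeasurable
  have e5 : ∀ n, ∫ m, F m ∂(κ n : Measure (PointMeasure E)) =
      ∫ ω, F (toPointMeasure (Nn (n + 1) ω)) ∂P₁ := fun n =>
    integral_map (hNn (n + 1) (by omega)).2 F.continuous.measurable.aestronglyMeasurable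
  simpa only [e4, e5] using h3

end Laplace

end REPP

end

noncomputable section

namespace REPP

/-! ### Charts that are almost isometric at a point -/

section Hausdorff

variable {X Y : Type*} [EMetricSpace X] [MeasurableSpace X] [BorelSpace X]
  [EMetricSpace Y] [MeasurableSpace Y] [BorelSpace Y] {d : ℕ} {A : Set X} {f : X → Y} {K : ℝ≥0}

/-- The Euclidean normalisation constant is the same on both spaces, so the Lipschitz comparison of
Hausdorff measures carries over with the factor `K ^ d`. -/
theorem euclideanHausdorffMeasure_le_image
    (h : ∀ x ∈ A, ∀ y ∈ A, edist x y ≤ K * edist (f x) (f y)) :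
    (Measure.euclideanHausdorffMeasure d : Measure X) A ≤
      K ^ d * (Measure.euclideanHausdorffMeasure d : Measure Y) (f '' A) := by
  have hanti : AntilipschitzWith K fun x : A => f x := fun x y => h x x.2 y y.2
  have h1 := hanti.le_hausdorffMeasure_image (d := d) (by positivity) univ
  have h2 : Measure.hausdorffMeasure (d : ℝ) (univ : Set A) = Measure.hausdorffMeasure (d : ℝ) A := by
    rw [← isometry_subtype_coe.hausdorffMeasure_image (Or.inl (by positivity)), image_univ,
      Subtype.range_coe]
  have h3 : (fun x : A => f x) '' univ = f '' A := by
    rw [image_univ, image_eq_range]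
  rw [h2, h3, ENNReal.rpow_natCast] at h1
  simp only [Measure.euclideanHausdorffMeasure_def, Measure.smul_apply]
  rw [ENNReal.smul_def, ENNReal.smul_def, smul_eq_mul, smul_eq_mul, mul_left_comm]
  gcongr

theorem euclideanHausdorffMeasure_image_le
    (h : ∀ x ∈ A, ∀ y ∈ A, edist (f x) (f y) ≤ K * edist x y) :
    (Measure.euclideanHausdorffMeasure d : Measure Y) (f '' A) ≤
      K ^ d * (Measure.euclideanHausdorffMeasure d : Measure X) A := by
  have hlip : LipschitzOnWith K f A := fun x hx y hy => h x hx y hy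
  have h1 := hlip.hausdorffMeasure_image_le (d := d) (by positivity)
  rw [ENNReal.rpow_natCast] at h1
  simp only [Measure.euclideanHausdorffMeasure_def, Measure.smul_apply]
  rw [ENNReal.smul_def, ENNReal.smul_def, smul_eq_mul, smul_eq_mul, mul_left_comm]
  gcongr

end Hausdorff

/-! ### Riemannian distance, volume and the return map in coordinates at a point. -/

section Geometry

set_option linter.unusedSectionVars false

open Manifold

variable {F : Type*} [NormedAddCommGroup F] [NormedSpace ℝ F]
  {H : Type*} [TopologicalSpace H] (I : ModelWithCorners ℝ F H)
  {X : Type*} [MetricSpace X] [ChartedSpace H X] [IsManifold I 1 X]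
  [Bundle.RiemannianBundle (fun x : X => TangentSpace I x)]
  [IsContinuousRiemannianBundle F (fun x : X => TangentSpace I x)]
  [IsRiemannianManifold I X]
  {G : Type*} [NormedAddCommGroup G] [NormedSpace ℝ G]

/-- The metric is continuous, so norms of vectors at y and at ζ, compared through the trivialization
at ζ, are close for y near ζ; that trivialization at y is the derivative of the chart. -/
theorem eventually_norm_mfderiv_chart_le (ζ : X) {r : ℝ} (hr : 1 < r) : ∀ᶠ y in 𝓝 ζ, ∀ v : TangentSpace I y,
   ‖(show TangentSpace I ζ from (mfderiv I 𝓘(ℝ, F) (extChartAt I ζ) y v : F))‖ ≤ r * ‖v‖ := by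
  have h := eventually_norm_symmL_trivializationAt_self_comp_lt F (fun x : X => TangentSpace I x) ζ hr
  filter_upwards [h, chart_source_mem_nhds H ζ] with y hy h'y v
  have h1 := ContinuousLinearMap.le_of_opNorm_le _ hy.le v
  have h2 : (trivializationAt F (TangentSpace I) ζ).symmL ℝ ζ = ContinuousLinearMap.id ℝ F := by
    rw [TangentBundle.symmL_trivializationAt_eq_core (by simp)]
    ext v
    exact (tangentBundleCore I X).coordChange_self _ _ (by simp) v
  have h3 := TangentBundle.continuousLinearMapAt_trivializationAt (I := I) h'y
  rw [ContinuousLinearMap.comp_apply, h3] at h1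
  have h4 := congrArg (fun A : F →L[ℝ] F => A (mfderiv I 𝓘(ℝ, F) (extChartAt I ζ) y v : F)) h2
  exact (congrArg (fun w : TangentSpace I ζ => ‖w‖) h4.symm).trans_le h1

theorem eventually_norm_mfderivWithin_chart_symm_le (ζ : X) {r : ℝ} (hr : 1 < r) : ∀ᶠ z in 𝓝[range I] (extChartAt I ζ ζ), ∀ v : TangentSpace I ζ,
   ‖(mfderivWithin 𝓘(ℝ, F) I (extChartAt I ζ).symm (range I) z (show F from v))‖ ≤ r * ‖v‖ := by
  have h := eventually_norm_symmL_trivializationAt_comp_self_lt F (fun x : X => TangentSpace I x) ζ hr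
  have hc : Tendsto (extChartAt I ζ).symm (𝓝[range I] (extChartAt I ζ ζ)) (𝓝 ζ) := by
    have := (continuousAt_extChartAt_symm (I := I) ζ).tendsto
    rw [extChartAt_to_inv] at this
    exact this.mono_left nhdsWithin_le_nhds
  filter_upwards [hc.eventually h, hc.eventually (chart_source_mem_nhds H ζ), extChartAt_target_mem_nhdsWithin (I := I) ζ] with z hy h'y hz v
  have h1 := ContinuousLinearMap.le_of_opNorm_le _ hy.le v
  have h3 : (trivializationAt F (TangentSpace I) ζ).continuousLinearMapAt ℝ ζ = ContinuousLinearMap.id ℝ F := by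
    rw [TangentBundle.continuousLinearMapAt_trivializationAt_eq_core (by simp)]
    ext v
    exact (tangentBundleCore I X).coordChange_self _ _ (by simp) v
  have h2 := TangentBundle.symmL_trivializationAt (I := I) h'y
  rw [ContinuousLinearMap.comp_apply] at h1
  have A : (extChartAt I ζ) ((extChartAt I ζ).symm z) = z := (extChartAt I ζ).right_inv hz
  have h4 := congrArg (fun A : F →L[ℝ] F => A (show F from v)) h3
  have h5 : (show F from mfderivWithin 𝓘(ℝ, F) I (extChartAt I ζ).symm (range I) z (show F from v))
    = (mfderivWithin 𝓘(ℝ, F) I (extChartAt I ζ).symm (range I) (extChartAt I ζ ((extChartAt I ζ).symm z)) (show F from v)) := by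
    rw [A]
  have h6 : (show F from mfderivWithin 𝓘(ℝ, F) I (extChartAt I ζ).symm (range I) z (show F from v))
    = (trivializationAt F (TangentSpace I) ζ).symmL ℝ ((extChartAt I ζ).symm z) ((trivializationAt F (TangentSpace I) ζ).continuousLinearMapAt ℝ ζ v) := by
    refine h5.trans ?_
    rw [h2]
    exact congrArg _ h4.symm
  exact (congrArg (fun w : TangentSpace I ((extChartAt I ζ).symm z) => ‖w‖) h6).trans_le h1
-- The inverse chart maps the segment between the two coordinate points to a curve whose length
-- bounds the distance. The segment stays in the chart because the intersection of a ball with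
-- `range I` is convex, also at the boundary.
theorem exists_nhds_edist_le (ζ : X) (A : F →L[ℝ] G) (C : ℝ≥0)
    (hC : ∀ᶠ z in 𝓝[range I] (extChartAt I ζ ζ), ∀ v : F,
      ‖mfderivWithin 𝓘(ℝ, F) I (extChartAt I ζ).symm (range I) z v‖ₑ ≤ C * ‖A v‖ₑ) :
    ∃ U ∈ 𝓝 ζ, ∀ x ∈ U, ∀ y ∈ U,
      edist x y ≤ C * edist (A (extChartAt I ζ x)) (A (extChartAt I ζ y)) := by
  obtain ⟨r, r_pos, hr⟩ := Metric.mem_nhdsWithin_iff.1 (inter_mem (extChartAt_target_mem_nhdsWithin ζ) hC)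
  have hU : (extChartAt I ζ) ⁻¹' (Metric.ball (extChartAt I ζ ζ) r ∩ range I) ∈ 𝓝 ζ := by
    apply extChartAt_preimage_mem_nhds_of_mem_nhdsWithin (by simp)
    rw [inter_comm]
    exact inter_mem_nhdsWithin _ (Metric.ball_mem_nhds _ r_pos)
  refine ⟨_, inter_mem hU (chart_source_mem_nhds H ζ), ?_⟩
  rintro x ⟨hx, h'x⟩ y ⟨hy, h'y⟩
  let η := ContinuousAffineMap.lineMap (R := ℝ) (extChartAt I ζ x) (extChartAt I ζ y)
  set γ := (extChartAt I ζ).symm ∘ η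
  have hη : ∀ t ∈ Icc (0 : ℝ) 1, η t ∈ Metric.ball (extChartAt I ζ ζ) r ∩ range I := by
    intro t ht
    refine ((convex_ball _ _).inter I.convex_range).segment_subset hx hy ?_
    rw [segment_eq_image_lineMap]
    exact ⟨t, ht, by simp [η, ContinuousAffineMap.coe_lineMap_eq]⟩
  have hη1 : MapsTo η (Icc 0 1) (extChartAt I ζ).target := fun t ht => (hr (hη t ht)).1
  have η_smooth : ContMDiffOn 𝓘(ℝ, ℝ) 𝓘(ℝ, F) 1 η (Icc 0 1) := by
    apply ContMDiff.contMDiffOn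
    rw [contMDiff_iff_contDiff]
    exact ContinuousAffineMap.contDiff _
  have hle : edist x y ≤ pathELength I γ 0 1 := by
    rw [IsRiemannianManifold.out (I := I) x y]
    apply riemannianEDist_le_pathELength _ _ _ zero_le_one
    · exact (contMDiffOn_extChartAt_symm ζ).comp η_smooth hη1
    · simp [γ, η, ContinuousAffineMap.coe_lineMap_eq, h'x]
    · simp [γ, η, ContinuousAffineMap.coe_lineMap_eq, h'y]
  refine hle.trans ?_
  rw [pathELength_eq_lintegral_mfderivWithin_Icc]
  have hbound : ∀ t ∈ Icc (0 : ℝ) 1, ‖mfderivWithin 𝓘(ℝ, ℝ) I γ (Icc 0 1) t 1‖ₑ ≤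
      C * edist (A (extChartAt I ζ x)) (A (extChartAt I ζ y)) := by
    intro t ht
    have h1 : mfderivWithin 𝓘(ℝ, ℝ) I γ (Icc 0 1) t =
        (mfderivWithin 𝓘(ℝ, F) I (extChartAt I ζ).symm (range I) (η t)) ∘L
          (mfderivWithin 𝓘(ℝ, ℝ) 𝓘(ℝ, F) η (Icc 0 1) t) := by
      apply mfderivWithin_comp
      · exact mdifferentiableWithinAt_extChartAt_symm (hη1 ht)
      · exact η_smooth.mdifferentiableOn one_ne_zero t ht
      · exact fun t ht => (hη t ht).2
      · rw [uniqueMDiffWithinAt_iff_uniqueDiffWithinAt]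
        exact uniqueDiffOn_Icc zero_lt_one t ht
    have h2 : mfderivWithin 𝓘(ℝ, ℝ) I γ (Icc 0 1) t 1 =
        (mfderivWithin 𝓘(ℝ, F) I (extChartAt I ζ).symm (range I) (η t))
          (mfderivWithin 𝓘(ℝ, ℝ) 𝓘(ℝ, F) η (Icc 0 1) t 1) := congr($h1 1)
    have hline : ∀ a b : F, fderiv ℝ (ContinuousAffineMap.lineMap (R := ℝ) a b) t 1 = b - a := by
      simp
    have h3 : (show F from mfderivWithin 𝓘(ℝ, ℝ) 𝓘(ℝ, F) η (Icc 0 1) t (1 : ℝ)) =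
        extChartAt I ζ y - extChartAt I ζ x := by
      change (mfderivWithin 𝓘(ℝ, ℝ) 𝓘(ℝ, F) η (Icc 0 1) t : ℝ →L[ℝ] F) 1 = _
      rw [mfderivWithin_eq_fderivWithin, fderivWithin_eq_fderiv (uniqueDiffOn_Icc zero_lt_one _ ht)
        (ContinuousAffineMap.differentiableAt _)]
      exact hline _ _
    rw [h2]
    refine ((hr (hη t ht)).2 _).trans ?_
    rw [edist_comm, edist_eq_enorm_sub, ← map_sub]
    exact le_of_eq (congrArg (fun w : F => (C : ℝ≥0∞) * ‖A w‖ₑ) h3)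
  refine (setLIntegral_mono' measurableSet_Icc hbound).trans ?_
  simp

/-- An almost length-minimising curve is pushed into the linear coordinates, where its length bounds
the distance of the endpoints. -/
theorem exists_nhds_edist_ge (ζ : X) (A : F →L[ℝ] G) (C : ℝ≥0)
    (hC : ∀ᶠ y in 𝓝 ζ, ∀ v : TangentSpace I y,
      ‖A (mfderiv I 𝓘(ℝ, F) (extChartAt I ζ) y v)‖ₑ ≤ C * ‖v‖ₑ) :
    ∃ U ∈ 𝓝 ζ, ∀ x ∈ U, ∀ y ∈ U,
      edist (A (extChartAt I ζ x)) (A (extChartAt I ζ y)) ≤ C * edist x y := by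
  obtain ⟨r, r_pos, hr⟩ := EMetric.mem_nhds_iff.1 (inter_mem (chart_source_mem_nhds H ζ) hC)
  -- Two points within r / 3 of ζ are joined by a curve of length below 2r / 3, which cannot leave
  -- the ball of radius r in which the derivative is controlled.
  refine ⟨Metric.eball ζ (r / 3), Metric.eball_mem_nhds _ (ENNReal.div_pos r_pos.ne' (by simp)),
    fun x hx y hy => ?_⟩
  have hxy : edist x y < r / 3 + r / 3 :=
    (edist_triangle_right x y ζ).trans_lt (ENNReal.add_lt_add hx hy)
  have hr3 : r / 3 + (r / 3 + r / 3) = r := by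
    rw [← add_assoc]; exact ENNReal.add_thirds r
  refine le_of_forall_gt fun s hs => ?_
  obtain ⟨s', hs', hs's⟩ : ∃ s', edist x y < s' ∧ C * s' < s := by
    have hcont : Tendsto (fun s' : ℝ≥0∞ => C * s') (𝓝[>] (edist x y)) (𝓝 (C * edist x y)) :=
      (ENNReal.Tendsto.const_mul tendsto_id (Or.inr ENNReal.coe_ne_top)).mono_left nhdsWithin_le_nhds
    have hne : (𝓝[>] (edist x y)).NeBot := nhdsGT_neBot_of_exists_gt ⟨_, hxy⟩
    obtain ⟨s', h1, h2⟩ := ((hcont.eventually (gt_mem_nhds hs)).and self_mem_nhdsWithin).exists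
    exact ⟨s', h2, h1⟩
  have hmin : riemannianEDist I x y < min s' (r / 3 + r / 3) := by
    rw [← IsRiemannianManifold.out (I := I) x y]; exact lt_min hs' hxy
  obtain ⟨γ, h0, h1, γ_smooth, hγ⟩ := exists_lt_of_riemannianEDist_lt hmin
  have hmem : ∀ t ∈ Icc (0 : ℝ) 1, γ t ∈ Metric.eball ζ r := by
    intro t ht
    have h2 : edist x (γ t) ≤ pathELength I γ 0 1 := by
      rw [IsRiemannianManifold.out (I := I) x (γ t)]
      exact (riemannianEDist_le_pathELength (γ_smooth.mono (Icc_subset_Icc le_rfl ht.2)) h0 rfl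
        ht.1).trans (pathELength_mono le_rfl ht.2)
    rw [Metric.mem_eball, edist_comm, ← hr3]
    refine (edist_triangle ζ x (γ t)).trans_lt (ENNReal.add_lt_add ?_ ?_)
    · rw [edist_comm]; exact hx
    · exact h2.trans_lt (hγ.trans_le (min_le_right _ _))
  let γ' : ℝ → G := A ∘ extChartAt I ζ ∘ γ
  have hγ1 : ContMDiffOn 𝓘(ℝ, ℝ) 𝓘(ℝ, F) 1 (extChartAt I ζ ∘ γ) (Icc 0 1) :=
    contMDiffOn_extChartAt.comp (I' := I) (t := (chartAt H ζ).source) γ_smooth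
      (fun t ht => (hr (hmem t ht)).1)
  have hγ2 : ContDiffOn ℝ 1 γ' (Icc 0 1) :=
    A.contDiff.comp_contDiffOn (contMDiffOn_iff_contDiffOn.1 hγ1)
  have hlen : ‖γ' 1 - γ' 0‖ₑ ≤ C * pathELength I γ 0 1 := by
    refine (enorm_sub_le_lintegral_derivWithin_Icc_of_contDiffOn_Icc hγ2 zero_le_one).trans ?_
    rw [pathELength_eq_lintegral_mfderivWithin_Icc, ← lintegral_const_mul' _ _ ENNReal.coe_ne_top]
    refine setLIntegral_mono' measurableSet_Icc fun t ht => ?_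
    have hu := uniqueDiffOn_Icc (zero_lt_one (α := ℝ)) t ht
    have e1 : mfderivWithin 𝓘(ℝ, ℝ) 𝓘(ℝ, F) (extChartAt I ζ ∘ γ) (Icc 0 1) t =
        (mfderiv I 𝓘(ℝ, F) (extChartAt I ζ) (γ t)) ∘L (mfderivWithin 𝓘(ℝ, ℝ) I γ (Icc 0 1) t) := by
      apply mfderiv_comp_mfderivWithin
      · exact mdifferentiableAt_extChartAt (hr (hmem t ht)).1
      · exact γ_smooth.mdifferentiableOn one_ne_zero t ht
      · rw [uniqueMDiffWithinAt_iff_uniqueDiffWithinAt]; exact hu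
    have e2 : derivWithin γ' (Icc 0 1) t =
        A (mfderiv I 𝓘(ℝ, F) (extChartAt I ζ) (γ t) (mfderivWithin 𝓘(ℝ, ℝ) I γ (Icc 0 1) t 1)) := by
      have hd : DifferentiableWithinAt ℝ (extChartAt I ζ ∘ γ) (Icc 0 1) t :=
        (contMDiffOn_iff_contDiffOn.1 hγ1).differentiableOn one_ne_zero t ht
      have e3 : derivWithin γ' (Icc 0 1) t = A (derivWithin (extChartAt I ζ ∘ γ) (Icc 0 1) t) :=
        A.hasFDerivAt.comp_hasDerivWithinAt t hd.hasDerivWithinAt |>.derivWithin hu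
      rw [e3, ← fderivWithin_derivWithin, ← mfderivWithin_eq_fderivWithin]
      exact congrArg A (congrArg (fun B : ℝ →L[ℝ] F => B 1) e1)
    rw [e2]
    exact (hr (hmem t ht)).2 _
  have e4 : edist (A (extChartAt I ζ x)) (A (extChartAt I ζ y)) = ‖γ' 1 - γ' 0‖ₑ := by
    rw [edist_comm, edist_eq_enorm_sub]; simp [γ', h0, h1]
  rw [e4]
  refine (hlen.trans ?_).trans_lt hs's
  gcongr
  exact (hγ.trans_le (min_le_left _ _)).le

variable [FiniteDimensional ℝ F] {d : ℕ} {ζ : X}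
  (Φ : EuclideanSpace ℝ (Fin d) ≃ₗᵢ[ℝ] TangentSpace I ζ)

/-- The linear coordinates on the model space given by Euclidean coordinates on a tangent space. -/
def tangentCoord : F ≃L[ℝ] EuclideanSpace ℝ (Fin d) :=
  -- The tangent space is `F` as a vector space, with the Riemannian norm at ζ instead of the norm
  -- of `F`; as a map on `F` the isometry is only a linear homeomorphism.
  LinearEquiv.toContinuousLinearEquiv
    (show F ≃ₗ[ℝ] EuclideanSpace ℝ (Fin d) from Φ.symm.toLinearEquiv)

theorem norm_tangentCoord (v : TangentSpace I ζ) : ‖tangentCoord I Φ (show F from v)‖ = ‖v‖ :=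
  Φ.symm.norm_map v

/-- Coordinates around `ζ` in which the metric at `ζ` is the Euclidean one. -/
def normalChart (x : X) : EuclideanSpace ℝ (Fin d) :=
  tangentCoord I Φ (extChartAt I ζ x - extChartAt I ζ ζ)

theorem normalChart_self : normalChart I Φ ζ = 0 := by simp [normalChart]

theorem normalChart_bilipschitz {ε : ℝ} (hε : 0 < ε) :
    ∃ U ∈ 𝓝 ζ, ∀ x ∈ U, ∀ y ∈ U,
      dist x y ≤ (1 + ε) * ‖normalChart I Φ x - normalChart I Φ y‖ ∧
      ‖normalChart I Φ x - normalChart I Φ y‖ ≤ (1 + ε) * dist x y := by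
  set C : ℝ≥0 := ⟨1 + ε, by positivity⟩ with hCdef
  have H₁ : ∀ᶠ z in 𝓝[range I] (extChartAt I ζ ζ), ∀ v : F,
      ‖mfderivWithin 𝓘(ℝ, F) I (extChartAt I ζ).symm (range I) z v‖ₑ ≤
        C * ‖(tangentCoord I Φ).toContinuousLinearMap v‖ₑ := by
    filter_upwards [eventually_norm_mfderivWithin_chart_symm_le I ζ (r := 1 + ε) (by linarith)]
      with z hz v
    have h1 := (hz v).trans_eq (congrArg ((1 + ε) * ·)
      (norm_tangentCoord I Φ (show TangentSpace I ζ from v)).symm)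
    rw [enorm_eq_nnnorm, enorm_eq_nnnorm, ← ENNReal.coe_mul, ENNReal.coe_le_coe]
    exact h1
  have H₂ : ∀ᶠ y in 𝓝 ζ, ∀ v : TangentSpace I y,
      ‖(tangentCoord I Φ).toContinuousLinearMap (mfderiv I 𝓘(ℝ, F) (extChartAt I ζ) y v)‖ₑ ≤
        C * ‖v‖ₑ := by
    filter_upwards [eventually_norm_mfderiv_chart_le I ζ (r := 1 + ε) (by linarith)]
      with y hy v
    have h1 := hy v
    rw [← norm_tangentCoord I Φ] at h1
    rw [enorm_eq_nnnorm, enorm_eq_nnnorm, ← ENNReal.coe_mul, ENNReal.coe_le_coe]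
    exact h1
  obtain ⟨U₁, hU₁, h₁⟩ := exists_nhds_edist_le I ζ (tangentCoord I Φ).toContinuousLinearMap C H₁
  obtain ⟨U₂, hU₂, h₂⟩ := exists_nhds_edist_ge I ζ (tangentCoord I Φ).toContinuousLinearMap C H₂
  have hsub : ∀ x y, normalChart I Φ x - normalChart I Φ y =
      tangentCoord I Φ (extChartAt I ζ x) - tangentCoord I Φ (extChartAt I ζ y) := fun x y => by
    simp [normalChart]
  refine ⟨U₁ ∩ U₂, inter_mem hU₁ hU₂, fun x hx y hy => ?_⟩
  have e₁ := h₁ x hx.1 y hy.1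
  have e₂ := h₂ x hx.2 y hy.2
  rw [hsub, ← dist_eq_norm]
  constructor
  · rw [edist_nndist, edist_nndist, ← ENNReal.coe_mul, ENNReal.coe_le_coe] at e₁
    exact e₁
  · rw [edist_nndist, edist_nndist, ← ENNReal.coe_mul, ENNReal.coe_le_coe] at e₂
    exact e₂

/-- At an interior point the chart covers a full neighbourhood of its value, not merely one within
`range I`. -/
theorem map_normalChart_nhds (hζ : I.IsInteriorPoint ζ) :
    map (normalChart I Φ) (𝓝 ζ) = 𝓝 0 := by
  have h1 : map (extChartAt I ζ) (𝓝 ζ) = 𝓝 (extChartAt I ζ ζ) := by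
    rw [map_extChartAt_nhds, nhdsWithin_eq_nhds.2 (range_mem_nhds_isInteriorPoint hζ)]
  have h2 : map (fun z : F => tangentCoord I Φ (z - extChartAt I ζ ζ)) (𝓝 (extChartAt I ζ ζ)) =
      𝓝 0 := by
    have := ((Homeomorph.subRight (extChartAt I ζ ζ)).trans
      (tangentCoord I Φ).toHomeomorph).map_nhds_eq (extChartAt I ζ ζ)
    refine this.trans (congrArg 𝓝 ?_)
    change tangentCoord I Φ (extChartAt I ζ ζ - extChartAt I ζ ζ) = 0
    rw [sub_self, map_zero]
  rw [← h2, ← h1, Filter.map_map]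
  rfl

/-- The derivative of the return map in Euclidean coordinates. -/
def returnMap (T : X → X) : EuclideanSpace ℝ (Fin d) →ₗ[ℝ] EuclideanSpace ℝ (Fin d) :=
  Φ.symm.toLinearEquiv.toLinearMap ∘ₗ returnDeriv I T ζ ∘ₗ Φ.toLinearEquiv.toLinearMap

theorem returnMap_pow (T : X → X) (ℓ : ℕ) (v : EuclideanSpace ℝ (Fin d)) :
    (returnDeriv I T ζ ^ ℓ) (Φ v) = Φ ((returnMap I Φ T ^ ℓ) v) := by
  induction ℓ with
  | zero => simp
  | succ ℓ ih =>
    rw [pow_succ', pow_succ', Module.End.mul_apply, Module.End.mul_apply, ih]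
    simp [returnMap]

theorem det_returnMap (T : X → X) :
    LinearMap.det (returnMap I Φ T) = LinearMap.det (returnDeriv I T ζ) :=
  LinearMap.det_conj (returnDeriv I T ζ) Φ.symm.toLinearEquiv

/-- Up to sign the determinant is the constant coefficient of the characteristic polynomial, hence
the product of the complex eigenvalues; the product is not empty because the dimension is positive.
-/
theorem one_lt_abs_det_returnDeriv {T : X → X} (hT : IsRepellingPeriodicPt I T ζ)
    (hF : 0 < Module.finrank ℝ F) : 1 < |LinearMap.det (returnDeriv I T ζ)| := by
  set p := LinearMap.charpoly (show F →ₗ[ℝ] F from returnDeriv I T ζ) with hp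
  have hmonic : (p.map (algebraMap ℝ ℂ)).Monic := (LinearMap.charpoly_monic _).map _
  have hsplits : (p.map (algebraMap ℝ ℂ)).Splits := IsAlgClosed.splits _
  have hdet : LinearMap.det (returnDeriv I T ζ) = (-1) ^ Module.finrank ℝ F * p.coeff 0 :=
    LinearMap.det_eq_sign_charpoly_coeff (show F →ₗ[ℝ] F from returnDeriv I T ζ)
  have h1 : |LinearMap.det (returnDeriv I T ζ)| = ‖(p.map (algebraMap ℝ ℂ)).coeff 0‖ := by
    rw [hdet, abs_mul, abs_pow, abs_neg, abs_one, one_pow, one_mul, Polynomial.coeff_map]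
    simp
  have hcard : 0 < (p.map (algebraMap ℝ ℂ)).roots.card := by
    rw [← hsplits.natDegree_eq_card_roots, Polynomial.natDegree_map, LinearMap.charpoly_natDegree]
    exact hF
  have h2 : ∀ s : Multiset ℂ, (∀ z ∈ s, 1 < ‖z‖) → 0 < s.card → 1 < ‖s.prod‖ := by
    intro s
    induction s using Multiset.induction with
    | empty => simp
    | cons a s ih =>
      intro hs _
      have ha := hs a (Multiset.mem_cons_self a s)
      rw [Multiset.prod_cons, norm_mul]
      rcases Nat.eq_zero_or_pos s.card with h0 | h0
      · rw [Multiset.card_eq_zero.1 h0]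
        simpa using ha
      · exact one_lt_mul_of_lt_of_le ha (ih (fun z hz => hs z (Multiset.mem_cons_of_mem hz)) h0).le
  rw [h1, hsplits.coeff_zero_eq_prod_roots_of_monic hmonic, norm_mul, norm_pow, norm_neg, norm_one,
    one_pow, one_mul]
  exact h2 _ (fun z hz => hT.expanding z (Polynomial.isRoot_of_mem_roots hz)) hcard

/-- This is differentiability of the return map at its fixed point ζ. Interiority turns the
derivative within `range I` into a full one. -/
theorem normalChart_iterate_isLittleO {T : X → X} (hζ : I.IsInteriorPoint ζ)
    (hT : IsRepellingPeriodicPt I T ζ) :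
    (fun x => normalChart I Φ (T^[Function.minimalPeriod T ζ] x) -
      returnMap I Φ T (normalChart I Φ x)) =o[𝓝 ζ] normalChart I Φ := by
  set f := T^[Function.minimalPeriod T ζ] with hf
  have hfix : f ζ = ζ := Function.iterate_minimalPeriod
  have hd : MDifferentiableAt I I f ζ := hT.contMDiffAt.mdifferentiableAt one_ne_zero
  have h1 : HasFDerivWithinAt (writtenInExtChartAt I I ζ f) (show F →L[ℝ] F from mfderiv I I f ζ)
    (range I) (extChartAt I ζ ζ) := hd.hasMFDerivAt.2
  have h2 := (h1.hasFDerivAt (range_mem_nhds_isInteriorPoint hζ)).isLittleO.comp_tendsto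
    (continuousAt_extChartAt (I := I) ζ)
  have hw : ∀ z, writtenInExtChartAt I I ζ f z = extChartAt I ζ (f ((extChartAt I ζ).symm z)) := by
    intro z
    simp only [writtenInExtChartAt, Function.comp_apply]
    rw [hfix]
  have h3 : (fun x => extChartAt I ζ (f x) - extChartAt I ζ ζ -
      (show F →L[ℝ] F from mfderiv I I f ζ) (extChartAt I ζ x - extChartAt I ζ ζ)) =o[𝓝 ζ]
      fun x => extChartAt I ζ x - extChartAt I ζ ζ := by
    refine h2.congr' ?_ (Eventually.of_forall fun x => rfl)
    filter_upwards [extChartAt_source_mem_nhds (I := I) ζ] with x hx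
    simp only [Function.comp_apply, hw, (extChartAt I ζ).left_inv hx, extChartAt_to_inv, hfix]
  have h4 := ((tangentCoord I Φ).toContinuousLinearMap.isBigO_comp _ (𝓝 ζ)).trans_isLittleO h3
  have h5 : (fun x => extChartAt I ζ x - extChartAt I ζ ζ) =O[𝓝 ζ] normalChart I Φ := by
    refine ((tangentCoord I Φ).symm.toContinuousLinearMap.isBigO_comp (normalChart I Φ) (𝓝 ζ)).congr_left ?_
    intro x
    simp [normalChart, -extChartAt]
  refine (h4.trans_isBigO h5).congr_left fun x => ?_
  have h6 : ∀ v : F, returnMap I Φ T (tangentCoord I Φ v) =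
      tangentCoord I Φ ((show F →L[ℝ] F from mfderiv I I f ζ) v) := by
    intro v
    change Φ.symm (returnDeriv I T ζ (Φ (Φ.symm (show TangentSpace I ζ from v)))) = _
    rw [LinearIsometryEquiv.apply_symm_apply]
    rfl
  simp only [normalChart, h6, ContinuousLinearEquiv.coe_coe]
  rw [← map_sub]

/-- A bi-Lipschitz chart sends a small neighbourhood into a Euclidean ball. Boundary points are
allowed, so that compactness will give finite total volume. -/
theorem exists_nhds_euclideanHausdorffMeasure_lt_top [MeasurableSpace X] [BorelSpace X]
    (hd : Module.finrank ℝ F = d) (ζ : X) :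
    ∃ U ∈ 𝓝 ζ, U ⊆ (extChartAt I ζ).source ∧
      (Measure.euclideanHausdorffMeasure d : Measure X) U < ∞ := by
  have hd' : Module.finrank ℝ (TangentSpace I ζ) = d := hd
  have : FiniteDimensional ℝ (TangentSpace I ζ) := ‹FiniteDimensional ℝ F›
  let Φ : EuclideanSpace ℝ (Fin d) ≃ₗᵢ[ℝ] TangentSpace I ζ :=
    ((stdOrthonormalBasis ℝ (TangentSpace I ζ)).reindex (finCongr hd')).repr.symm
  obtain ⟨U, hU, h⟩ := normalChart_bilipschitz I Φ one_pos
  refine ⟨U ∩ (extChartAt I ζ).source ∩ Metric.ball ζ 1,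
    inter_mem (inter_mem hU (extChartAt_source_mem_nhds ζ)) (Metric.ball_mem_nhds _ one_pos),
    fun x hx => hx.1.2, ?_⟩
  refine (euclideanHausdorffMeasure_le_image (K := 2) (f := normalChart I Φ) fun x hx y hy => ?_).trans_lt
    (ENNReal.mul_lt_top (by simp) ?_)
  · have := (h x hx.1.1 y hy.1.1).1
    rw [edist_dist, edist_dist, dist_eq_norm (normalChart I Φ x)]
    rw [show ((2 : ℝ≥0) : ℝ≥0∞) = ENNReal.ofReal 2 by simp, ← ENNReal.ofReal_mul (by norm_num)]
    exact ENNReal.ofReal_le_ofReal (by norm_num at this; linarith)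
  · rw [EuclideanSpace.euclideanHausdorffMeasure_eq_volume]
    refine (measure_mono ?_).trans_lt
      (measure_ball_lt_top (μ := volume) (x := (0 : EuclideanSpace ℝ (Fin d))) (r := 3))
    rintro _ ⟨x, hx, rfl⟩
    have := (h x hx.1.1 ζ (mem_of_mem_nhds hU)).2
    have h2 : dist x ζ < 1 := hx.2
    rw [normalChart_self, sub_zero] at this
    rw [mem_ball_zero_iff]
    linarith

end Geometry

end REPP

end

noncomputable section

namespace REPP

/-! ### The scaling limit around a point -/

section Scaling

set_option linter.unusedSectionVars false

open scoped Pointwise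

variable {X : Type*} [MetricSpace X] {d : ℕ} {ζ : X} {ψ : X → EuclideanSpace ℝ (Fin d)}

/-- Coordinates around `ζ` that are almost isometric at `ζ`. -/
structure IsNormalChart (ζ : X) (ψ : X → EuclideanSpace ℝ (Fin d)) : Prop where
  map_self : ψ ζ = 0
  bilipschitz : ∀ ε : ℝ, 0 < ε → ∃ U ∈ 𝓝 ζ, ∀ x ∈ U, ∀ y ∈ U,
    dist x y ≤ (1 + ε) * ‖ψ x - ψ y‖ ∧ ‖ψ x - ψ y‖ ≤ (1 + ε) * dist x y
  map_nhds : map ψ (𝓝 ζ) = 𝓝 0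

/-- Radii such that `ψ` is bi-Lipschitz on `ball ζ δ` and its image contains `ball 0 κ`. -/
structure IsChartDomain (ζ : X) (ψ : X → EuclideanSpace ℝ (Fin d)) (δ κ : ℝ) : Prop where
  δ_pos : 0 < δ
  κ_pos : 0 < κ
  map_self : ψ ζ = 0
  dist_le : ∀ x ∈ Metric.ball ζ δ, ∀ y ∈ Metric.ball ζ δ, dist x y ≤ 2 * ‖ψ x - ψ y‖
  norm_le : ∀ x ∈ Metric.ball ζ δ, ∀ y ∈ Metric.ball ζ δ, ‖ψ x - ψ y‖ ≤ 2 * dist x y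
  surj : Metric.ball 0 κ ⊆ ψ '' Metric.ball ζ δ

theorem IsNormalChart.exists_domain (h : IsNormalChart ζ ψ) : ∃ δ κ, IsChartDomain ζ ψ δ κ := by
  obtain ⟨U, hU, hb⟩ := h.bilipschitz 1 one_pos
  obtain ⟨δ, hδ, hδU⟩ := Metric.mem_nhds_iff.1 hU
  have h1 : ψ '' Metric.ball ζ δ ∈ 𝓝 (0 : EuclideanSpace ℝ (Fin d)) := by
    rw [← h.map_nhds]; exact image_mem_map (Metric.ball_mem_nhds ζ hδ)
  obtain ⟨κ, hκ, hκU⟩ := Metric.mem_nhds_iff.1 h1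
  refine ⟨δ, κ, hδ, hκ, h.map_self, fun x hx y hy => ?_, fun x hx y hy => ?_, hκU⟩
  · have := (hb x (hδU hx) y (hδU hy)).1
    linarith
  · have := (hb x (hδU hx) y (hδU hy)).2
    linarith

/-- The domain of the chart. -/
def chartDomain (ζ : X) (ψ : X → EuclideanSpace ℝ (Fin d)) (δ κ : ℝ) : Set X :=
  Metric.ball ζ δ ∩ ψ ⁻¹' Metric.ball 0 κ

variable {δ κ : ℝ}

theorem IsChartDomain.mem_ball (h : IsChartDomain ζ ψ δ κ) : ζ ∈ Metric.ball ζ δ :=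
  Metric.mem_ball_self h.δ_pos

theorem IsChartDomain.dist_self_le (h : IsChartDomain ζ ψ δ κ) {x : X}
    (hx : x ∈ Metric.ball ζ δ) : dist x ζ ≤ 2 * ‖ψ x‖ := by
  simpa [h.map_self] using h.dist_le x hx ζ h.mem_ball

theorem IsChartDomain.norm_le_dist_self (h : IsChartDomain ζ ψ δ κ) {x : X}
    (hx : x ∈ Metric.ball ζ δ) : ‖ψ x‖ ≤ 2 * dist x ζ := by
  simpa [h.map_self] using h.norm_le x hx ζ h.mem_ball

theorem IsChartDomain.continuousOn (h : IsChartDomain ζ ψ δ κ) :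
    ContinuousOn ψ (Metric.ball ζ δ) := by
  refine (LipschitzOnWith.of_dist_le_mul (K := 2) fun x hx y hy => ?_).continuousOn
  rw [dist_eq_norm]
  exact h.norm_le x hx y hy

theorem IsChartDomain.isOpen_inter_preimage (h : IsChartDomain ζ ψ δ κ)
    {S : Set (EuclideanSpace ℝ (Fin d))} (hS : IsOpen S) : IsOpen (Metric.ball ζ δ ∩ ψ ⁻¹' S) :=
  h.continuousOn.isOpen_inter_preimage Metric.isOpen_ball hS

theorem IsChartDomain.isOpen (h : IsChartDomain ζ ψ δ κ) : IsOpen (chartDomain ζ ψ δ κ) :=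
  h.isOpen_inter_preimage Metric.isOpen_ball

theorem IsChartDomain.mem (h : IsChartDomain ζ ψ δ κ) : ζ ∈ chartDomain ζ ψ δ κ :=
  ⟨h.mem_ball, by simp [h.map_self, h.κ_pos]⟩

theorem IsChartDomain.image_eq (h : IsChartDomain ζ ψ δ κ) {S : Set (EuclideanSpace ℝ (Fin d))}
    (hS : S ⊆ Metric.ball 0 κ) : ψ '' (chartDomain ζ ψ δ κ ∩ ψ ⁻¹' S) = S := by
  refine Subset.antisymm ?_ fun s hs => ?_
  · rintro _ ⟨x, hx, rfl⟩
    exact hx.2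
  · obtain ⟨x, hx, rfl⟩ := h.surj (hS hs)
    exact ⟨x, ⟨⟨hx, hS hs⟩, hs⟩, rfl⟩

theorem edist_le_mul_edist {Y Z : Type*} [PseudoMetricSpace Y] [PseudoMetricSpace Z] {a b : Y}
    {a' b' : Z} {K : ℝ≥0} (h : dist a b ≤ K * dist a' b') : edist a b ≤ K * edist a' b' := by
  rw [edist_nndist, edist_nndist, ← ENNReal.coe_mul, ENNReal.coe_le_coe]
  exact h

variable [MeasurableSpace X] [BorelSpace X]

theorem _root_.ContinuousOn.measurable_indicator {Y : Type*} [TopologicalSpace Y] [MeasurableSpace Y]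
    [BorelSpace Y] [Zero Y] {f : X → Y} {U : Set X} (hf : ContinuousOn f U)
    (hU : MeasurableSet U) : Measurable (U.indicator f) := by
  classical
  rw [← piecewise_eq_indicator]
  exact hf.measurable_piecewise continuousOn_const hU

theorem IsChartDomain.measurable_indicator (h : IsChartDomain ζ ψ δ κ) :
    Measurable ((chartDomain ζ ψ δ κ).indicator ψ) :=
  (h.continuousOn.mono inter_subset_left).measurable_indicator h.isOpen.measurableSet

theorem IsChartDomain.measurableSet_inter (h : IsChartDomain ζ ψ δ κ)
    {S : Set (EuclideanSpace ℝ (Fin d))} (hS : MeasurableSet S) :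
    MeasurableSet (chartDomain ζ ψ δ κ ∩ ψ ⁻¹' S) := by
  have h1 := h.measurable_indicator
  have h2 : chartDomain ζ ψ δ κ ∩ ψ ⁻¹' S =
      chartDomain ζ ψ δ κ ∩ (chartDomain ζ ψ δ κ).indicator ψ ⁻¹' S := by
    ext x
    refine and_congr_right fun hx => ?_
    rw [mem_preimage, mem_preimage, indicator_of_mem hx]
  rw [h2]
  exact h.isOpen.measurableSet.inter (h1 hS)

theorem IsChartDomain.measure_le (h : IsChartDomain ζ ψ δ κ)
    (S : Set (EuclideanSpace ℝ (Fin d))) :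
    (Measure.euclideanHausdorffMeasure d : Measure X) (Metric.ball ζ δ ∩ ψ ⁻¹' S) ≤
      2 ^ d * volume S := by
  refine (euclideanHausdorffMeasure_le_image (K := 2) (f := ψ) fun x hx y hy =>
    edist_le_mul_edist ?_).trans ?_
  · rw [dist_eq_norm (ψ x)]
    exact h.dist_le x hx.1 y hy.1
  · rw [EuclideanSpace.euclideanHausdorffMeasure_eq_volume]
    simp only [ENNReal.coe_ofNat]
    gcongr
    rintro _ ⟨x, hx, rfl⟩
    exact hx.2

/-- Close to `ζ`, the volume in the manifold is almost the Euclidean volume in the chart. -/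
theorem IsNormalChart.measure_close (hψ : IsNormalChart ζ ψ) (h : IsChartDomain ζ ψ δ κ)
    {ε : ℝ≥0} (hε : 0 < ε) : ∃ r₀ : ℝ, 0 < r₀ ∧ ∀ S ⊆ Metric.ball (0 : EuclideanSpace ℝ (Fin d)) r₀,
      (Measure.euclideanHausdorffMeasure d : Measure X) (chartDomain ζ ψ δ κ ∩ ψ ⁻¹' S) ≤
          ((1 + ε : ℝ≥0) : ℝ≥0∞) ^ d * volume S ∧
        volume S ≤ ((1 + ε : ℝ≥0) : ℝ≥0∞) ^ d *
          (Measure.euclideanHausdorffMeasure d : Measure X) (chartDomain ζ ψ δ κ ∩ ψ ⁻¹' S) := by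
  obtain ⟨U, hU, hb⟩ := hψ.bilipschitz ε hε
  obtain ⟨s, hs, hsU⟩ := Metric.mem_nhds_iff.1 hU
  -- Since dist x ζ ≤ 2 ‖ψ x‖, the radius s / 2 puts the preimage inside `U`; κ makes ψ map the
  -- preimage of `S` onto `S`.
  refine ⟨min (s / 2) κ, lt_min (by positivity) h.κ_pos, fun S hS => ?_⟩
  have hSκ : S ⊆ Metric.ball 0 κ := hS.trans (Metric.ball_subset_ball (min_le_right _ _))
  have hsub : chartDomain ζ ψ δ κ ∩ ψ ⁻¹' S ⊆ U := by
    rintro x ⟨hx, hxS⟩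
    refine hsU (Metric.mem_ball.2 ((h.dist_self_le hx.1).trans_lt ?_))
    have h1 := hS hxS
    rw [mem_ball_zero_iff] at h1
    have := h1.trans_le (min_le_left _ _)
    linarith
  have h1 := euclideanHausdorffMeasure_le_image (d := d) (K := 1 + ε) (f := ψ)
    (A := chartDomain ζ ψ δ κ ∩ ψ ⁻¹' S) fun x hx y hy => edist_le_mul_edist (by
      rw [dist_eq_norm (ψ x)]; exact (hb x (hsub hx) y (hsub hy)).1)
  have h2 := euclideanHausdorffMeasure_image_le (d := d) (K := 1 + ε) (f := ψ)
    (A := chartDomain ζ ψ δ κ ∩ ψ ⁻¹' S) fun x hx y hy => edist_le_mul_edist (by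
      rw [dist_eq_norm (ψ x)]; exact (hb x (hsub hx) y (hsub hy)).2)
  rw [h.image_eq hSκ, EuclideanSpace.euclideanHausdorffMeasure_eq_volume] at h1 h2
  exact ⟨h1, h2⟩

/-- The scale at which a measure of density `h` has mass of order `1 / n`. -/
def scale (d : ℕ) (h : ℝ) (n : ℕ) : ℝ := ((n : ℝ) * h) ^ (-(1 / (d : ℝ)))

theorem scale_pos {h : ℝ} (hh : 0 < h) {n : ℕ} (hn : 1 ≤ n) : 0 < scale d h n := by
  have : (0 : ℝ) < n := by exact_mod_cast hn
  exact Real.rpow_pos_of_pos (by positivity) _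

theorem mul_scale_pow (hd : 0 < d) {h : ℝ} (hh : 0 < h) {n : ℕ} (hn : 1 ≤ n) :
    (n : ℝ) * h * scale d h n ^ d = 1 := by
  have h0 : (0 : ℝ) < n * h := by
    have : (0 : ℝ) < n := by exact_mod_cast hn
    positivity
  have hd' : (d : ℝ) ≠ 0 := by exact_mod_cast hd.ne'
  rw [scale, ← Real.rpow_natCast, ← Real.rpow_mul h0.le, neg_mul, one_div, inv_mul_cancel₀ hd',
    Real.rpow_neg_one, mul_inv_cancel₀ h0.ne']

theorem tendsto_scale (hd : 0 < d) {h : ℝ} (hh : 0 < h) :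
    Tendsto (scale d h) atTop (𝓝 0) := by
  have h1 : Tendsto (fun n : ℕ => (n : ℝ) * h) atTop atTop :=
    tendsto_natCast_atTop_atTop.atTop_mul_const hh
  exact (tendsto_rpow_neg_atTop (by positivity)).comp h1

/-- A squeeze adapted to charts with bi-Lipschitz constant 1 + ε, which distort volumes by at most
(1 + ε)^d in either direction. -/
theorem tendsto_of_eventually_le_mul_pow {a : ℕ → ℝ} {v : ℝ}
    (h : ∀ ε : ℝ≥0, 0 < ε → ∀ᶠ n in atTop, a n ≤ (1 + ε) ^ d * v ∧ v ≤ (1 + ε) ^ d * a n) :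
    Tendsto a atTop (𝓝 v) := by
  have key : ∀ w : ℝ, Tendsto (fun ε : ℝ≥0 => (1 + (ε : ℝ)) ^ d * w) (𝓝[>] 0) (𝓝 w) := by
    intro w
    have : Tendsto (fun ε : ℝ≥0 => (1 + (ε : ℝ)) ^ d * w) (𝓝 0) (𝓝 ((1 + ((0 : ℝ≥0) : ℝ)) ^ d * w)) :=
      Continuous.tendsto (by fun_prop) 0
    simpa using this.mono_left nhdsWithin_le_nhds
  refine tendsto_order.2 ⟨fun b hb => ?_, fun b hb => ?_⟩
  · obtain ⟨ε, h1, h2⟩ := (((key b).eventually (gt_mem_nhds hb)).and self_mem_nhdsWithin).exists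
    filter_upwards [h ε h2] with n hn
    have h3 : (0 : ℝ) < (1 + (ε : ℝ)) ^ d := by positivity
    exact lt_of_mul_lt_mul_left (h1.trans_le hn.2) h3.le
  · obtain ⟨ε, h1, h2⟩ := (((key v).eventually (gt_mem_nhds hb)).and self_mem_nhdsWithin).exists
    filter_upwards [h ε h2] with n hn
    exact hn.1.trans_lt h1

/-- The factor n h cancels the Jacobian of the dilation exactly (`mul_scale_pow`), so only the
distortion of the chart, which tends to 1, remains. -/
theorem tendsto_mul_hausdorff (hψ : IsNormalChart ζ ψ) (hdom : IsChartDomain ζ ψ δ κ) (hd : 0 < d)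
    {h : ℝ} (hh : 0 < h) {S : Set (EuclideanSpace ℝ (Fin d))} (hS : Bornology.IsBounded S) :
    Tendsto (fun n : ℕ => (n : ℝ) * (h * (Measure.euclideanHausdorffMeasure d : Measure X).real
      (chartDomain ζ ψ δ κ ∩ ψ ⁻¹' (scale d h n • S)))) atTop (𝓝 (volume.real S)) := by
  obtain ⟨R, hR⟩ := hS.subset_ball_lt 0 0
  have hvS : volume S < ∞ := (measure_mono hR.2).trans_lt measure_ball_lt_top
  refine tendsto_of_eventually_le_mul_pow (d := d) fun ε hε => ?_
  obtain ⟨r₀, hr₀, hr⟩ := hψ.measure_close hdom hε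
  have hsmall : ∀ᶠ n : ℕ in atTop, scale d h n * R < r₀ := by
    have := (tendsto_scale hd hh).mul_const R
    rw [zero_mul] at this
    exact this.eventually (gt_mem_nhds hr₀)
  filter_upwards [hsmall, eventually_ge_atTop 1] with n hn h1n
  have hpos := scale_pos (d := d) hh h1n
  have hone := mul_scale_pow hd hh h1n
  set A := chartDomain ζ ψ δ κ ∩ ψ ⁻¹' (scale d h n • S)
  have hsub : scale d h n • S ⊆ Metric.ball 0 r₀ := by
    rintro _ ⟨s, hs, rfl⟩
    have := hR.2 hs
    rw [mem_ball_zero_iff] at this ⊢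
    simp only [norm_smul, Real.norm_eq_abs, abs_of_pos hpos]
    exact (mul_lt_mul_of_pos_left this hpos).trans hn
  have hvol : volume (scale d h n • S) = ENNReal.ofReal (scale d h n ^ d) * volume S := by
    rw [Measure.addHaar_smul]
    simp [abs_of_pos hpos]
  obtain ⟨h1, h2⟩ := hr _ hsub
  rw [hvol] at h1 h2
  have hAfin : (Measure.euclideanHausdorffMeasure d : Measure X) A < ∞ :=
    h1.trans_lt (by
      refine ENNReal.mul_lt_top (by simp) (ENNReal.mul_lt_top (by simp) hvS))
  have h1' := ENNReal.toReal_mono (ENNReal.mul_lt_top (by simp)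
    (ENNReal.mul_lt_top (by simp) hvS)).ne h1
  have h2' := ENNReal.toReal_mono (ENNReal.mul_lt_top (by simp) hAfin).ne h2
  simp only [ENNReal.toReal_mul, ENNReal.toReal_pow, ENNReal.coe_toReal,
    ENNReal.toReal_ofReal (pow_nonneg hpos.le d), NNReal.coe_add, NNReal.coe_one] at h1' h2'
  have hnh : 0 < (n : ℝ) * h := by
    have : (0 : ℝ) < n := by exact_mod_cast h1n
    positivity
  constructor
  · have := mul_le_mul_of_nonneg_left h1' hnh.le
    calc _ = (n : ℝ) * h * (Measure.euclideanHausdorffMeasure d : Measure X).real A := by ring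
      _ ≤ (n : ℝ) * h * ((1 + (ε : ℝ)) ^ d * (scale d h n ^ d * (volume S).toReal)) := this
      _ = (n * h * scale d h n ^ d) * ((1 + (ε : ℝ)) ^ d * (volume S).toReal) := by ring
      _ = _ := by rw [hone, one_mul]; rfl
  · have := mul_le_mul_of_nonneg_left h2' hnh.le
    calc volume.real S = (n * h * scale d h n ^ d) * (volume S).toReal := by rw [hone, one_mul]; rfl
      _ = n * h * (scale d h n ^ d * (volume S).toReal) := by ring
      _ ≤ _ := this
      _ = _ := by simp only [Measure.real]; ring

/-- The error is integrated over a larger set `B`, to be taken as a ball, because the Lebesgue point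
condition speaks of balls only. -/
theorem hasRegularDensityAt_bounds {ν μ : Measure X} {h : X → ℝ≥0} (hm : Measurable h)
    (hμ : μ = ν.withDensity fun x => (h x : ℝ≥0∞)) {A B : Set X} (hA : MeasurableSet A)
    (hAB : A ⊆ B) :
    μ A ≤ h ζ * ν A + ∫⁻ x in B, ‖(h x : ℝ) - (h ζ : ℝ)‖ₑ ∂ν ∧
      h ζ * ν A ≤ μ A + ∫⁻ x in B, ‖(h x : ℝ) - (h ζ : ℝ)‖ₑ ∂ν := by
  have hpt : ∀ a b : ℝ≥0, (a : ℝ≥0∞) ≤ b + ‖(a : ℝ) - (b : ℝ)‖ₑ := by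
    intro a b
    rw [Real.enorm_eq_ofReal_abs, ← ENNReal.ofReal_coe_nnreal (p := a),
      ← ENNReal.ofReal_coe_nnreal (p := b), ← ENNReal.ofReal_add b.coe_nonneg (abs_nonneg _)]
    exact ENNReal.ofReal_le_ofReal (by linarith [le_abs_self ((a : ℝ) - b)])
  have hμA : μ A = ∫⁻ x in A, h x ∂ν := by rw [hμ, withDensity_apply _ hA]
  have hconst : h ζ * ν A = ∫⁻ _ in A, (h ζ : ℝ≥0∞) ∂ν := by rw [setLIntegral_const]
  have hmono : ∫⁻ x in A, ‖(h x : ℝ) - (h ζ : ℝ)‖ₑ ∂ν ≤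
      ∫⁻ x in B, ‖(h x : ℝ) - (h ζ : ℝ)‖ₑ ∂ν := lintegral_mono_set hAB
  rw [hμA, hconst]
  constructor
  · refine le_trans ?_ (add_le_add_right hmono _)
    rw [← lintegral_add_left measurable_const]
    exact lintegral_mono fun x => hpt _ _
  · refine le_trans ?_ (add_le_add_right hmono _)
    rw [← lintegral_add_left hm.coe_nnreal_ennreal]
    refine lintegral_mono fun x => (hpt (h ζ) (h x)).trans_eq ?_
    rw [← enorm_neg, neg_sub]

theorem IsChartDomain.measure_ball_le (hdom : IsChartDomain ζ ψ δ κ) {s : ℝ} (hs : 0 < s)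
    (hsδ : s ≤ δ) : (Measure.euclideanHausdorffMeasure d : Measure X) (Metric.ball ζ s) ≤
      2 ^ d * (ENNReal.ofReal ((2 * s) ^ d) *
        volume (Metric.ball (0 : EuclideanSpace ℝ (Fin d)) 1)) := by
  have hsub : Metric.ball ζ s ⊆ Metric.ball ζ δ ∩ ψ ⁻¹' Metric.ball 0 (2 * s) := by
    intro x hx
    have hxδ := Metric.ball_subset_ball hsδ hx
    refine ⟨hxδ, ?_⟩
    rw [mem_preimage, mem_ball_zero_iff]
    have h1 := hdom.norm_le_dist_self hxδ
    have h2 : dist x ζ < s := hx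
    linarith
  refine (measure_mono hsub).trans ((hdom.measure_le _).trans_eq ?_)
  rw [Measure.addHaar_ball_of_pos _ _ (by positivity : (0 : ℝ) < 2 * s), finrank_euclideanSpace,
    Fintype.card_fin]

/-- The density may be frozen at ζ: the error is at most the Lebesgue-point ratio, which tends to 0,
times n ν(ball), which is bounded because the radius is of the order of the scale. -/
theorem tendsto_mass (hψ : IsNormalChart ζ ψ) (hdom : IsChartDomain ζ ψ δ κ) (hd : 0 < d)
    {μ : Measure X} [IsFiniteMeasure μ] {h : X → ℝ≥0} (hm : Measurable h)
    (hμ : μ = (Measure.euclideanHausdorffMeasure d).withDensity fun x => (h x : ℝ≥0∞))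
    (hζ : 0 < h ζ)
    (hleb : Tendsto (fun ε : ℝ => (∫⁻ x in Metric.ball ζ ε, ‖(h x : ℝ) - (h ζ : ℝ)‖ₑ
      ∂(Measure.euclideanHausdorffMeasure d)) /
      (Measure.euclideanHausdorffMeasure d) (Metric.ball ζ ε)) (𝓝[>] 0) (𝓝 0))
    {S : Set (EuclideanSpace ℝ (Fin d))} (hS : Bornology.IsBounded S) (hSm : MeasurableSet S) :
    Tendsto (fun n : ℕ => (n : ℝ) * μ.real
      (chartDomain ζ ψ δ κ ∩ ψ ⁻¹' (scale d (h ζ) n • S))) atTop (𝓝 (volume.real S)) := by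
  set ν : Measure X := Measure.euclideanHausdorffMeasure d with hν
  have hh : (0 : ℝ) < h ζ := hζ
  obtain ⟨R, hR0, hR⟩ := hS.subset_ball_lt 0 0
  -- The preimage of the rescaled `S` lies in this ball; the factor 2 is the Lipschitz constant of
  -- the inverse chart.
  set s : ℕ → ℝ := fun n => 2 * R * scale d (h ζ) n with hs
  have hs0 : Tendsto s atTop (𝓝 0) := by
    simpa using (tendsto_scale hd hh).const_mul (2 * R)
  have hspos : ∀ n, 1 ≤ n → 0 < s n := fun n hn => mul_pos (by positivity) (scale_pos hh hn)
  have hsw : Tendsto s atTop (𝓝[>] 0) :=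
    tendsto_nhdsWithin_iff.2 ⟨hs0, (eventually_ge_atTop 1).mono fun n hn => hspos n hn⟩
  set q : ℕ → ℝ≥0∞ := fun n => ∫⁻ x in Metric.ball ζ (s n), ‖(h x : ℝ) - (h ζ : ℝ)‖ₑ ∂ν with hq
  set ratio : ℕ → ℝ≥0∞ := fun n => q n / ν (Metric.ball ζ (s n)) with hratio
  have hratio0 : Tendsto ratio atTop (𝓝 0) := hleb.comp hsw
  set B := volume (Metric.ball (0 : EuclideanSpace ℝ (Fin d)) 1) with hB
  have hBfin : B < ∞ := measure_ball_lt_top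
  set C : ℝ := 2 ^ d * ((4 * R) ^ d * B.toReal) / h ζ with hC
  have hball : ∀ᶠ n in atTop, ν (Metric.ball ζ (s n)) ≠ ∞ ∧
      (n : ℝ) * ν.real (Metric.ball ζ (s n)) ≤ C := by
    filter_upwards [hs0.eventually (gt_mem_nhds hdom.δ_pos), eventually_ge_atTop 1] with n hn h1n
    have h1 := hdom.measure_ball_le (hspos n h1n) hn.le
    have hfin : (2 : ℝ≥0∞) ^ d * (ENNReal.ofReal ((2 * s n) ^ d) * B) < ∞ :=
      ENNReal.mul_lt_top (by simp) (ENNReal.mul_lt_top (by simp) hBfin)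
    refine ⟨(h1.trans_lt hfin).ne, ?_⟩
    have h2 := ENNReal.toReal_mono hfin.ne h1
    rw [ENNReal.toReal_mul, ENNReal.toReal_mul, ENNReal.toReal_pow, ENNReal.toReal_ofNat,
      ENNReal.toReal_ofReal (by have := hspos n h1n; positivity)] at h2
    have hone := mul_scale_pow hd hh h1n
    rw [hC, le_div_iff₀ hh]
    calc (n : ℝ) * ν.real (Metric.ball ζ (s n)) * h ζ
        ≤ n * (2 ^ d * ((2 * s n) ^ d * B.toReal)) * h ζ := by gcongr; exact h2
      _ = (n * h ζ * scale d (h ζ) n ^ d) * (2 ^ d * ((4 * R) ^ d * B.toReal)) := by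
        rw [hs]; simp only; rw [show 2 * (2 * R * scale d (h ζ) n) = 4 * R * scale d (h ζ) n by ring,
          mul_pow]; ring
      _ = _ := by rw [hone, one_mul]
  have hq0 : ∀ᶠ n in atTop, q n ≠ ∞ ∧ (n : ℝ) * (q n).toReal ≤ (ratio n).toReal * C := by
    filter_upwards [hball, hratio0.eventually (gt_mem_nhds one_pos)] with n hn h1
    have hle : q n ≤ ratio n * ν (Metric.ball ζ (s n)) := by
      rcases eq_or_ne (ν (Metric.ball ζ (s n))) 0 with h0 | h0
      · have : q n = 0 := by
          rw [hq]; simp only; rw [Measure.restrict_eq_zero.2 h0, lintegral_zero_measure]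
        rw [this]; exact zero_le
      · rw [hratio]; simp only; rw [ENNReal.div_mul_cancel h0 hn.1]
    have hfin : ratio n * ν (Metric.ball ζ (s n)) < ∞ :=
      ENNReal.mul_lt_top (h1.trans ENNReal.one_lt_top) hn.1.lt_top
    refine ⟨(hle.trans_lt hfin).ne, ?_⟩
    have h2 := ENNReal.toReal_mono hfin.ne hle
    rw [ENNReal.toReal_mul] at h2
    calc (n : ℝ) * (q n).toReal ≤ n * ((ratio n).toReal * (ν (Metric.ball ζ (s n))).toReal) := by
          gcongr
      _ = (ratio n).toReal * (n * ν.real (Metric.ball ζ (s n))) := by rw [Measure.real]; ring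
      _ ≤ _ := by gcongr; exact hn.2
  have hr0 : Tendsto (fun n => (ratio n).toReal * C) atTop (𝓝 0) := by
    have := ((ENNReal.tendsto_toReal ENNReal.zero_ne_top).comp hratio0).mul_const C
    simpa using this
  have hlebS := tendsto_mul_hausdorff hψ hdom hd hh hS
  have hdiff : Tendsto (fun n : ℕ => (n : ℝ) * μ.real
      (chartDomain ζ ψ δ κ ∩ ψ ⁻¹' (scale d (h ζ) n • S)) - (n : ℝ) * (h ζ * ν.real
      (chartDomain ζ ψ δ κ ∩ ψ ⁻¹' (scale d (h ζ) n • S)))) atTop (𝓝 0) := by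
    refine squeeze_zero_norm' ?_ hr0
    filter_upwards [hq0, hball, eventually_ge_atTop 1] with n hn hb h1n
    set A := chartDomain ζ ψ δ κ ∩ ψ ⁻¹' (scale d (h ζ) n • S)
    have hpos := scale_pos (d := d) hh h1n
    have hAB : A ⊆ Metric.ball ζ (s n) := by
      rintro x ⟨hx, y, hy, hxy⟩
      have h1 := hdom.dist_self_le hx.1
      have h2 := hR hy
      rw [mem_ball_zero_iff] at h2
      rw [← hxy] at h1
      simp only [norm_smul, Real.norm_eq_abs, abs_of_pos hpos] at h1
      rw [Metric.mem_ball]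
      calc dist x ζ ≤ 2 * (scale d (h ζ) n * ‖y‖) := h1
        _ < 2 * (scale d (h ζ) n * R) := by gcongr
        _ = s n := by rw [hs]; ring
    have hA : MeasurableSet A := hdom.measurableSet_inter (hSm.const_smul₀ _)
    obtain ⟨h1, h2⟩ := hasRegularDensityAt_bounds (ζ := ζ) hm hμ hA hAB
    have hνA : ν A ≠ ∞ := ((measure_mono hAB).trans_lt hb.1.lt_top).ne
    have hhA : (h ζ : ℝ≥0∞) * ν A ≠ ∞ := ENNReal.mul_ne_top ENNReal.coe_ne_top hνA
    have h1' := ENNReal.toReal_mono (ENNReal.add_ne_top.2 ⟨hhA, hn.1⟩) h1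
    have h2' := ENNReal.toReal_mono (ENNReal.add_ne_top.2 ⟨measure_ne_top μ A, hn.1⟩) h2
    rw [ENNReal.toReal_add hhA hn.1, ENNReal.toReal_mul, ENNReal.coe_toReal] at h1'
    rw [ENNReal.toReal_add (measure_ne_top μ A) hn.1, ENNReal.toReal_mul, ENNReal.coe_toReal] at h2'
    refine le_trans ?_ hn.2
    rw [← mul_sub, norm_mul, Real.norm_eq_abs, Real.norm_eq_abs, Nat.abs_cast]
    gcongr
    rw [abs_le]
    simp only [Measure.real]
    constructor <;> linarith
  have := hdiff.add hlebS
  rw [zero_add] at this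
  exact this.congr fun n => sub_add_cancel _ _

end Scaling

end REPP

end

noncomputable section

namespace REPP

/-! ### Cubes in the chart are tame -/

section Cubes

set_option linter.unusedSectionVars false

open scoped Pointwise

variable {d : ℕ}

/-- The half-open cube with lower corner `c` and side `s`. -/
def cube (c : EuclideanSpace ℝ (Fin d)) (s : ℝ) : Set (EuclideanSpace ℝ (Fin d)) :=
  {v | ∀ i, c i ≤ v i ∧ v i < c i + s}

theorem cube_eq_preimage (c : EuclideanSpace ℝ (Fin d)) (s : ℝ) :
    cube c s = (MeasurableEquiv.toLp 2 (Fin d → ℝ)).symm ⁻¹'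
      (univ.pi fun i => Ico (c i) (c i + s)) := by
  ext v
  simp [cube]

theorem measurableSet_cube (c : EuclideanSpace ℝ (Fin d)) (s : ℝ) : MeasurableSet (cube c s) := by
  rw [cube_eq_preimage]
  exact (MeasurableEquiv.toLp 2 (Fin d → ℝ)).symm.measurable
    (MeasurableSet.univ_pi fun i => measurableSet_Ico)

theorem volume_cube (c : EuclideanSpace ℝ (Fin d)) (s : ℝ) :
    volume (cube c s) = ENNReal.ofReal s ^ d := by
  rw [cube_eq_preimage, (EuclideanSpace.volume_preserving_symm_measurableEquiv_toLp (Fin d)).measure_preimage_equiv,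
    Real.volume_pi_Ico]
  simp

theorem convex_cube (c : EuclideanSpace ℝ (Fin d)) (s : ℝ) : Convex ℝ (cube c s) := by
  intro v hv w hw a b ha hb hab i
  have h1 := hv i
  have h2 := hw i
  have e : (a • v + b • w) i = a * v i + b * w i := by simp
  rw [e]
  have h3 := (convex_Ico (𝕜 := ℝ) (c i) (c i + s)) h1 h2 ha hb hab
  simpa using h3

theorem smul_cube {r : ℝ} (hr : 0 < r) (c : EuclideanSpace ℝ (Fin d)) (s : ℝ) :
    r • cube c s = cube (r • c) (r * s) := by
  ext v
  rw [mem_smul_set_iff_inv_smul_mem₀ hr.ne']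
  simp only [cube, mem_ofPred_eq, PiLp.smul_apply, smul_eq_mul]
  refine forall_congr' fun i => and_congr ?_ ?_
  · rw [le_inv_mul_iff₀ hr]
  · rw [inv_mul_lt_iff₀ hr, mul_add]

theorem isBounded_cube (c : EuclideanSpace ℝ (Fin d)) (s : ℝ) : Bornology.IsBounded (cube c s) := by
  rw [isBounded_iff_forall_norm_le]
  refine ⟨∑ i, (|c i| + |s|), fun v hv => ?_⟩
  have h1 : ‖v‖ ≤ ∑ i, ‖v i‖ := by
    have h2 : v = ∑ i, EuclideanSpace.single i (v i) := by
      ext j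
      simp [Finset.sum_apply]
    calc ‖v‖ = ‖∑ i, EuclideanSpace.single i (v i)‖ := congrArg norm h2
      _ ≤ ∑ i, ‖EuclideanSpace.single i (v i)‖ := norm_sum_le _ _
      _ = _ := by simp
  refine h1.trans (Finset.sum_le_sum fun i _ => ?_)
  rw [Real.norm_eq_abs, abs_le]
  have := hv i
  constructor
  · linarith [neg_abs_le (c i), abs_nonneg s]
  · linarith [le_abs_self (c i), le_abs_self s]

theorem abs_apply_le_norm (v : EuclideanSpace ℝ (Fin d)) (i : Fin d) : |v i| ≤ ‖v‖ :=
  PiLp.norm_apply_le v i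

/-- The bound 7 is that of an enlarged side s + 6 ε with s, ε ≤ 1. The point is that the volume of a
cubical shell is linear in its width. -/
theorem pow_sub_pow_le_mul {a b : ℝ} (hb : 0 ≤ b) (hab : b ≤ a) (ha : a ≤ 7) (k : ℕ) :
    a ^ k - b ^ k ≤ k * (a - b) * 7 ^ k := by
  induction k with
  | zero => simp
  | succ k ih =>
    have h1 : b ^ k ≤ 7 ^ k := pow_le_pow_left₀ hb (hab.trans ha) k
    have h2 : (0 : ℝ) ≤ 7 ^ k := by positivity
    have h3 : 0 ≤ k * (a - b) * 7 ^ k := by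
      have : 0 ≤ a - b := by linarith
      positivity
    calc a ^ (k + 1) - b ^ (k + 1) = a * (a ^ k - b ^ k) + (a - b) * b ^ k := by ring
      _ ≤ a * (k * (a - b) * 7 ^ k) + (a - b) * 7 ^ k := by
        gcongr
        linarith
      _ ≤ 7 * (k * (a - b) * 7 ^ k) + (a - b) * 7 ^ k * 7 := by
        have : 0 ≤ (a - b) * 7 ^ k := mul_nonneg (by linarith) h2
        have := mul_le_mul_of_nonneg_right ha h3
        linarith
      _ = _ := by push_cast; ring

/-- Points near the frontier lie in the shell between two concentric cubes. The sides are moved by 3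
ε, not 2 ε, so that the inequalities are strict and half-open faces play no role. -/
theorem volume_near_frontier_cube {c : EuclideanSpace ℝ (Fin d)} {s ε : ℝ} (hs : 0 < s)
    (hs1 : s ≤ 1) (hε : 0 < ε) (hε1 : ε ≤ 1) :
    volume {v | ∃ w ∈ frontier (cube c s), ‖v - w‖ ≤ 2 * ε} ≤
      ENNReal.ofReal (d * (12 * ε) * 7 ^ d) := by
  let e : EuclideanSpace ℝ (Fin d) := WithLp.toLp 2 fun _ => 3 * ε
  have he : ∀ i, e i = 3 * ε := fun i => rfl
  have hsub : {v | ∃ w ∈ frontier (cube c s), ‖v - w‖ ≤ 2 * ε} ⊆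
      cube (c - e) (s + 6 * ε) \ cube (c + e) (s - 6 * ε) := by
    rintro v ⟨w, hw, hvw⟩
    have hcoord : ∀ i, |v i - w i| ≤ 2 * ε := fun i => by
      have := abs_apply_le_norm (v - w) i
      rw [PiLp.sub_apply] at this
      exact this.trans hvw
    have hcl : ∀ i, c i ≤ w i ∧ w i ≤ c i + s := by
      have h1 : IsClosed {w : EuclideanSpace ℝ (Fin d) | ∀ i, c i ≤ w i ∧ w i ≤ c i + s} := by
        simp only [ofPred_forall]
        refine isClosed_iInter fun i => ?_
        have hci : Continuous fun w : EuclideanSpace ℝ (Fin d) => w i := by fun_prop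
        exact (isClosed_le continuous_const hci).inter (isClosed_le hci continuous_const)
      exact closure_minimal (fun w hw i => ⟨(hw i).1, (hw i).2.le⟩) h1 hw.1
    constructor
    · intro i
      have h1 := hcoord i
      have h2 := hcl i
      rw [abs_le] at h1
      rw [PiLp.sub_apply, he]
      constructor <;> linarith
    · intro hv
      refine hw.2 ?_
      have h1 : IsOpen {w : EuclideanSpace ℝ (Fin d) | ∀ i, c i < w i ∧ w i < c i + s} := by
        simp only [ofPred_forall]
        refine isOpen_iInter_of_finite fun i => ?_
        have hci : Continuous fun w : EuclideanSpace ℝ (Fin d) => w i := by fun_prop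
        exact (isOpen_lt continuous_const hci).inter (isOpen_lt hci continuous_const)
      refine interior_maximal (fun w hw i => ⟨(hw i).1.le, (hw i).2⟩) h1 fun i => ?_
      have h2 := hcoord i
      have h3 := hv i
      rw [abs_le] at h2
      rw [PiLp.add_apply, he] at h3
      constructor <;> linarith
  refine (measure_mono hsub).trans ?_
  have hinc : cube (c + e) (s - 6 * ε) ⊆ cube (c - e) (s + 6 * ε) := by
    intro v hv i
    have h3 := hv i
    rw [PiLp.add_apply, he] at h3
    rw [PiLp.sub_apply, he]
    constructor <;> linarith
  rw [measure_sdiff hinc (measurableSet_cube _ _).nullMeasurableSet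
    (by rw [volume_cube]; exact ENNReal.pow_ne_top ENNReal.ofReal_ne_top), volume_cube, volume_cube,
    ← ENNReal.ofReal_pow (by positivity)]
  -- When s < 6 ε the inner cube is empty and its formal side is negative; truncation at 0 covers
  -- both cases.
  have hb : ENNReal.ofReal (s - 6 * ε) = ENNReal.ofReal (max (s - 6 * ε) 0) := by
    rcases le_total (s - 6 * ε) 0 with h | h
    · rw [max_eq_right h, ENNReal.ofReal_of_nonpos h, ENNReal.ofReal_zero]
    · rw [max_eq_left h]
  rw [hb, ← ENNReal.ofReal_pow (le_max_right _ _),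
    ← ENNReal.ofReal_sub _ (pow_nonneg (le_max_right _ _) _)]
  refine ENNReal.ofReal_le_ofReal ((pow_sub_pow_le_mul (le_max_right _ _)
    (max_le (by linarith) (by linarith)) (by linarith) d).trans ?_)
  gcongr
  linarith [le_max_left (s - 6 * ε) 0]

variable {X : Type*} [MetricSpace X] [MeasurableSpace X] [BorelSpace X] {ζ : X}
  {ψ : X → EuclideanSpace ℝ (Fin d)} {δ κ : ℝ}

/-- The inverse of ψ is 2-Lipschitz, so the preimage is a continuous image of `S`. -/
theorem IsChartDomain.isPreconnected (h : IsChartDomain ζ ψ δ κ)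
    {S : Set (EuclideanSpace ℝ (Fin d))} (hS : S ⊆ Metric.ball 0 κ) (hc : IsPreconnected S) :
    IsPreconnected (chartDomain ζ ψ δ κ ∩ ψ ⁻¹' S) := by
  have : Nonempty X := ⟨ζ⟩
  set g := Function.invFunOn ψ (Metric.ball ζ δ)
  have hg : ∀ v ∈ S, g v ∈ Metric.ball ζ δ ∧ ψ (g v) = v := fun v hv =>
    ⟨Function.invFunOn_mem (h.surj (hS hv)), Function.invFunOn_eq (h.surj (hS hv))⟩
  have himage : chartDomain ζ ψ δ κ ∩ ψ ⁻¹' S = g '' S := by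
    ext x
    constructor
    · rintro ⟨hx, hxS⟩
      refine ⟨ψ x, hxS, ?_⟩
      have h1 := hg _ hxS
      have h2 := h.dist_le _ h1.1 x hx.1
      rw [h1.2, sub_self, norm_zero, mul_zero] at h2
      exact dist_le_zero.1 h2
    · rintro ⟨v, hv, rfl⟩
      have h1 := hg v hv
      exact ⟨⟨h1.1, by rw [mem_preimage, h1.2]; exact hS hv⟩, by rw [mem_preimage, h1.2]; exact hv⟩
  rw [himage]
  refine hc.image g (LipschitzOnWith.of_dist_le_mul (K := 2) fun v hv w hw => ?_).continuousOn
  have h1 := h.dist_le _ (hg v hv).1 _ (hg w hw).1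
  rw [(hg v hv).2, (hg w hw).2] at h1
  rw [dist_eq_norm v]
  exact h1

/-- The frontier lies over the frontier of the cube, so thin boundary layers are controlled in the
chart; for ε > δ / 4 the constant `A₂` makes the finite total volume a sufficient bound. The
constants do not depend on the cube, so small cubes have indicators of uniformly bounded norm. -/
theorem IsChartDomain.exists_isTameSet (h : IsChartDomain ζ ψ δ κ)
    (hfin : (Measure.euclideanHausdorffMeasure d : Measure X) univ < ∞) :
    ∃ A ρ₀ : ℝ, 0 < ρ₀ ∧ ∀ (c : EuclideanSpace ℝ (Fin d)) (s : ℝ), 0 < s → s ≤ 1 →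
      cube c s ⊆ Metric.ball 0 ρ₀ →
      IsTameSet (Measure.euclideanHausdorffMeasure d) 1 A (chartDomain ζ ψ δ κ ∩ ψ ⁻¹' cube c s) := by
  set ν : Measure X := Measure.euclideanHausdorffMeasure d with hν
  have hδ := h.δ_pos
  have hκ := h.κ_pos
  set A₁ : ℝ := 2 ^ d * (d * 12 * 7 ^ d) with hA₁
  set A₂ : ℝ := (ν univ).toReal / (δ / 4) with hA₂
  have hA₁0 : 0 ≤ A₁ := by positivity
  have hA₂0 : 0 ≤ A₂ := by positivity
  -- The radius δ / 8 keeps the set within δ / 4 of ζ, and a thickening by at most δ / 4 still lies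
  -- in the domain of the chart.
  refine ⟨A₁ + A₂, min (κ / 2) (δ / 8), lt_min (by positivity) (by positivity),
    fun c s hs hs1 hcs => ?_⟩
  set B := chartDomain ζ ψ δ κ ∩ ψ ⁻¹' cube c s with hB
  have hcs1 : cube c s ⊆ Metric.ball 0 (κ / 2) :=
    hcs.trans (Metric.ball_subset_ball (min_le_left _ _))
  have hcs2 : cube c s ⊆ Metric.ball 0 (δ / 8) :=
    hcs.trans (Metric.ball_subset_ball (min_le_right _ _))
  have hcsκ : cube c s ⊆ Metric.ball 0 κ :=
    hcs1.trans (Metric.ball_subset_ball (by linarith))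
  have hBball : B ⊆ Metric.closedBall ζ (δ / 4) := by
    rintro x ⟨hx, hxc⟩
    have h1 := h.dist_self_le hx.1
    have h2 := hcs2 hxc
    rw [mem_ball_zero_iff] at h2
    rw [Metric.mem_closedBall]
    linarith
  have hclB : closure B ⊆ Metric.closedBall ζ (δ / 4) :=
    closure_minimal hBball Metric.isClosed_closedBall
  have hfront : ∀ x ∈ frontier B, x ∈ Metric.closedBall ζ (δ / 4) ∧ ψ x ∈ frontier (cube c s) := by
    intro x hx
    have hxb := hclB hx.1
    have hxδ : x ∈ Metric.ball ζ δ :=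
      Metric.closedBall_subset_ball (by linarith) hxb
    refine ⟨hxb, ?_, fun hint => hx.2 ?_⟩
    · have hcont : ContinuousWithinAt ψ B x :=
        (h.continuousOn.continuousAt (Metric.isOpen_ball.mem_nhds hxδ)).continuousWithinAt
      exact closure_mono (by rintro _ ⟨y, hy, rfl⟩; exact hy.2) (hcont.mem_closure_image hx.1)
    · refine interior_maximal ?_ (h.isOpen_inter_preimage isOpen_interior) ⟨hxδ, hint⟩
      rintro y ⟨hy, hyc⟩
      have hyc' : ψ y ∈ cube c s := interior_subset hyc
      exact ⟨⟨hy, hcsκ hyc'⟩, hyc'⟩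
  refine ⟨h.measurableSet_inter (measurableSet_cube c s), ?_, fun ε hε hε1 => ?_⟩
  · have hpre : PreconnectedSpace B := isPreconnected_iff_preconnectedSpace.1
      (h.isPreconnected hcsκ (convex_cube c s).isPreconnected)
    simp
  · rcases le_or_gt ε (δ / 4) with hεδ | hεδ
    · have hsub : Metric.thickening ε (frontier B) ⊆
          Metric.ball ζ δ ∩ ψ ⁻¹' {v | ∃ w ∈ frontier (cube c s), ‖v - w‖ ≤ 2 * ε} := by
        intro y hy
        obtain ⟨x, hx, hyx⟩ := Metric.mem_thickening_iff.1 hy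
        obtain ⟨hxb, hxf⟩ := hfront x hx
        have hxδ : x ∈ Metric.ball ζ δ := Metric.closedBall_subset_ball (by linarith) hxb
        have hyδ : y ∈ Metric.ball ζ δ := by
          rw [Metric.mem_ball]
          have h2 : dist x ζ ≤ δ / 4 := hxb
          linarith [dist_triangle y x ζ]
        refine ⟨hyδ, ψ x, hxf, (h.norm_le y hyδ x hxδ).trans ?_⟩
        linarith
      refine (measure_mono hsub).trans ((h.measure_le _).trans ?_)
      refine (mul_le_mul_right (volume_near_frontier_cube hs hs1 hε hε1) _).trans ?_
      rw [show (2 : ℝ≥0∞) ^ d = ENNReal.ofReal (2 ^ d) by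
        rw [ENNReal.ofReal_pow (by norm_num)]; simp, ← ENNReal.ofReal_mul (by positivity)]
      refine ENNReal.ofReal_le_ofReal ?_
      calc _ = A₁ * ε := by rw [hA₁]; ring
        _ ≤ _ := by gcongr; linarith
    · refine (measure_mono (subset_univ _)).trans ?_
      rw [← ENNReal.ofReal_toReal hfin.ne]
      refine ENNReal.ofReal_le_ofReal ?_
      have : (ν univ).toReal ≤ A₂ * ε := by
        rw [hA₂, div_mul_eq_mul_div, le_div_iff₀ (by positivity)]
        gcongr
      nlinarith

end Cubes

end REPP

end

noncomputable section

namespace REPP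

/-! ### Levels and heights -/

section Levels

/-- If u τ < z, continuity gives u t < z already for some t < τ, so the infimum is strictly below τ.
-/
theorem levelInv_lt_iff {u : ℝ → ℝ} (hc : ContinuousOn u (Ioi 0)) (ha : StrictAntiOn u (Ioi 0))
    {z : EReal} {τ : ℝ≥0} (hτ : 0 < τ) : levelInv u z < τ ↔ (u τ : EReal) < z := by
  have hτ' : (0 : ℝ) < τ := hτ
  constructor
  · intro h
    obtain ⟨σ, hσ⟩ := iInf_lt_iff.1 h
    obtain ⟨⟨hσ0, hσz⟩, hστ⟩ := iInf_lt_iff.1 hσ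
    refine lt_trans (EReal.coe_lt_coe_iff.2 (ha hσ0 hτ' ?_)) hσz
    exact_mod_cast hστ
  · intro h
    have hcont : ContinuousAt (fun t : ℝ => (u t : EReal)) τ :=
      (continuous_coe_real_ereal.continuousAt).comp (hc.continuousAt (Ioi_mem_nhds hτ'))
    have h1 : ∀ᶠ t : ℝ in 𝓝[<] (τ : ℝ), (u t : EReal) < z :=
      (hcont.eventually (gt_mem_nhds h)).filter_mono nhdsWithin_le_nhds
    have h2 : ∀ᶠ t : ℝ in 𝓝[<] (τ : ℝ), 0 < t :=
      (lt_mem_nhds hτ').filter_mono nhdsWithin_le_nhds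
    obtain ⟨t, ht1, ht2, ht3⟩ := (h1.and (h2.and self_mem_nhdsWithin)).exists
    have ht3' : t < τ := ht3
    refine lt_of_le_of_lt (iInf₂_le (⟨t, ht2.le⟩ : ℝ≥0) ⟨ht2, ht1⟩) ?_
    exact ENNReal.coe_lt_coe.2 ht3'

/-- The volume of the Euclidean ball of radius `‖v‖`. -/
def ballVol {d : ℕ} (v : EuclideanSpace ℝ (Fin d)) : ℝ≥0 :=
  (volume (Metric.ball (0 : EuclideanSpace ℝ (Fin d)) ‖v‖)).toNNReal

/-- The volume of a Euclidean ball as a function of the radius. -/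
def radVol (d : ℕ) (r : ℝ) : ℝ :=
  r ^ d * volume.real (Metric.ball (0 : EuclideanSpace ℝ (Fin d)) 1)

theorem volume_real_ball {d : ℕ} (hd : 0 < d) {r : ℝ} (hr : 0 ≤ r) :
    volume.real (Metric.ball (0 : EuclideanSpace ℝ (Fin d)) r) = radVol d r := by
  have : Nonempty (Fin d) := ⟨⟨0, hd⟩⟩
  rw [Measure.real, Measure.addHaar_ball _ _ hr, ENNReal.toReal_mul, finrank_euclideanSpace,
    Fintype.card_fin, ENNReal.toReal_ofReal (by positivity), radVol, Measure.real]

theorem coe_ballVol {d : ℕ} (hd : 0 < d) (v : EuclideanSpace ℝ (Fin d)) :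
    (ballVol v : ℝ) = radVol d ‖v‖ := by
  rw [← volume_real_ball hd (norm_nonneg v)]
  rfl

theorem unitBall_pos (d : ℕ) : 0 < volume.real (Metric.ball (0 : EuclideanSpace ℝ (Fin d)) 1) :=
  ENNReal.toReal_pos (Metric.measure_ball_pos _ _ one_pos).ne' measure_ball_lt_top.ne

theorem continuous_radVol (d : ℕ) : Continuous (radVol d) := by
  unfold radVol; fun_prop

theorem radVol_zero {d : ℕ} (hd : 0 < d) : radVol d 0 = 0 := by
  simp [radVol, hd.ne']

theorem IsPeakFunction.exists_antitone {g : ℝ≥0 → EReal} (hg : IsPeakFunction g) :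
    ∃ δ : ℝ≥0, 0 < δ ∧ ∀ r r', r ≤ δ → r ≤ r' → g r' ≤ g r := by
  obtain ⟨-, δ, hδ, hanti, hle⟩ := hg
  refine ⟨δ, hδ, fun r r' hr hrr' => ?_⟩
  rcases le_total r' δ with h | h
  · exact hanti.antitoneOn hr h hrr'
  · exact (hle r' h).trans (hanti.antitoneOn hr self_mem_Iic hr)

end Levels

/-! ### Heights, returns and indicators in rescaled coordinates. -/

section ScalingChart

set_option linter.unusedSectionVars false

open scoped Pointwise

variable {X : Type*} [MetricSpace X] {d : ℕ} {ζ : X} {ψ : X → EuclideanSpace ℝ (Fin d)} {δ κ : ℝ}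

/-- The chart, rescaled so that the measure has mass of order `1 / n` on the unit ball. -/
def scaledChart (ζ : X) (ψ : X → EuclideanSpace ℝ (Fin d)) (δ κ h : ℝ) (n : ℕ) (x : X) :
    EuclideanSpace ℝ (Fin d) :=
  (scale d h n)⁻¹ • (chartDomain ζ ψ δ κ).indicator ψ x

theorem scaledChart_apply {h : ℝ} {n : ℕ} {x : X} (hx : x ∈ chartDomain ζ ψ δ κ) :
    scaledChart ζ ψ δ κ h n x = (scale d h n)⁻¹ • ψ x := by
  rw [scaledChart, indicator_of_mem hx]

theorem scaledChart_inter {h : ℝ} (hh : 0 < h) {n : ℕ} (hn : 1 ≤ n)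
    (S : Set (EuclideanSpace ℝ (Fin d))) :
    chartDomain ζ ψ δ κ ∩ scaledChart ζ ψ δ κ h n ⁻¹' S =
      chartDomain ζ ψ δ κ ∩ ψ ⁻¹' (scale d h n • S) := by
  ext x
  refine and_congr_right fun hx => ?_
  rw [mem_preimage, mem_preimage, scaledChart_apply hx,
    mem_smul_set_iff_inv_smul_mem₀ (scale_pos hh hn).ne']

theorem norm_le_of_norm_scaledChart_le {h : ℝ} (hh : 0 < h) {n : ℕ} (hn : 1 ≤ n) {x : X}
    (hx : x ∈ chartDomain ζ ψ δ κ) {R : ℝ} : ‖scaledChart ζ ψ δ κ h n x‖ ≤ R ↔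
      ‖ψ x‖ ≤ scale d h n * R := by
  have := scale_pos (d := d) hh hn
  rw [scaledChart_apply hx, norm_smul, norm_inv, Real.norm_eq_abs, abs_of_pos this,
    inv_mul_le_iff₀ this]

theorem eventually_mem_of_scaledChart (hdom : IsChartDomain ζ ψ δ κ) (hd : 0 < d) {h : ℝ}
    (hh : 0 < h) {W : Set X} (hW : W ∈ 𝓝 ζ) (R : ℝ) :
    ∀ᶠ n in atTop, ∀ x ∈ chartDomain ζ ψ δ κ, ‖scaledChart ζ ψ δ κ h n x‖ ≤ R → x ∈ W := by
  obtain ⟨ε, hε, hεW⟩ := Metric.mem_nhds_iff.1 hW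
  have h1 : Tendsto (fun n => 2 * (scale d h n * R)) atTop (𝓝 0) := by
    simpa using ((tendsto_scale hd hh).mul_const R).const_mul 2
  filter_upwards [h1.eventually (gt_mem_nhds hε), eventually_ge_atTop 1] with n hn h1n x hx hxR
  refine hεW (Metric.mem_ball.2 (lt_of_le_of_lt (hdom.dist_self_le hx.1) (lt_of_le_of_lt ?_ hn)))
  have := (norm_le_of_norm_scaledChart_le hh h1n hx).1 hxR
  linarith

/-- Points that are closer to `ζ` have smaller coordinates, up to a small error. -/
theorem eventually_norm_scaledChart_le (hψ : IsNormalChart ζ ψ) (hdom : IsChartDomain ζ ψ δ κ)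
    (hd : 0 < d) {h : ℝ} (hh : 0 < h) {c c' : ℝ} (hc : c' < c) :
    ∀ᶠ n in atTop, ∀ x y, y ∈ chartDomain ζ ψ δ κ → ‖scaledChart ζ ψ δ κ h n y‖ ≤ c' →
      dist x ζ ≤ dist y ζ → x ∈ chartDomain ζ ψ δ κ ∧ ‖scaledChart ζ ψ δ κ h n x‖ ≤ c := by
  obtain ⟨ε, hε0, hε⟩ : ∃ ε : ℝ, 0 < ε ∧ (1 + ε) * ((1 + ε) * c') ≤ c := by
    have h1 : Tendsto (fun ε : ℝ => (1 + ε) * ((1 + ε) * c')) (𝓝[>] 0) (𝓝 c') := by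
      have : Tendsto (fun ε : ℝ => (1 + ε) * ((1 + ε) * c')) (𝓝 0)
        (𝓝 ((1 + 0) * ((1 + 0) * c'))) := Continuous.tendsto (by fun_prop) 0
      simpa using this.mono_left nhdsWithin_le_nhds
    obtain ⟨ε, h2, h3⟩ := ((h1.eventually (gt_mem_nhds hc)).and self_mem_nhdsWithin).exists
    exact ⟨ε, h3, h2.le⟩
  obtain ⟨W, hW, hb⟩ := hψ.bilipschitz ε hε0
  obtain ⟨s, hs, hsW⟩ := Metric.mem_nhds_iff.1
    (inter_mem hW (hdom.isOpen.mem_nhds hdom.mem))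
  filter_upwards [eventually_mem_of_scaledChart hdom hd hh (Metric.ball_mem_nhds ζ hs) c',
    eventually_ge_atTop 1] with n hn h1n x y hy hyc hxy
  have hys := hn y hy hyc
  have hxs : x ∈ Metric.ball ζ s := lt_of_le_of_lt hxy hys
  have hpos := scale_pos (d := d) hh h1n
  refine ⟨(hsW hxs).2, (norm_le_of_norm_scaledChart_le hh h1n (hsW hxs).2).2 ?_⟩
  have h1 := (hb x (hsW hxs).1 ζ (mem_of_mem_nhds hW)).2
  have h2 := (hb y (hsW hys).1 ζ (mem_of_mem_nhds hW)).1
  rw [hψ.map_self, sub_zero] at h1 h2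
  have h3 := (norm_le_of_norm_scaledChart_le hh h1n hy).1 hyc
  calc ‖ψ x‖ ≤ (1 + ε) * dist x ζ := h1
    _ ≤ (1 + ε) * ((1 + ε) * (scale d h n * c')) := by
      gcongr
      exact hxy.trans (h2.trans (by gcongr))
    _ = scale d h n * ((1 + ε) * ((1 + ε) * c')) := by ring
    _ ≤ _ := by gcongr

variable [MeasurableSpace X] [BorelSpace X] {C₁ : Type*} [NormedAddCommGroup C₁] [NormedSpace ℝ C₁]

theorem measurable_scaledChart (hdom : IsChartDomain ζ ψ δ κ) (h : ℝ) (n : ℕ) :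
    Measurable (scaledChart ζ ψ δ κ h n) :=
  hdom.measurable_indicator.const_smul (scale d h n)⁻¹

/-- Rescaled coordinates `y n` on a set `U` for the visits of `T` to small sets, with a height
function `H n` and the linear map `L` that describes the `p`-th iterate. -/
structure IsScalingChart (μ : Measure X) (T : X → X) (ι : C₁ →ₗ[ℝ] (X →ₘ[μ] ℝ))
    (H : ℕ → X → ℝ≥0∞) (p : ℕ) (L : EuclideanSpace ℝ (Fin d) →ₗ[ℝ] EuclideanSpace ℝ (Fin d))
    (U : Set X) (y : ℕ → X → EuclideanSpace ℝ (Fin d)) : Prop where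
  measurableSet : MeasurableSet U
  measurable : ∀ n, Measurable (y n)
  mass : ∀ S : Set (EuclideanSpace ℝ (Fin d)), Bornology.IsBounded S → MeasurableSet S →
    Tendsto (fun n : ℕ => (n : ℝ) * μ.real (U ∩ y n ⁻¹' S)) atTop (𝓝 (volume.real S))
  indicators : ∀ (c : EuclideanSpace ℝ (Fin d)) (s : ℝ), 0 < s → ∃ K : ℝ, ∀ᶠ n in atTop,
    ∃ φ : C₁, (ι φ : X → ℝ) =ᵐ[μ] (U ∩ y n ⁻¹' cube c s).indicator 1 ∧ ‖φ‖ ≤ K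
  height_lt : ∀ b : ℝ≥0, ∃ R : ℝ, ∀ᶠ n in atTop, ∀ x, H n x < b → x ∈ U ∧ ‖y n x‖ ≤ R
  height : ∀ R ε : ℝ, 0 < ε → ∀ᶠ n in atTop, ∀ x ∈ U, ‖y n x‖ ≤ R →
    H n x ≠ ∞ ∧ |(H n x).toReal - ballVol (y n x)| ≤ ε
  return_close : ∀ (R ε : ℝ) (ℓ : ℕ), 0 < ε → ∀ᶠ n in atTop, ∀ x ∈ U, ‖y n x‖ ≤ R →
    T^[p * ℓ] x ∈ U ∧ ‖y n (T^[p * ℓ] x) - (L ^ ℓ) (y n x)‖ ≤ ε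
  no_return : ∀ (R : ℝ) (j : ℕ), ¬p ∣ j → ∀ᶠ n in atTop, ∀ x ∈ U, ‖y n x‖ ≤ R →
    ¬(T^[j] x ∈ U ∧ ‖y n (T^[j] x)‖ ≤ R)

section Height

variable {μ : Measure X} [IsProbabilityMeasure μ] {h : ℝ} {g : ℝ≥0 → EReal} {u : ℕ → ℝ → ℝ}

/-- If a point of rescaled norm at most c had height ≥ τ, every point exceeding u_n(τ) would be at
least as close to ζ and so have rescaled norm at most some c' > c. But n times the mass of that ball
tends to |B_c'| < τ, while n times the mass of the exceedances tends to τ. -/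
theorem eventually_height_lt (hψ : IsNormalChart ζ ψ) (hdom : IsChartDomain ζ ψ δ κ)
    (hd : 0 < d) (hh : 0 < h)
    (hmass : ∀ S : Set (EuclideanSpace ℝ (Fin d)), Bornology.IsBounded S → MeasurableSet S →
      Tendsto (fun n : ℕ => (n : ℝ) * μ.real (chartDomain ζ ψ δ κ ∩ scaledChart ζ ψ δ κ h n ⁻¹' S))
        atTop (𝓝 (volume.real S)))
    (hg : IsPeakFunction g) (hu : IsLevelSequence μ (fun x => g (nndist x ζ)) u)
    {c : ℝ} (hc : 0 ≤ c) {τ : ℝ≥0} (hτ : radVol d c < τ) :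
    ∀ᶠ n in atTop, ∀ x ∈ chartDomain ζ ψ δ κ, ‖scaledChart ζ ψ δ κ h n x‖ ≤ c →
      levelInv (u n) (g (nndist x ζ)) < τ := by
  obtain ⟨δg, hδg, hanti⟩ := hg.exists_antitone
  have hτ0 : 0 < τ := by
    have : 0 ≤ radVol d c := mul_nonneg (pow_nonneg hc d) (unitBall_pos d).le
    exact_mod_cast this.trans_lt hτ
  obtain ⟨c', hc', hc'τ⟩ : ∃ c', c < c' ∧ radVol d c' < τ := by
    have h1 : Tendsto (radVol d) (𝓝[>] c) (𝓝 (radVol d c)) :=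
      (continuous_radVol d).continuousAt.mono_left nhdsWithin_le_nhds
    obtain ⟨c', h2, h3⟩ := ((h1.eventually (gt_mem_nhds hτ)).and self_mem_nhdsWithin).exists
    exact ⟨c', h3, h2⟩
  have hc'0 : 0 ≤ c' := hc.trans hc'.le
  have hS := hmass (Metric.closedBall 0 c') Metric.isBounded_closedBall
    Metric.isClosed_closedBall.measurableSet
  have hvol : volume.real (Metric.closedBall (0 : EuclideanSpace ℝ (Fin d)) c') = radVol d c' := by
    have : Nonempty (Fin d) := ⟨⟨0, hd⟩⟩
    rw [← volume_real_ball hd hc'0, Measure.real, Measure.real,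
      Measure.addHaar_closedBall_eq_addHaar_ball]
  rw [hvol] at hS
  obtain ⟨m, hm1, hm2⟩ := exists_between hc'τ
  have hA := hu.tendsto τ hτ0
  filter_upwards [eventually_norm_scaledChart_le hψ hdom hd hh hc',
    hS.eventually (gt_mem_nhds hm1), hA.eventually (lt_mem_nhds hm2),
    eventually_mem_of_scaledChart hdom hd hh (Metric.ball_mem_nhds ζ hδg) c] with n h1 h2 h3 h4 x hx hxc
  rw [levelInv_lt_iff (hu.continuousOn n) (hu.strictAntiOn n) hτ0]
  by_contra hcon
  rw [not_lt] at hcon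
  have hsub : {z | (u n τ : EReal) < g (nndist z ζ)} ⊆
      chartDomain ζ ψ δ κ ∩ scaledChart ζ ψ δ κ h n ⁻¹' Metric.closedBall 0 c' := by
    intro z hz
    have hlt : dist z ζ ≤ dist x ζ := by
      by_contra hlt
      rw [not_le] at hlt
      have h5 : nndist x ζ ≤ δg := by
        have : dist x ζ < δg := h4 x hx hxc
        exact_mod_cast this.le
      have h6 := hanti (nndist x ζ) (nndist z ζ) h5 (by exact_mod_cast hlt.le)
      exact absurd (lt_of_lt_of_le hz (h6.trans hcon)) (lt_irrefl _)
    have := h1 z x hx hxc hlt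
    exact ⟨this.1, by rw [mem_preimage, mem_closedBall_zero_iff]; exact this.2⟩
  have h5 : (n : ℝ) * μ.real {z | (u n τ : EReal) < g (nndist z ζ)} ≤ n * μ.real
      (chartDomain ζ ψ δ κ ∩ scaledChart ζ ψ δ κ h n ⁻¹' Metric.closedBall 0 c') := by
    gcongr
    exact measure_ne_top _ _
  linarith

/-- The mirror image: a point of height below τ outside the ball of rescaled radius c would force a
whole ball of radius c' < c with |B_c'| > τ to exceed u_n(τ), which is too much mass. -/
theorem eventually_mem_of_height_lt (hψ : IsNormalChart ζ ψ) (hdom : IsChartDomain ζ ψ δ κ)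
    (hd : 0 < d) (hh : 0 < h)
    (hmass : ∀ S : Set (EuclideanSpace ℝ (Fin d)), Bornology.IsBounded S → MeasurableSet S →
      Tendsto (fun n : ℕ => (n : ℝ) * μ.real (chartDomain ζ ψ δ κ ∩ scaledChart ζ ψ δ κ h n ⁻¹' S))
        atTop (𝓝 (volume.real S)))
    (hg : IsPeakFunction g) (hu : IsLevelSequence μ (fun x => g (nndist x ζ)) u)
    {c : ℝ} (hc : 0 < c) {τ : ℝ≥0} (hτ0 : 0 < τ) (hτ : τ < radVol d c) :
    ∀ᶠ n in atTop, ∀ x, levelInv (u n) (g (nndist x ζ)) < τ →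
      x ∈ chartDomain ζ ψ δ κ ∧ ‖scaledChart ζ ψ δ κ h n x‖ ≤ c := by
  obtain ⟨δg, hδg, hanti⟩ := hg.exists_antitone
  obtain ⟨c', hc', hc'τ, hc'0⟩ : ∃ c', c' < c ∧ τ < radVol d c' ∧ 0 < c' := by
    have h1 : Tendsto (radVol d) (𝓝[<] c) (𝓝 (radVol d c)) :=
      (continuous_radVol d).continuousAt.mono_left nhdsWithin_le_nhds
    have h0 : ∀ᶠ c' in 𝓝[<] c, 0 < c' := (lt_mem_nhds hc).filter_mono nhdsWithin_le_nhds
    obtain ⟨c', h2, h3, h4⟩ :=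
      ((h1.eventually (lt_mem_nhds hτ)).and (h0.and self_mem_nhdsWithin)).exists
    exact ⟨c', h4, h2, h3⟩
  have hS := hmass (Metric.ball 0 c') Metric.isBounded_ball Metric.isOpen_ball.measurableSet
  rw [volume_real_ball hd hc'0.le] at hS
  obtain ⟨m, hm1, hm2⟩ := exists_between hc'τ
  have hA := hu.tendsto τ hτ0
  filter_upwards [eventually_norm_scaledChart_le hψ hdom hd hh hc',
    hS.eventually (lt_mem_nhds hm2), hA.eventually (gt_mem_nhds hm1),
    eventually_mem_of_scaledChart hdom hd hh (Metric.ball_mem_nhds ζ hδg) c'] with n h1 h2 h3 h4 x hx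
  rw [levelInv_lt_iff (hu.continuousOn n) (hu.strictAntiOn n) hτ0] at hx
  by_contra hcon
  have hsub : chartDomain ζ ψ δ κ ∩ scaledChart ζ ψ δ κ h n ⁻¹' Metric.ball 0 c' ⊆
      {z | (u n τ : EReal) < g (nndist z ζ)} := by
    rintro z ⟨hz, hzc⟩
    rw [mem_preimage, mem_ball_zero_iff] at hzc
    have hlt : dist z ζ < dist x ζ := by
      by_contra hlt
      exact hcon (h1 x z hz hzc.le (not_lt.1 hlt))
    have h5 : nndist z ζ ≤ δg := by
      have : dist z ζ < δg := h4 z hz hzc.le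
      exact_mod_cast this.le
    exact lt_of_lt_of_le hx (hanti (nndist z ζ) (nndist x ζ) h5 (by exact_mod_cast hlt.le))
  have h5 : n * μ.real (chartDomain ζ ψ δ κ ∩ scaledChart ζ ψ δ κ h n ⁻¹' Metric.ball 0 c') ≤
      (n : ℝ) * μ.real {z | (u n τ : EReal) < g (nndist z ζ)} := by
    gcongr
    exact measure_ne_top _ _
  linarith

/-- The two comparisons pinch the height near each radius t; compactness of [0, R] makes the
estimate uniform. -/
theorem eventually_height_close (hψ : IsNormalChart ζ ψ) (hdom : IsChartDomain ζ ψ δ κ)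
    (hd : 0 < d) (hh : 0 < h)
    (hmass : ∀ S : Set (EuclideanSpace ℝ (Fin d)), Bornology.IsBounded S → MeasurableSet S →
      Tendsto (fun n : ℕ => (n : ℝ) * μ.real (chartDomain ζ ψ δ κ ∩ scaledChart ζ ψ δ κ h n ⁻¹' S))
        atTop (𝓝 (volume.real S)))
    (hg : IsPeakFunction g) (hu : IsLevelSequence μ (fun x => g (nndist x ζ)) u)
    (R : ℝ) {ε : ℝ} (hε : 0 < ε) :
    ∀ᶠ n in atTop, ∀ x ∈ chartDomain ζ ψ δ κ, ‖scaledChart ζ ψ δ κ h n x‖ ≤ R →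
      levelInv (u n) (g (nndist x ζ)) ≠ ∞ ∧
        |(levelInv (u n) (g (nndist x ζ))).toReal - ballVol (scaledChart ζ ψ δ κ h n x)| ≤ ε := by
  let P : Set ℝ → Prop := fun s => ∀ᶠ n in atTop, ∀ x ∈ chartDomain ζ ψ δ κ,
    ‖scaledChart ζ ψ δ κ h n x‖ ∈ s → levelInv (u n) (g (nndist x ζ)) ≠ ∞ ∧
        |(levelInv (u n) (g (nndist x ζ))).toReal - ballVol (scaledChart ζ ψ δ κ h n x)| ≤ ε
  have hP : P (Icc 0 R) := by
    refine isCompact_Icc.induction_on (p := P) ?_ ?_ ?_ ?_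
    · exact Eventually.of_forall fun n x _ hx => absurd hx (notMem_empty _)
    · intro s t hst ht
      filter_upwards [ht] with n hn x hx hxs using hn x hx (hst hxs)
    · intro s t hs ht
      filter_upwards [hs, ht] with n h1 h2 x hx hxs
      exact hxs.elim (h1 x hx) (h2 x hx)
    · intro t ht
      set b := radVol d t with hb
      have hb0 : 0 ≤ b := mul_nonneg (pow_nonneg ht.1 d) (unitBall_pos d).le
      have hbc : ∀ᶠ t' in 𝓝 t, |radVol d t' - b| < ε / 2 := by
        exact Metric.continuousAt_iff'.1 ((continuous_radVol d).continuousAt (x := t)) (ε / 2)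
          (by positivity)
      obtain ⟨c, hc, hcb⟩ : ∃ c, t < c ∧ radVol d c < b + ε / 2 := by
        have h1 : Tendsto (radVol d) (𝓝[>] t) (𝓝 (radVol d t)) :=
          (continuous_radVol d).continuousAt.mono_left nhdsWithin_le_nhds
        obtain ⟨c', h2, h3⟩ := ((h1.eventually (gt_mem_nhds
          (show radVol d t < b + ε / 2 by linarith))).and self_mem_nhdsWithin).exists
        exact ⟨c', h3, h2⟩
      have hup := eventually_height_lt hψ hdom hd hh hmass hg hu (ht.1.trans hc.le)
        (τ := ⟨b + ε / 2, by positivity⟩) hcb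
      have hlow : ∃ W ∈ 𝓝 t, ∀ᶠ n in atTop, ∀ x ∈ chartDomain ζ ψ δ κ,
          ‖scaledChart ζ ψ δ κ h n x‖ ∈ W →
            ENNReal.ofReal (b - ε / 2) ≤ levelInv (u n) (g (nndist x ζ)) := by
        -- Near radius 0 the lower bound is void; otherwise t > 0 and a slightly smaller radius is
        -- available.
        rcases le_or_gt (b - ε / 2) 0 with hb' | hb'
        · refine ⟨univ, univ_mem, Eventually.of_forall fun n x _ _ => ?_⟩
          rw [ENNReal.ofReal_of_nonpos hb']
          exact zero_le
        · have ht0 : 0 < t := by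
            rcases ht.1.eq_or_lt with h0 | h0
            · rw [hb, ← h0, radVol_zero hd] at hb'
              linarith
            · exact h0
          obtain ⟨c', hc', hc'τ, hc'0⟩ : ∃ c', c' < t ∧ b - ε / 2 < radVol d c' ∧ 0 < c' := by
            have h1 : Tendsto (radVol d) (𝓝[<] t) (𝓝 (radVol d t)) :=
              (continuous_radVol d).continuousAt.mono_left nhdsWithin_le_nhds
            have h0 : ∀ᶠ c' in 𝓝[<] t, 0 < c' := (lt_mem_nhds ht0).filter_mono nhdsWithin_le_nhds
            obtain ⟨c', h2, h3, h4⟩ := ((h1.eventually (lt_mem_nhds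
              (show b - ε / 2 < radVol d t by linarith))).and (h0.and self_mem_nhdsWithin)).exists
            exact ⟨c', h4, h2, h3⟩
          refine ⟨Ioi c', Ioi_mem_nhds hc', ?_⟩
          filter_upwards [eventually_mem_of_height_lt hψ hdom hd hh hmass hg hu hc'0
            (τ := ⟨b - ε / 2, hb'.le⟩) hb' hc'τ] with n hn x hx hxW
          by_contra hlt
          rw [not_le] at hlt
          have := (hn x (hlt.trans_eq (ENNReal.ofReal_eq_coe_nnreal hb'.le))).2
          exact absurd (lt_of_lt_of_le hxW this) (lt_irrefl _)
      obtain ⟨W, hW, hlow⟩ := hlow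
      refine ⟨_, mem_nhdsWithin_of_mem_nhds (inter_mem (inter_mem hbc (Iio_mem_nhds hc)) hW), ?_⟩
      filter_upwards [hup, hlow] with n h1 h2 x hx hxs
      have h3 := h1 x hx (le_of_lt hxs.1.2)
      have h4 := h2 x hx hxs.2
      have h5 : levelInv (u n) (g (nndist x ζ)) ≠ ∞ := (h3.trans ENNReal.coe_lt_top).ne
      refine ⟨h5, ?_⟩
      have h6 : (levelInv (u n) (g (nndist x ζ))).toReal ≤ b + ε / 2 :=
        ENNReal.toReal_le_coe_of_le_coe h3.le
      have h7 : b - ε / 2 ≤ (levelInv (u n) (g (nndist x ζ))).toReal :=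
        (ENNReal.ofReal_le_iff_le_toReal h5).1 h4
      have h8 : |radVol d ‖scaledChart ζ ψ δ κ h n x‖ - b| < ε / 2 := hxs.1.1
      rw [coe_ballVol hd]
      rw [abs_lt] at h8
      rw [abs_le]
      constructor <;> linarith
  filter_upwards [hP] with n hn x hx hxR using hn x hx ⟨norm_nonneg _, hxR⟩

end Height

/-- Here the geometry is traded for the rescaled coordinates: later arguments use only the
properties listed in `IsScalingChart`. -/
theorem exists_isScalingChart (hψ : IsNormalChart ζ ψ) (hd : 0 < d)
    (hfin : (Measure.euclideanHausdorffMeasure d : Measure X) univ < ∞)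
    {μ : Measure X} [IsProbabilityMeasure μ] {ι : C₁ →ₗ[ℝ] (X →ₘ[μ] ℝ)}
    (hC₁ : ControlsIndicators (Measure.euclideanHausdorffMeasure d) ι)
    (hdens : HasRegularDensityAt (Measure.euclideanHausdorffMeasure d) μ ζ)
    {T : X → X} (hcont : ∀ k : ℕ, ContinuousAt T (T^[k] ζ))
    {g : ℝ≥0 → EReal} (hg : IsPeakFunction g) {u : ℕ → ℝ → ℝ}
    (hu : IsLevelSequence μ (fun x => g (nndist x ζ)) u)
    {L : EuclideanSpace ℝ (Fin d) →ₗ[ℝ] EuclideanSpace ℝ (Fin d)}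
    (hL : (fun x => ψ (T^[Function.minimalPeriod T ζ] x) - L (ψ x)) =o[𝓝 ζ] ψ) :
    ∃ (U : Set X) (y : ℕ → X → EuclideanSpace ℝ (Fin d)),
      IsScalingChart μ T ι (fun n x => levelInv (u n) (g (nndist x ζ)))
        (Function.minimalPeriod T ζ) L U y := by
  obtain ⟨δ, κ, hdom⟩ := hψ.exists_domain
  obtain ⟨h, hm, hμ, hζ, hleb⟩ := hdens
  have hh : (0 : ℝ) < h ζ := hζ
  set p := Function.minimalPeriod T ζ with hp
  have hiter : ∀ k, ContinuousAt T^[k] ζ := by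
    intro k
    induction k with
    | zero => exact continuousAt_id
    | succ k ih =>
      rw [Function.iterate_succ']
      exact ContinuousAt.comp (hcont k) ih
  have hmass : ∀ S : Set (EuclideanSpace ℝ (Fin d)), Bornology.IsBounded S → MeasurableSet S →
      Tendsto (fun n : ℕ => (n : ℝ) * μ.real
        (chartDomain ζ ψ δ κ ∩ scaledChart ζ ψ δ κ (h ζ) n ⁻¹' S)) atTop (𝓝 (volume.real S)) := by
    intro S hS hSm
    refine (tendsto_mass hψ hdom hd hm hμ hζ hleb hS hSm).congr' ?_
    filter_upwards [eventually_ge_atTop 1] with n hn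
    rw [scaledChart_inter hh hn]
  refine ⟨chartDomain ζ ψ δ κ, scaledChart ζ ψ δ κ (h ζ), hdom.isOpen.measurableSet,
    measurable_scaledChart hdom (h ζ), hmass, ?_, ?_, fun R ε hε =>
      eventually_height_close hψ hdom hd hh hmass hg hu R hε, ?_, ?_⟩
  -- In the chart the set is again a cube, shrunk by the scale, so the bound for small tame cubes
  -- applies with a constant independent of n.
  · intro c s hs
    obtain ⟨A, ρ₀, hρ₀, htame⟩ := hdom.exists_isTameSet hfin
    obtain ⟨K, hK⟩ := hC₁ 1 A
    refine ⟨K, ?_⟩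
    obtain ⟨R, -, hR⟩ := (isBounded_cube c s).subset_ball_lt 0 0
    have h1 : Tendsto (fun n => scale d (h ζ) n * R) atTop (𝓝 0) := by
      simpa using (tendsto_scale hd hh).mul_const R
    have h2 : Tendsto (fun n => scale d (h ζ) n * s) atTop (𝓝 0) := by
      simpa using (tendsto_scale hd hh).mul_const s
    filter_upwards [h1.eventually (gt_mem_nhds hρ₀), h2.eventually (gt_mem_nhds one_pos),
      eventually_ge_atTop 1] with n hn1 hn2 hn
    have hpos := scale_pos (d := d) hh hn
    rw [scaledChart_inter hh hn, smul_cube hpos]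
    refine hK _ (htame _ _ (by positivity) hn2.le ?_)
    rw [← smul_cube hpos]
    rintro _ ⟨v, hv, rfl⟩
    have h3 := hR hv
    rw [mem_ball_zero_iff] at h3 ⊢
    simp only [norm_smul, Real.norm_eq_abs, abs_of_pos hpos]
    exact (mul_lt_mul_of_pos_left h3 hpos).trans hn1
  · intro b
    obtain ⟨c, hc, hcb⟩ : ∃ c : ℝ, 0 < c ∧ (b + 1 : ℝ) < radVol d c := by
      have h1 : Tendsto (radVol d) atTop atTop :=
        (tendsto_pow_atTop hd.ne').atTop_mul_const (unitBall_pos d)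
      obtain ⟨c, h2, h3⟩ := ((h1.eventually_gt_atTop (b + 1 : ℝ)).and (eventually_gt_atTop 0)).exists
      exact ⟨c, h3, h2⟩
    refine ⟨c, ?_⟩
    filter_upwards [eventually_mem_of_height_lt hψ hdom hd hh hmass hg hu hc
      (τ := b + 1) (by positivity) (by simpa using hcb)] with n hn x hx
    refine hn x (hx.trans ?_)
    exact ENNReal.coe_lt_coe.2 (lt_add_one b)
  · have hone : ∀ R ε : ℝ, 0 < ε → ∀ᶠ n in atTop, ∀ x ∈ chartDomain ζ ψ δ κ,
        ‖scaledChart ζ ψ δ κ (h ζ) n x‖ ≤ R → T^[p] x ∈ chartDomain ζ ψ δ κ ∧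
          ‖scaledChart ζ ψ δ κ (h ζ) n (T^[p] x) - L (scaledChart ζ ψ δ κ (h ζ) n x)‖ ≤ ε := by
      intro R ε hε
      have hW1 : ∀ᶠ x in 𝓝 ζ, T^[p] x ∈ chartDomain ζ ψ δ κ := by
        refine (hiter p).eventually ?_
        rw [Function.iterate_minimalPeriod]
        exact hdom.isOpen.mem_nhds hdom.mem
      have hW2 := hL.bound (show 0 < ε / (|R| + 1) by positivity)
      filter_upwards [eventually_mem_of_scaledChart hdom hd hh (hW1.and hW2) R,
        eventually_ge_atTop 1] with n hn h1n x hx hxR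
      obtain ⟨h1, h2⟩ := hn x hx hxR
      refine ⟨h1, ?_⟩
      have hpos := scale_pos (d := d) hh h1n
      have h3 := (norm_le_of_norm_scaledChart_le hh h1n hx).1 hxR
      rw [scaledChart_apply h1, scaledChart_apply hx, map_smul, ← smul_sub, norm_smul, norm_inv,
        Real.norm_eq_abs, abs_of_pos hpos, inv_mul_le_iff₀ hpos]
      calc _ ≤ ε / (|R| + 1) * ‖ψ x‖ := h2
        _ ≤ ε / (|R| + 1) * (scale d (h ζ) n * (|R| + 1)) := by
          gcongr
          refine h3.trans ?_
          gcongr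
          linarith [le_abs_self R]
        _ = _ := by field_simp
    intro R ε ℓ
    induction ℓ generalizing ε with
    | zero =>
      intro hε
      refine Eventually.of_forall fun n x hx _ => ⟨by simpa using hx, by simpa using hε.le⟩
    | succ ℓ ih =>
      intro hε
      set L' := LinearMap.toContinuousLinearMap L with hL'
      have hLn : ∀ v, ‖L v‖ ≤ ‖L'‖ * ‖v‖ := fun v => L'.le_opNorm v
      set Lℓ := LinearMap.toContinuousLinearMap (L ^ ℓ) with hLℓ
      have hLℓn : ∀ v, ‖(L ^ ℓ) v‖ ≤ ‖Lℓ‖ * ‖v‖ := fun v => Lℓ.le_opNorm v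
      -- The bound 1 keeps the ℓ-th return in a fixed bounded region where the one-step estimate
      -- holds; the other term compensates the amplification of the error by L.
      set ε' := min 1 (ε / (2 * (‖L'‖ + 1))) with hε'
      have hε'0 : 0 < ε' := lt_min one_pos (by positivity)
      filter_upwards [ih ε' hε'0, hone (‖Lℓ‖ * |R| + 1) (ε / 2) (by positivity)] with n h1 h2 x hx hxR
      obtain ⟨h3, h4⟩ := h1 x hx hxR
      have h5 : ‖scaledChart ζ ψ δ κ (h ζ) n (T^[p * ℓ] x)‖ ≤ ‖Lℓ‖ * |R| + 1 := by
        have h6 := norm_le_norm_add_norm_sub' (scaledChart ζ ψ δ κ (h ζ) n (T^[p * ℓ] x))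
          ((L ^ ℓ) (scaledChart ζ ψ δ κ (h ζ) n x))
        refine h6.trans (add_le_add ((hLℓn _).trans ?_) (h4.trans (min_le_left _ _)))
        gcongr
        exact hxR.trans (le_abs_self R)
      obtain ⟨h6, h7⟩ := h2 _ h3 h5
      have e : T^[p * (ℓ + 1)] x = T^[p] (T^[p * ℓ] x) := by
        rw [← Function.iterate_add_apply]; congr 1; ring
      rw [e, pow_succ', Module.End.mul_apply]
      refine ⟨h6, ?_⟩
      set a := scaledChart ζ ψ δ κ (h ζ) n (T^[p * ℓ] x)
      set b := (L ^ ℓ) (scaledChart ζ ψ δ κ (h ζ) n x)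
      calc _ ≤ ‖scaledChart ζ ψ δ κ (h ζ) n (T^[p] (T^[p * ℓ] x)) - L a‖ + ‖L a - L b‖ :=
            norm_sub_le_norm_sub_add_norm_sub _ _ _
        _ ≤ ε / 2 + ‖L'‖ * (ε / (2 * (‖L'‖ + 1))) := by
          refine add_le_add h7 ?_
          rw [← map_sub]
          refine (hLn _).trans ?_
          gcongr
          exact h4.trans (min_le_right _ _)
        _ ≤ ε / 2 + (‖L'‖ + 1) * (ε / (2 * (‖L'‖ + 1))) := by
          gcongr
          linarith
        _ = ε := by field_simp; ring
  -- For j not divisible by p the points T^j ζ and ζ differ, and continuity of T^j at ζ keeps the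
  -- images of nearby points away from ζ.
  · intro R j hj
    have hne : T^[j] ζ ≠ ζ := fun h => hj (Function.IsPeriodicPt.minimalPeriod_dvd h)
    obtain ⟨V, W, hV, hW, hζV, hζW, hVW⟩ := t2_separation hne
    have h1 : ∀ᶠ x in 𝓝 ζ, T^[j] x ∈ V := (hiter j).eventually (hV.mem_nhds hζV)
    filter_upwards [eventually_mem_of_scaledChart hdom hd hh h1 R,
      eventually_mem_of_scaledChart hdom hd hh (hW.mem_nhds hζW) R] with n h2 h3 x hx hxR hcon
    exact Set.disjoint_left.1 hVW (h2 x hx hxR) (h3 _ hcon.1 hcon.2)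

end ScalingChart

end REPP

end

noncomputable section

namespace REPP

/-! ### Elementary estimates -/

section Elementary

/-- A summable sequence has small values, compared to `1 / n`, at gaps that are negligible
compared to `n`. -/
theorem exists_gap {ρ : ℕ → ℝ} (hρ : Summable ρ) : ∃ t : ℕ → ℕ, Tendsto t atTop atTop ∧
    Tendsto (fun n => (t n : ℝ) / n) atTop (𝓝 0) ∧
    Tendsto (fun n : ℕ => (n : ℝ) * |ρ (t n)|) atTop (𝓝 0) := by
  -- The gap will minimise this cost over t ≤ n. Its three terms control the three required limits,
  -- so it is enough that some t makes the cost small.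
  let c : ℕ → ℕ → ℝ := fun n t => ((t : ℝ) + 1)⁻¹ + (t : ℝ) / n + n * |ρ t|
  have hc0 : ∀ n t, 0 ≤ c n t := fun n t => by positivity
  have hex : ∀ ε : ℝ, 0 < ε → ∀ᶠ n : ℕ in atTop, ∃ t ≤ n, c n t ≤ 3 * ε := by
    intro ε' hε'
    set ε := min ε' 1 with hεdef
    have hε : 0 < ε := lt_min hε' one_pos
    have hε1 : ε ≤ 1 := min_le_right _ _
    have hsum := hρ.abs
    obtain ⟨s₀, hs₀⟩ := summable_iff_vanishing_norm.1 hsum (ε ^ 2 / 4) (by positivity)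
    obtain ⟨N, hN⟩ := s₀.exists_nat_subset_range
    filter_upwards [tendsto_natCast_atTop_atTop.eventually_ge_atTop (4 / ε),
      tendsto_natCast_atTop_atTop.eventually_ge_atTop (2 * (N + 1) / ε),
      tendsto_natCast_atTop_atTop.eventually_ge_atTop (2 / ε ^ 2 + 2 / ε),
      eventually_ge_atTop 1] with n h1 h2 h3 h4
    have hn0 : (0 : ℝ) < n := by exact_mod_cast h4
    set s := ⌊ε * n / 2⌋₊ with hs
    have hsle : (s : ℝ) ≤ ε * n / 2 := Nat.floor_le (by positivity)
    have hslt : ε * n / 2 < s + 1 := Nat.lt_floor_add_one _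
    rw [div_le_iff₀ hε] at h1 h2
    have hsN : N ≤ s := by
      have : (N : ℝ) < s + 1 := by linarith
      exact_mod_cast Nat.lt_succ_iff.1 (by exact_mod_cast this)
    have hdis : Disjoint (Finset.Ico s (2 * s)) s₀ := by
      refine Finset.disjoint_left.2 fun t ht hts => ?_
      have := Finset.mem_range.1 (hN hts)
      have := (Finset.mem_Ico.1 ht).1
      omega
    have hlt := hs₀ _ hdis
    rw [Real.norm_eq_abs, abs_of_nonneg (Finset.sum_nonneg fun _ _ => abs_nonneg _)] at hlt
    -- Pigeonhole: about ε n / 2 terms have a sum below ε² / 4, so one of them is at most ε / n.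
    obtain ⟨t, ht, htρ⟩ : ∃ t ∈ Finset.Ico s (2 * s), |ρ t| ≤ ε / n := by
      by_contra! hcon
      have h5 : (Finset.Ico s (2 * s)).card • (ε / n) ≤ ∑ t ∈ Finset.Ico s (2 * s), |ρ t| :=
        Finset.card_nsmul_le_sum _ _ _ fun t ht => (hcon t ht).le
      rw [Nat.card_Ico, nsmul_eq_mul, show 2 * s - s = s by omega] at h5
      have h6 : ε ^ 2 / 4 ≤ s * (ε / n) := by
        rw [mul_div_assoc', le_div_iff₀ hn0]
        nlinarith
      linarith
    rw [Finset.mem_Ico] at ht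
    have hts : (t : ℝ) ≤ 2 * s := by exact_mod_cast ht.2.le
    have hst : (s : ℝ) ≤ t := by exact_mod_cast ht.1
    have htn : (t : ℝ) ≤ ε * n := by linarith
    refine ⟨t, ?_, ?_⟩
    · have : (t : ℝ) ≤ n := htn.trans (by nlinarith)
      exact_mod_cast this
    · have e1 : ((t : ℝ) + 1)⁻¹ ≤ ε := by
        rw [inv_le_comm₀ (by positivity) hε]
        have h7 : 2 / ε ^ 2 * ε ^ 2 = 2 := by field_simp
        have h8 : 2 / ε ^ 2 ≤ n := by have : 0 < 2 / ε := by positivity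
                                      linarith
        have h9 : 2 ≤ n * ε ^ 2 := by rw [← h7]; gcongr
        have h10 : ε⁻¹ ≤ ε * n / 2 := by
          rw [inv_le_iff_one_le_mul₀ hε]; nlinarith
        linarith
      have e2 : (t : ℝ) / n ≤ ε := by rwa [div_le_iff₀ hn0]
      have e3 : n * |ρ t| ≤ ε := by
        rw [le_div_iff₀ hn0] at htρ; linarith
      have : ε ≤ ε' := min_le_left _ _
      simp only [c]; linarith
  have hmin : ∀ n : ℕ, ∃ t ∈ Finset.range (n + 1), ∀ t' ∈ Finset.range (n + 1), c n t ≤ c n t' :=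
    fun n => Finset.exists_min_image _ _ ⟨0, by simp⟩
  choose t ht hmin using hmin
  have hlim : Tendsto (fun n => c n (t n)) atTop (𝓝 0) := by
    rw [Metric.tendsto_atTop']
    intro ε hε
    obtain ⟨N, hN⟩ := eventually_atTop.1 (hex (ε / 4) (by positivity))
    refine ⟨N, fun n hn => ?_⟩
    obtain ⟨t', ht', hct'⟩ := hN n hn.le
    have := hmin n t' (Finset.mem_range.2 (by omega))
    rw [Real.dist_eq, sub_zero, abs_of_nonneg (hc0 _ _)]
    linarith
  have hp1 : ∀ n : ℕ, 0 ≤ (((t n : ℕ) : ℝ) + 1)⁻¹ := fun n => by positivity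
  have hp2 : ∀ n : ℕ, 0 ≤ (t n : ℝ) / n := fun n => by positivity
  have hp3 : ∀ n : ℕ, 0 ≤ (n : ℝ) * |ρ (t n)| := fun n => by positivity
  refine ⟨t, ?_, squeeze_zero hp2 (fun n => ?_) hlim, squeeze_zero hp3 (fun n => ?_) hlim⟩
  · have h1 : Tendsto (fun n => (((t n : ℕ) : ℝ) + 1)⁻¹) atTop (𝓝 0) :=
      squeeze_zero hp1 (fun n => by simp only [c]; linarith [hp2 n, hp3 n]) hlim
    refine tendsto_atTop.2 fun b => ?_
    have h2 : (0 : ℝ) < ((b : ℝ) + 1)⁻¹ := by positivity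
    filter_upwards [h1.eventually (gt_mem_nhds h2)] with n hn
    have := (inv_lt_inv₀ (by positivity) (by positivity)).1 hn
    have h3 : (b : ℝ) < t n := by linarith
    exact_mod_cast h3.le
  · simp only [c]; linarith [hp1 n, hp3 n]
  · simp only [c]; linarith [hp1 n, hp2 n]

/-- A sequence that nearly satisfies a linear backward recursion is nearly exponential. -/
theorem abs_sub_exp_le_of_recursion {N : ℝ} (hN : 0 < N) {J : ℕ} {e l : ℕ → ℝ} {ε Λ : ℝ}
    (hJ : e J = 1) (hl0 : ∀ k, 0 ≤ l k) (hlΛ : ∀ k, l k ≤ Λ) (hΛN : Λ ≤ N)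
    (hrec : ∀ k, |N * (e (k + 1) - e k) - l k * e (k + 1)| ≤ ε) :
    |e 0 - Real.exp (-(∑ k ∈ Finset.range J, l k) / N)| ≤ J * (ε / N + Λ ^ 2 / N ^ 2) := by
  have hΛ : 0 ≤ Λ := (hl0 0).trans (hlΛ 0)
  -- Backward induction from `J`. A step multiplies by 1 - x with x = l k / N in [0, 1], which does
  -- not amplify errors, and replacing 1 - x by exp(-x) costs at most Λ² / N².
  have key : ∀ m k, k + m = J →
      |e k - Real.exp (-(∑ i ∈ Finset.Ico k J, l i) / N)| ≤ m * (ε / N + Λ ^ 2 / N ^ 2) := by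
    intro m
    induction m with
    | zero => intro k hk; obtain rfl : k = J := by omega
              simp [hJ]
    | succ m ih =>
      intro k hk
      have h1 := ih (k + 1) (by omega)
      set b := Real.exp (-(∑ i ∈ Finset.Ico (k + 1) J, l i) / N) with hb
      set x := l k / N with hx
      have hx0 : 0 ≤ x := div_nonneg (hl0 k) hN.le
      have hxΛ : x ≤ Λ / N := div_le_div_of_nonneg_right (hlΛ k) hN.le
      have hx1 : x ≤ 1 := hxΛ.trans ((div_le_one hN).2 hΛN)
      have hbk : Real.exp (-(∑ i ∈ Finset.Ico k J, l i) / N) = b * Real.exp (-x) := by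
        rw [hb, hx, ← Real.exp_add, Finset.sum_eq_sum_Ico_succ_bot (by omega)]
        congr 1; ring
      have hb0 : 0 ≤ b := (Real.exp_pos _).le
      have hb1 : b ≤ 1 := by
        refine Real.exp_le_one_iff.2 (div_nonpos_of_nonpos_of_nonneg ?_ hN.le)
        exact neg_nonpos.2 (Finset.sum_nonneg fun i _ => hl0 i)
      have hexp : |Real.exp (-x) - 1 - -x| ≤ Λ ^ 2 / N ^ 2 := by
        refine (Real.abs_exp_sub_one_sub_id_le (by rw [abs_neg, abs_of_nonneg hx0]; exact hx1)).trans
          ?_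
        rw [neg_sq, ← div_pow]
        gcongr
      have he : |e k - (1 - x) * e (k + 1)| ≤ ε / N := by
        rw [le_div_iff₀ hN, ← abs_of_pos hN, ← abs_mul]
        refine le_trans (le_of_eq ?_) (hrec k)
        rw [← abs_neg]; congr 1; rw [hx]; field_simp; ring
      rw [hbk]
      calc |e k - b * Real.exp (-x)|
          = |(e k - (1 - x) * e (k + 1)) + (1 - x) * (e (k + 1) - b)
              - b * (Real.exp (-x) - 1 - -x)| := by congr 1; ring
        _ ≤ |e k - (1 - x) * e (k + 1)| + |(1 - x) * (e (k + 1) - b)|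
              + |b * (Real.exp (-x) - 1 - -x)| :=
          (abs_sub _ _).trans (by gcongr; exact abs_add_le _ _)
        _ ≤ ε / N + 1 * (m * (ε / N + Λ ^ 2 / N ^ 2)) + 1 * (Λ ^ 2 / N ^ 2) := by
          rw [abs_mul, abs_mul, abs_of_nonneg hb0, abs_of_nonneg (sub_nonneg.2 hx1)]
          gcongr
          linarith
        _ = _ := by push_cast; ring
  simpa using key J 0 (by omega)

/-- Riemann sums on `[0, ∞)` of a uniformly continuous function that vanishes beyond `a`. -/
theorem tendsto_riemannSum {l : ℝ → ℝ} (hl : UniformContinuous l) {a : ℝ}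
    (hla : ∀ s, a ≤ s → l s = 0) {J : ℕ → ℕ} (hJ : ∀ᶠ n : ℕ in atTop, a * n ≤ J n)
    {b : ℝ} (hJ' : ∀ᶠ n : ℕ in atTop, (J n : ℝ) ≤ b * n) :
    Tendsto (fun n : ℕ => (∑ k ∈ Finset.range (J n), l (k / n)) / n) atTop
      (𝓝 (∫ s in (0 : ℝ)..a, l s)) := by
  rw [Metric.tendsto_nhds]
  intro ε hε
  set η := ε / (2 * (|b| + 1)) with hη
  have hη0 : 0 < η := by positivity
  obtain ⟨δ, hδ, hδl⟩ := Metric.uniformContinuous_iff.1 hl η hη0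
  filter_upwards [hJ, hJ', eventually_ge_atTop 1,
    tendsto_natCast_atTop_atTop.eventually_gt_atTop (1 / δ)] with n h1 h2 h3 h4
  have hn : (0 : ℝ) < n := by exact_mod_cast h3
  have hint : ∀ x y, IntervalIntegrable l volume x y := fun x y =>
    hl.continuous.intervalIntegrable x y
  have e1 : ∫ s in (0 : ℝ)..a, l s = ∫ s in (0 : ℝ)..((J n : ℝ) / n), l s := by
    rw [← intervalIntegral.integral_add_adjacent_intervals (hint 0 a) (hint a ((J n : ℝ) / n))]
    have haJ : a ≤ (J n : ℝ) / n := by rwa [le_div_iff₀ hn]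
    rw [intervalIntegral.integral_congr (a := a) (g := fun _ => (0 : ℝ))]
    · simp
    · intro s hs
      rw [uIcc_of_le haJ] at hs
      exact hla s hs.1
  have e2 : ∫ s in (0 : ℝ)..((J n : ℝ) / n), l s =
      ∑ k ∈ Finset.range (J n), ∫ s in ((k : ℝ) / n)..(((k + 1 : ℕ) : ℝ) / n), l s := by
    have := intervalIntegral.sum_integral_adjacent_intervals (f := l) (μ := volume)
      (a := fun k : ℕ => (k : ℝ) / n) (n := J n) (fun k _ => hint _ _)
    simp only [Nat.cast_zero, zero_div] at this
    exact this.symm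
  have e3 : ∀ k : ℕ, |l (k / n) / n - ∫ s in ((k : ℝ) / n)..(((k + 1 : ℕ) : ℝ) / n), l s| ≤
      η / n := by
    intro k
    have hk : ((k + 1 : ℕ) : ℝ) / n - (k : ℝ) / n = 1 / n := by push_cast; ring
    have hk0 : (k : ℝ) / n ≤ ((k + 1 : ℕ) : ℝ) / n := by
      have : (0 : ℝ) ≤ 1 / n := by positivity
      linarith
    have : l (k / n) / n = ∫ s in ((k : ℝ) / n)..(((k + 1 : ℕ) : ℝ) / n), l (k / n) := by
      rw [intervalIntegral.integral_const, hk, smul_eq_mul]; ring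
    rw [this, ← intervalIntegral.integral_sub (by simp) (hint _ _), ← Real.norm_eq_abs]
    refine (intervalIntegral.norm_integral_le_of_norm_le_const (C := η) fun s hs => ?_).trans ?_
    · rw [uIoc_of_le hk0] at hs
      rw [← dist_eq_norm]
      refine (hδl ?_).le
      rw [dist_comm, Real.dist_eq, abs_of_nonneg (by linarith [hs.1])]
      have : 1 / (n : ℝ) < δ := by
        rw [div_lt_iff₀ hn]; rw [div_lt_iff₀ hδ] at h4; linarith
      linarith [hs.2]
    · rw [hk, abs_of_nonneg (by positivity)]
      exact le_of_eq (by ring)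
  rw [e1, e2, Real.dist_eq, Finset.sum_div, ← Finset.sum_sub_distrib]
  refine lt_of_le_of_lt (Finset.abs_sum_le_sum_abs _ _) ?_
  refine lt_of_le_of_lt (Finset.sum_le_sum fun k _ => e3 k) ?_
  rw [Finset.sum_const, Finset.card_range, nsmul_eq_mul]
  calc (J n : ℝ) * (η / n) ≤ (|b| * n) * (η / n) := by
        gcongr
        exact h2.trans (by gcongr; exact le_abs_self b)
    _ = |b| * η := by field_simp
    _ ≤ (|b| + 1) * η := by gcongr; linarith
    _ = ε / 2 := by rw [hη]; field_simp
    _ < ε := by linarith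

end Elementary

end REPP

end

noncomputable section

namespace REPP

/-! ### Equidistribution of rescaled visits -/

section Equidistribution

set_option linter.unusedSectionVars false

theorem exists_cube_partition {d : ℕ} (c : EuclideanSpace ℝ (Fin d)) {s δ : ℝ} (hs : 0 < s)
    (hδ : 0 < δ) : ∃ (m : ℕ) (b : (Fin d → Fin m) → EuclideanSpace ℝ (Fin d)) (r : ℝ), 0 < r ∧
      (∀ v ∈ cube c s, ∃! i, v ∈ cube (b i) r) ∧ (∀ i, cube (b i) r ⊆ cube c s) ∧
      ∀ i, ∀ v ∈ cube (b i) r, ‖v - b i‖ ≤ δ := by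
  -- Vectors whose coordinates are at most s / m have norm at most d (s / m) ≤ δ.
  obtain ⟨m, hm⟩ := exists_nat_gt (d * s / δ)
  have hm0 : (0 : ℝ) < m := lt_of_le_of_lt (by positivity) hm
  have hr : 0 < s / m := by positivity
  refine ⟨m, fun i => WithLp.toLp 2 fun k => c k + (i k : ℕ) * (s / m), s / m, hr, ?_, ?_, ?_⟩
  · intro v hv
    have h0 : ∀ k, 0 ≤ (v k - c k) / (s / m) := fun k =>
      div_nonneg (sub_nonneg.2 (hv k).1) hr.le
    have hlt : ∀ k, ⌊(v k - c k) / (s / m)⌋₊ < m := fun k => by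
      rw [Nat.floor_lt (h0 k), div_lt_iff₀ hr]
      have := (hv k).2
      have e : (m : ℝ) * (s / m) = s := by field_simp
      linarith
    refine ⟨fun k => ⟨⌊(v k - c k) / (s / m)⌋₊, hlt k⟩, fun k => ?_, fun i hi => ?_⟩
    · have h1 := Nat.floor_le (h0 k)
      have h2 := Nat.lt_floor_add_one ((v k - c k) / (s / m))
      rw [le_div_iff₀ hr] at h1
      rw [div_lt_iff₀ hr] at h2
      constructor
      · simp only []; linarith
      · simp only []; linarith
    · ext k
      have := hi k
      simp only [] at this ⊢
      symm
      rw [Nat.floor_eq_iff (h0 k), le_div_iff₀ hr, div_lt_iff₀ hr]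
      constructor <;> linarith [this.1, this.2]
  · intro i v hv k
    have := hv k
    simp only [] at this
    have hik : ((i k : ℕ) : ℝ) + 1 ≤ m := by exact_mod_cast (i k).2
    have h1 : (0 : ℝ) ≤ (i k : ℕ) * (s / m) := by positivity
    have h2 : (((i k : ℕ) : ℝ) + 1) * (s / m) ≤ m * (s / m) := by gcongr
    have e : (m : ℝ) * (s / m) = s := by field_simp
    constructor <;> linarith [this.1, this.2]
  · intro i v hv
    have hdm : d * (s / m) ≤ δ := by
      rw [div_lt_iff₀ hδ] at hm
      rw [mul_div_assoc', div_le_iff₀ hm0]; linarith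
    refine le_trans ?_ hdm
    rw [EuclideanSpace.norm_eq]
    refine Real.sqrt_le_iff.2 ⟨by positivity, ?_⟩
    have h1 : ∀ k ∈ Finset.univ, ‖(v - WithLp.toLp 2 fun k => c k + (i k : ℕ) * (s / m)) k‖ ^ 2 ≤
        (s / m) ^ 2 := by
      intro k _
      have := hv k
      simp only [] at this
      rw [Real.norm_eq_abs, sq_abs]
      have e : (v - WithLp.toLp 2 fun k => c k + (i k : ℕ) * (s / m)) k =
        v k - (c k + (i k : ℕ) * (s / m)) := rfl
      rw [e]
      have : 0 ≤ v k - (c k + (i k : ℕ) * (s / m)) := by linarith [this.1]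
      gcongr
      linarith [(hv k).2]
    refine (Finset.sum_le_sum h1).trans ?_
    rw [Finset.sum_const, Finset.card_univ, Fintype.card_fin, nsmul_eq_mul, mul_pow]
    gcongr
    rcases Nat.eq_zero_or_pos d with h | h
    · simp [h]
    · have : (1 : ℝ) ≤ d := by exact_mod_cast h
      nlinarith

variable {X : Type*} [MetricSpace X] [MeasurableSpace X] [BorelSpace X] {μ : Measure X}
  [IsProbabilityMeasure μ] {T : X → X} {C₁ : Type*} [NormedAddCommGroup C₁] [NormedSpace ℝ C₁]
  {ι : C₁ →ₗ[ℝ] (X →ₘ[μ] ℝ)} {H : ℕ → X → ℝ≥0∞} {p d : ℕ}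
  {L : EuclideanSpace ℝ (Fin d) →ₗ[ℝ] EuclideanSpace ℝ (Fin d)} {U : Set X}
  {y : ℕ → X → EuclideanSpace ℝ (Fin d)} {ρ : ℕ → ℝ}

theorem DecayAgainstL1.abs_setIntegral_sub_le (hdecay : DecayAgainstL1 T ι ρ) {B : Set X}
    (hB : MeasurableSet B) {φ : C₁} (hφ : (ι φ : X → ℝ) =ᵐ[μ] B.indicator 1) {K : ℝ}
    (hK : ‖φ‖ ≤ K) {A : X → ℝ} (hA : Integrable A μ) {t : ℕ} (ht : 1 ≤ t) :
    |∫ x in B, A (T^[t] x) ∂μ - μ.real B * ∫ x, A x ∂μ| ≤ |ρ t| * (K * ∫ x, |A x| ∂μ) := by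
  obtain ⟨-, -, h⟩ := hdecay φ A hA t ht
  have e1 : ∫ x, ι φ x * A (T^[t] x) ∂μ = ∫ x in B, A (T^[t] x) ∂μ := by
    rw [← integral_indicator hB]
    refine integral_congr_ae (hφ.mono fun x hx => ?_)
    simp only [hx]
    by_cases hxB : x ∈ B <;> simp [hxB]
  have e2 : ∫ x, ι φ x ∂μ = μ.real B := by
    rw [integral_congr_ae hφ, integral_indicator_one hB]
  rw [e1, e2] at h
  have h0 : 0 ≤ ∫ x, |A x| ∂μ := integral_nonneg fun _ => abs_nonneg _
  refine h.trans ?_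
  gcongr
  exact le_abs_self _

theorem IsScalingChart.measurableSet_inter (h : IsScalingChart μ T ι H p L U y)
    {S : Set (EuclideanSpace ℝ (Fin d))} (hS : MeasurableSet S) (n : ℕ) :
    MeasurableSet (U ∩ y n ⁻¹' S) :=
  h.measurableSet.inter (h.measurable n hS)

/-- The rescaled position at time `0` and the state at a late time are nearly independent. -/
theorem IsScalingChart.eventually_integral_close (h : IsScalingChart μ T ι H p L U y)
    (hT : MeasurePreserving T μ μ)
    (hdecay : DecayAgainstL1 T ι ρ) {t : ℕ → ℕ} (ht : Tendsto t atTop atTop)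
    (hρt : Tendsto (fun n : ℕ => (n : ℝ) * |ρ (t n)|) atTop (𝓝 0)) {S : Type*}
    {Ψ : S → EuclideanSpace ℝ (Fin d) → ℝ} (hΨc : ∀ s, Continuous (Ψ s))
    (hΨ : ∀ ε : ℝ, 0 < ε → ∃ δ : ℝ, 0 < δ ∧ ∀ s v v', ‖v - v'‖ ≤ δ → |Ψ s v - Ψ s v'| ≤ ε)
    (hΨ1 : ∀ s v, |Ψ s v| ≤ 1) {c : EuclideanSpace ℝ (Fin d)} {r : ℝ} (hr : 0 < r)
    (hsupp : ∀ s, ∀ v ∉ cube c r, Ψ s v = 0) {ε : ℝ} (hε : 0 < ε) :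
    ∀ᶠ n : ℕ in atTop, ∀ s, ∀ A : X → ℝ, Measurable A → (∀ x, |A x| ≤ 1) →
      |n * ∫ x, U.indicator (fun x => Ψ s (y n x)) x * A (T^[t n] x) ∂μ -
        (∫ v, Ψ s v) * ∫ x, A x ∂μ| ≤ ε := by
  set vQ := volume.real (cube c r) with hvQ
  set η := ε / (2 * vQ + 1) with hη
  have hvQ0 : 0 ≤ vQ := measureReal_nonneg
  have hη0 : 0 < η := by positivity
  -- The partition depends only on the common modulus of continuity, so it is chosen before n, s and
  -- A; its finitely many constants `K i` are then beaten by n ρ_{t n} → 0.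
  obtain ⟨δ, hδ, hδΨ⟩ := hΨ η hη0
  obtain ⟨m, b, q, hq, hpart, hsub, hdist⟩ := exists_cube_partition c hr hδ
  choose K hK using fun i => h.indicators (b i) q hq
  have hmass := fun i => h.mass (cube (b i) q) (isBounded_cube _ _) (measurableSet_cube _ _)
  have hmassQ := h.mass (cube c r) (isBounded_cube _ _) (measurableSet_cube _ _)
  -- The error budget: step approximation under n μ, decay and convergence of mass on each subcube,
  -- step approximation under volume.
  have hlim : Tendsto (fun n : ℕ => η * (n * μ.real (U ∩ y n ⁻¹' cube c r)) +
      (∑ i, (n * |ρ (t n)| * K i + |n * μ.real (U ∩ y n ⁻¹' cube (b i) q) -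
        volume.real (cube (b i) q)|)) + η * vQ) atTop (𝓝 (η * vQ + (∑ i : Fin d → Fin m,
          ((0 : ℝ) * K i + |volume.real (cube (b i) q) - volume.real (cube (b i) q)|)) + η * vQ)) :=
    ((hmassQ.const_mul η).add (tendsto_finsetSum _ fun i _ =>
      (hρt.mul_const (K i)).add ((hmass i).sub_const _).abs)).add_const _
  have hlt : η * vQ + (∑ i : Fin d → Fin m,
      ((0 : ℝ) * K i + |volume.real (cube (b i) q) - volume.real (cube (b i) q)|)) + η * vQ < ε := by
    simp only [sub_self, abs_zero, zero_mul, add_zero, Finset.sum_const_zero]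
    have : η * (2 * vQ + 1) = ε := by rw [hη]; field_simp
    nlinarith
  filter_upwards [hlim.eventually (gt_mem_nhds hlt), ht.eventually_ge_atTop 1,
    eventually_all.2 hK] with n hn htn hKn s A hA hA1
  refine le_trans ?_ hn.le
  set D : Set X := U ∩ y n ⁻¹' cube c r with hD
  set Di : (Fin d → Fin m) → Set X := fun i => U ∩ y n ⁻¹' cube (b i) q with hDi
  have hDm : MeasurableSet D := h.measurableSet_inter (measurableSet_cube _ _) n
  have hDim : ∀ i, MeasurableSet (Di i) := fun i => h.measurableSet_inter (measurableSet_cube _ _) n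
  have hAint : Integrable A μ := Integrable.of_bound hA.aestronglyMeasurable 1 (ae_of_all _ hA1)
  have hAT : Measurable fun x => A (T^[t n] x) := hA.comp (hT.measurable.iterate _)
  have hATint : Integrable (fun x => A (T^[t n] x)) μ :=
    Integrable.of_bound hAT.aestronglyMeasurable 1 (ae_of_all _ fun x => hA1 _)
  have habs : ∫ x, |A x| ∂μ ≤ 1 := by
    refine (integral_mono hAint.abs (integrable_const 1) hA1).trans (by simp)
  -- the step function
  let σ : EuclideanSpace ℝ (Fin d) → ℝ := fun v =>
    ∑ i, (cube (b i) q).indicator (fun _ => Ψ s (b i)) v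
  have hσ : ∀ v, |Ψ s v - σ v| ≤ (cube c r).indicator (fun _ => η) v := by
    intro v
    by_cases hv : v ∈ cube c r
    · obtain ⟨i, hi, hiu⟩ := hpart v hv
      have : σ v = Ψ s (b i) := by
        simp only [σ]
        rw [Finset.sum_eq_single i, indicator_of_mem hi]
        · intro j _ hj
          exact indicator_of_notMem (fun hjm => hj (hiu j hjm)) _
        · simp
      rw [this, indicator_of_mem hv]
      exact hδΨ s _ _ (hdist i v hi)
    · have : σ v = 0 := Finset.sum_eq_zero fun i _ =>
        indicator_of_notMem (fun hi => hv (hsub i hi)) _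
      rw [this, hsupp s v hv, indicator_of_notMem hv]
      simp
  have hΨm : Measurable fun x => U.indicator (fun x => Ψ s (y n x)) x :=
    ((hΨc s).measurable.comp (h.measurable n)).indicator h.measurableSet
  -- the dynamical side
  have e1 : |∫ x, U.indicator (fun x => Ψ s (y n x)) x * A (T^[t n] x) ∂μ -
      ∑ i, Ψ s (b i) * ∫ x in Di i, A (T^[t n] x) ∂μ| ≤ η * μ.real D := by
    have hs : ∑ i, Ψ s (b i) * ∫ x in Di i, A (T^[t n] x) ∂μ =
        ∫ x, U.indicator (fun x => σ (y n x)) x * A (T^[t n] x) ∂μ := by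
      simp_rw [← integral_const_mul, ← integral_indicator (hDim _)]
      rw [← integral_finsetSum]
      · refine integral_congr_ae (ae_of_all _ fun x => ?_)
        simp only [σ]
        by_cases hx : x ∈ U
        · rw [indicator_of_mem hx, Finset.sum_mul]
          refine Finset.sum_congr rfl fun i _ => ?_
          by_cases hxi : y n x ∈ cube (b i) q
          · rw [indicator_of_mem hxi, indicator_of_mem (show x ∈ Di i from ⟨hx, hxi⟩)]
          · rw [indicator_of_notMem hxi, indicator_of_notMem (fun hh : x ∈ Di i => hxi hh.2),
              zero_mul]
        · rw [indicator_of_notMem hx, zero_mul]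
          exact Finset.sum_eq_zero fun i _ => indicator_of_notMem (fun hh : x ∈ Di i => hx hh.1) _
      · exact fun i _ => (hATint.const_mul _).indicator (hDim i)
    have hi1 : Integrable (fun x => U.indicator (fun x => Ψ s (y n x)) x * A (T^[t n] x)) μ := by
      refine Integrable.of_bound (hΨm.mul hAT).aestronglyMeasurable 1 (ae_of_all _ fun x => ?_)
      rw [norm_mul]
      refine mul_le_one₀ ?_ (norm_nonneg _) (hA1 _)
      rw [norm_indicator_eq_indicator_norm]
      exact indicator_apply_le' (fun _ => hΨ1 _ _) fun _ => zero_le_one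
    have hσm : Measurable σ :=
      Finset.measurable_sum _ fun i _ => measurable_const.indicator (measurableSet_cube _ _)
    have hbd : ∀ x, |U.indicator (fun x => Ψ s (y n x)) x * A (T^[t n] x) -
        U.indicator (fun x => σ (y n x)) x * A (T^[t n] x)| ≤ D.indicator (fun _ => η) x := by
      intro x
      rw [← sub_mul, abs_mul]
      by_cases hx : x ∈ U
      · rw [indicator_of_mem hx, indicator_of_mem hx]
        refine (mul_le_of_le_one_right (abs_nonneg _) (hA1 _)).trans ((hσ _).trans (le_of_eq ?_))
        by_cases hxc : y n x ∈ cube c r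
        · rw [indicator_of_mem hxc, indicator_of_mem (show x ∈ D from ⟨hx, hxc⟩)]
        · rw [indicator_of_notMem hxc, indicator_of_notMem (fun hh : x ∈ D => hxc hh.2)]
      · rw [indicator_of_notMem hx, indicator_of_notMem hx,
          indicator_of_notMem (fun hh : x ∈ D => hx hh.1)]
        simp
    have hi3 : Integrable (D.indicator fun _ => η) μ := (integrable_const η).indicator hDm
    have hi2 : Integrable (fun x => U.indicator (fun x => σ (y n x)) x * A (T^[t n] x)) μ := by
      have hm2 : Measurable fun x => U.indicator (fun x => σ (y n x)) x * A (T^[t n] x) :=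
        ((hσm.comp (h.measurable n)).indicator h.measurableSet).mul hAT
      refine Integrable.of_bound hm2.aestronglyMeasurable (1 + η) (ae_of_all _ fun x => ?_)
      have h1 := hbd x
      have h2 : |U.indicator (fun x => Ψ s (y n x)) x * A (T^[t n] x)| ≤ 1 := by
        rw [abs_mul]
        refine mul_le_one₀ ?_ (abs_nonneg _) (hA1 _)
        rw [← Real.norm_eq_abs, norm_indicator_eq_indicator_norm]
        exact indicator_apply_le' (fun _ => hΨ1 _ _) fun _ => zero_le_one
      have h3 : D.indicator (fun _ => η) x ≤ η := indicator_apply_le' (fun _ => le_rfl) fun _ => hη0.le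
      rw [Real.norm_eq_abs]
      rw [abs_sub_comm] at h1
      have := abs_sub_abs_le_abs_sub (U.indicator (fun x => σ (y n x)) x * A (T^[t n] x))
        (U.indicator (fun x => Ψ s (y n x)) x * A (T^[t n] x))
      linarith
    rw [hs, ← integral_sub hi1 hi2, ← Real.norm_eq_abs]
    refine (norm_integral_le_of_norm_le hi3 (ae_of_all _ hbd)).trans (le_of_eq ?_)
    rw [integral_indicator_const _ hDm, smul_eq_mul, mul_comm]
  have e2 : ∀ i, |∫ x in Di i, A (T^[t n] x) ∂μ - μ.real (Di i) * ∫ x, A x ∂μ| ≤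
      |ρ (t n)| * K i := by
    intro i
    obtain ⟨φ, hφ, hφK⟩ := hKn i
    refine (hdecay.abs_setIntegral_sub_le (hDim i) hφ hφK hAint htn).trans ?_
    have hK0 : 0 ≤ K i := (norm_nonneg φ).trans hφK
    gcongr
    exact mul_le_of_le_one_right hK0 habs
  -- the volume side
  have e3 : |(∑ i, Ψ s (b i) * volume.real (cube (b i) q)) - ∫ v, Ψ s v| ≤ η * vQ := by
    have hfinQ : volume (cube c r) < ∞ := (isBounded_cube c r).measure_lt_top
    have hi : ∀ i, Integrable ((cube (b i) q).indicator fun _ => Ψ s (b i)) := fun i =>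
      (integrable_indicator_iff (measurableSet_cube _ _)).2
        (integrableOn_const (isBounded_cube _ _).measure_lt_top.ne)
    have hs : ∑ i, Ψ s (b i) * volume.real (cube (b i) q) = ∫ v, σ v := by
      rw [integral_finsetSum _ fun i _ => hi i]
      refine Finset.sum_congr rfl fun i _ => ?_
      rw [integral_indicator_const _ (measurableSet_cube _ _), smul_eq_mul, mul_comm]
    have hσi : Integrable σ := integrable_finsetSum _ fun i _ => hi i
    have hηi : Integrable ((cube c r).indicator fun _ => η) :=
      (integrable_indicator_iff (measurableSet_cube _ _)).2 (integrableOn_const hfinQ.ne)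
    have hΨi : Integrable (Ψ s) := by
      have h1i : Integrable ((cube c r).indicator fun _ => (1 : ℝ)) :=
        (integrable_indicator_iff (measurableSet_cube _ _)).2 (integrableOn_const hfinQ.ne)
      refine h1i.mono' (hΨc s).aestronglyMeasurable (ae_of_all _ fun v => ?_)
      by_cases hv : v ∈ cube c r
      · rw [indicator_of_mem hv]; exact hΨ1 _ _
      · rw [hsupp s v hv, indicator_of_notMem hv, norm_zero]
    rw [hs, abs_sub_comm, ← integral_sub hΨi hσi, ← Real.norm_eq_abs]
    refine (norm_integral_le_of_norm_le hηi (ae_of_all _ hσ)).trans (le_of_eq ?_)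
    rw [integral_indicator_const _ (measurableSet_cube _ _), smul_eq_mul, mul_comm]
  have hEA : |∫ x, A x ∂μ| ≤ 1 := (abs_integral_le_integral_abs).trans habs
  have e4 : |∑ i, Ψ s (b i) * (n * ∫ x in Di i, A (T^[t n] x) ∂μ -
      volume.real (cube (b i) q) * ∫ x, A x ∂μ)| ≤
      ∑ i, (n * |ρ (t n)| * K i + |n * μ.real (Di i) - volume.real (cube (b i) q)|) := by
    refine (Finset.abs_sum_le_sum_abs _ _).trans (Finset.sum_le_sum fun i _ => ?_)
    rw [abs_mul]
    refine (mul_le_of_le_one_left (abs_nonneg _) (hΨ1 _ _)).trans ?_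
    calc |n * ∫ x in Di i, A (T^[t n] x) ∂μ - volume.real (cube (b i) q) * ∫ x, A x ∂μ|
        = |n * (∫ x in Di i, A (T^[t n] x) ∂μ - μ.real (Di i) * ∫ x, A x ∂μ) +
          (n * μ.real (Di i) - volume.real (cube (b i) q)) * ∫ x, A x ∂μ| := by congr 1; ring
      _ ≤ n * |∫ x in Di i, A (T^[t n] x) ∂μ - μ.real (Di i) * ∫ x, A x ∂μ| +
          |n * μ.real (Di i) - volume.real (cube (b i) q)| * |∫ x, A x ∂μ| := by
        refine (abs_add_le _ _).trans (le_of_eq ?_)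
        rw [abs_mul, abs_mul, abs_of_nonneg (Nat.cast_nonneg n)]
      _ ≤ n * (|ρ (t n)| * K i) + |n * μ.real (Di i) - volume.real (cube (b i) q)| * 1 := by
        gcongr
        exact e2 i
      _ = _ := by ring
  calc |n * ∫ x, U.indicator (fun x => Ψ s (y n x)) x * A (T^[t n] x) ∂μ -
        (∫ v, Ψ s v) * ∫ x, A x ∂μ|
      = |n * (∫ x, U.indicator (fun x => Ψ s (y n x)) x * A (T^[t n] x) ∂μ -
          ∑ i, Ψ s (b i) * ∫ x in Di i, A (T^[t n] x) ∂μ) +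
        (∑ i, Ψ s (b i) * (n * ∫ x in Di i, A (T^[t n] x) ∂μ -
          volume.real (cube (b i) q) * ∫ x, A x ∂μ)) +
        ((∑ i, Ψ s (b i) * volume.real (cube (b i) q)) - ∫ v, Ψ s v) * ∫ x, A x ∂μ| := by
        congr 1
        simp only [mul_sub, Finset.sum_sub_distrib, sub_mul, Finset.sum_mul, Finset.mul_sum]
        have : ∀ i, Ψ s (b i) * (n * ∫ x in Di i, A (T^[t n] x) ∂μ) =
          n * (Ψ s (b i) * ∫ x in Di i, A (T^[t n] x) ∂μ) := fun i => by ring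
        simp only [this, mul_assoc]
        ring
    _ ≤ n * (η * μ.real D) +
        (∑ i, (n * |ρ (t n)| * K i + |n * μ.real (Di i) - volume.real (cube (b i) q)|)) +
        η * vQ * 1 := by
        refine (abs_add_le _ _).trans (add_le_add ((abs_add_le _ _).trans (add_le_add ?_ e4)) ?_)
        · rw [abs_mul, abs_of_nonneg (Nat.cast_nonneg n)]
          gcongr
        · rw [abs_mul]
          gcongr
    _ = _ := by ring

/-- Late returns to a small cube before a time of smaller order than `n` are rare. -/
theorem IsScalingChart.eventually_sum_returns_le (h : IsScalingChart μ T ι H p L U y)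
    (hT : MeasurePreserving T μ μ) (hdecay : DecayAgainstL1 T ι ρ) (hρ : Summable ρ)
    {t : ℕ → ℕ} (ht : Tendsto (fun n => (t n : ℝ) / n) atTop (𝓝 0))
    (c : EuclideanSpace ℝ (Fin d)) {r : ℝ} (hr : 0 < r) {ε : ℝ} (hε : 0 < ε) :
    ∃ m₀ : ℕ, ∀ m ≥ m₀, ∀ᶠ n : ℕ in atTop, n * ∑ j ∈ Finset.Ioo m (t n),
      μ.real ((U ∩ y n ⁻¹' cube c r) ∩ T^[j] ⁻¹' (U ∩ y n ⁻¹' cube c r)) ≤ ε := by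
  obtain ⟨K', hK'⟩ := h.indicators c r hr
  set K := max K' 0 with hKdef
  have hK0 : 0 ≤ K := le_max_right _ _
  set vQ := volume.real (cube c r)
  have hvQ0 : 0 ≤ vQ := measureReal_nonneg
  set η := ε / (2 * (K * vQ + 1)) with hη
  have hη0 : 0 < η := by positivity
  obtain ⟨s₀, hs₀⟩ := summable_iff_vanishing_norm.1 hρ.abs η hη0
  obtain ⟨m₀, hm₀⟩ := s₀.exists_nat_subset_range
  refine ⟨m₀, fun m hm => ?_⟩
  have hmassQ := h.mass (cube c r) (isBounded_cube _ _) (measurableSet_cube _ _)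
  have hlim : Tendsto (fun n : ℕ => (t n : ℝ) / n * (n * μ.real (U ∩ y n ⁻¹' cube c r)) ^ 2 +
      K * η * (n * μ.real (U ∩ y n ⁻¹' cube c r))) atTop (𝓝 (0 * vQ ^ 2 + K * η * vQ)) :=
    (ht.mul (hmassQ.pow 2)).add (hmassQ.const_mul _)
  have hlt : 0 * vQ ^ 2 + K * η * vQ < ε := by
    have : η * (2 * (K * vQ + 1)) = ε := by rw [hη]; field_simp
    nlinarith [mul_nonneg hK0 hvQ0]
  filter_upwards [hlim.eventually (gt_mem_nhds hlt), hK', eventually_ge_atTop 1] with n hn hφ hn1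
  refine le_trans ?_ hn.le
  obtain ⟨φ, hφ, hφK⟩ := hφ
  set D : Set X := U ∩ y n ⁻¹' cube c r with hD
  have hDm : MeasurableSet D := h.measurableSet_inter (measurableSet_cube _ _) n
  have hn0 : (0 : ℝ) < n := by exact_mod_cast hn1
  -- The L¹ norm in the decay hypothesis supplies a factor μ(D) of order 1 / n. Hence n times the
  -- error at time j is of order ρ j, and the sum over late j is a tail of a convergent series.
  have hone : ∀ j ∈ Finset.Ioo m (t n), μ.real (D ∩ T^[j] ⁻¹' D) ≤
      μ.real D ^ 2 + |ρ j| * (K * μ.real D) := by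
    intro j hj
    have hj1 : 1 ≤ j := by have := (Finset.mem_Ioo.1 hj).1; omega
    have h1 := hdecay.abs_setIntegral_sub_le hDm hφ (hφK.trans (le_max_left _ _ : K' ≤ K))
      (A := D.indicator 1) ((integrable_const (1 : ℝ)).indicator hDm) hj1
    have e0 : ∫ x, D.indicator (1 : X → ℝ) x ∂μ = μ.real D := integral_indicator_one hDm
    have e1 : ∫ x in D, D.indicator (1 : X → ℝ) (T^[j] x) ∂μ = μ.real (D ∩ T^[j] ⁻¹' D) := by
      have : (fun x => D.indicator (1 : X → ℝ) (T^[j] x)) = (T^[j] ⁻¹' D).indicator 1 := rfl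
      rw [this, integral_indicator_one ((hT.measurable.iterate j) hDm), measureReal_restrict_apply'
        hDm, inter_comm]
    have e2 : ∫ x, |D.indicator (1 : X → ℝ) x| ∂μ = μ.real D := by
      rw [← e0]
      refine integral_congr_ae (ae_of_all _ fun x => abs_of_nonneg ?_)
      exact indicator_nonneg (fun _ _ => zero_le_one) x
    rw [e1, e2, e0] at h1
    have := (abs_le.1 h1).2
    nlinarith
  have hdis : Disjoint (Finset.Ioo m (t n)) s₀ := by
    refine Finset.disjoint_left.2 fun j hj hjs => ?_
    have := Finset.mem_range.1 (hm₀ hjs)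
    have := (Finset.mem_Ioo.1 hj).1
    omega
  have htail := hs₀ _ hdis
  rw [Real.norm_eq_abs, abs_of_nonneg (Finset.sum_nonneg fun _ _ => abs_nonneg _)] at htail
  have hcard : ((Finset.Ioo m (t n)).card : ℝ) ≤ t n := by
    rw [Nat.card_Ioo]; exact_mod_cast (by omega)
  calc n * ∑ j ∈ Finset.Ioo m (t n), μ.real (D ∩ T^[j] ⁻¹' D)
      ≤ n * ∑ j ∈ Finset.Ioo m (t n), (μ.real D ^ 2 + |ρ j| * (K * μ.real D)) := by
        gcongr with j hj; exact hone j hj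
    _ = n * ((Finset.Ioo m (t n)).card * μ.real D ^ 2 +
          (∑ j ∈ Finset.Ioo m (t n), |ρ j|) * (K * μ.real D)) := by
        rw [Finset.sum_add_distrib, Finset.sum_const, nsmul_eq_mul, ← Finset.sum_mul]
    _ ≤ n * (t n * μ.real D ^ 2 + η * (K * μ.real D)) := by gcongr
    _ = _ := by field_simp

end Equidistribution

end REPP

end

noncomputable section

namespace REPP

/-! ### The Laplace functional of the visits -/

section Recursion

set_option linter.unusedSectionVars false

theorem abs_exp_neg_sub_le {a b : ℝ} (ha : 0 ≤ a) (hb : 0 ≤ b) :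
    |Real.exp (-a) - Real.exp (-b)| ≤ |a - b| := by
  have key : ∀ {a b : ℝ}, 0 ≤ a → a ≤ b → Real.exp (-a) - Real.exp (-b) ≤ b - a := by
    intro a b ha hab
    have h1 : Real.exp (-b) = Real.exp (-a) * Real.exp (-(b - a)) := by
      rw [← Real.exp_add]; congr 1; ring
    have h2 := Real.one_sub_le_exp_neg (b - a)
    have h3 : Real.exp (-a) ≤ 1 := Real.exp_le_one_iff.2 (by linarith)
    have h4 := Real.exp_pos (-a)
    rw [h1]
    nlinarith
  rcases le_total a b with hab | hab
  · rw [abs_of_nonneg (sub_nonneg.2 (Real.exp_le_exp.2 (by linarith))),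
      abs_of_nonpos (by linarith)]
    linarith [key ha hab]
  · rw [abs_of_nonpos (sub_nonpos.2 (Real.exp_le_exp.2 (by linarith))),
      abs_of_nonneg (by linarith)]
    linarith [key hb hab]

theorem exp_neg_sum_mem {ι : Type*} {s : Finset ι} {a : ι → ℝ} (ha : ∀ i ∈ s, 0 ≤ a i) :
    0 ≤ Real.exp (-∑ i ∈ s, a i) ∧ Real.exp (-∑ i ∈ s, a i) ≤ 1 :=
  ⟨(Real.exp_pos _).le, Real.exp_le_one_iff.2 (neg_nonpos.2 (Finset.sum_nonneg ha))⟩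

variable {X : Type*}

/-- The exponential of minus the weights collected from time `k` on, started at `x` at time `k`;
no weights are collected after time `J`. -/
def tailFactor (T : X → X) (w : ℕ → X → ℝ) (J k : ℕ) (x : X) : ℝ :=
  Real.exp (-∑ j ∈ Finset.range J, w (k + j) (T^[j] x))

variable {T : X → X} {w : ℕ → X → ℝ} {J : ℕ}

theorem tailFactor_eq_mul (hJ : ∀ k, J ≤ k → w k = 0) (k m : ℕ) (x : X) :
    tailFactor T w J k x = Real.exp (-∑ j ∈ Finset.range m, w (k + j) (T^[j] x)) *
      tailFactor T w J (k + m) (T^[m] x) := by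
  have one : ∀ k x, tailFactor T w J k x = Real.exp (-w k x) * tailFactor T w J (k + 1) (T x) := by
    intro k x
    rw [tailFactor, tailFactor, ← Real.exp_add]
    congr 1
    -- Adding one more term is harmless because weights vanish from time `J` on.
    have h1 : ∑ j ∈ Finset.range (J + 1), w (k + j) (T^[j] x) =
        ∑ j ∈ Finset.range J, w (k + j) (T^[j] x) := by
      rw [Finset.sum_range_succ, hJ (k + J) (by omega)]; simp
    rw [← h1, Finset.sum_range_succ']
    simp only [Function.iterate_succ, Function.comp_apply, Function.iterate_zero, id, add_zero]
    have : ∀ j, w (k + (j + 1)) (T^[j] (T x)) = w (k + 1 + j) (T^[j] (T x)) := fun j => by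
      rw [show k + (j + 1) = k + 1 + j by ring]
    simp only [this]
    ring
  induction m with
  | zero => simp
  | succ m ih =>
    rw [ih, one (k + m), Finset.sum_range_succ, neg_add, Real.exp_add, Function.iterate_succ_apply',
      mul_assoc, add_assoc]

theorem tailFactor_of_le (hJ : ∀ k, J ≤ k → w k = 0) {k : ℕ} (hk : J ≤ k) (x : X) :
    tailFactor T w J k x = 1 := by
  rw [tailFactor, Finset.sum_eq_zero fun j _ => by rw [hJ _ (hk.trans (Nat.le_add_right k j))]; rfl]
  simp

theorem tailFactor_mem (hw : ∀ k x, 0 ≤ w k x) (k : ℕ) (x : X) :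
    0 ≤ tailFactor T w J k x ∧ tailFactor T w J k x ≤ 1 :=
  exp_neg_sum_mem fun _ _ => hw _ _

theorem abs_tailFactor_le (hw : ∀ k x, 0 ≤ w k x) (k : ℕ) (x : X) :
    |tailFactor T w J k x| ≤ 1 := by
  rw [abs_of_nonneg (tailFactor_mem hw k x).1]; exact (tailFactor_mem hw k x).2

variable [MeasurableSpace X] {μ : Measure X} [IsProbabilityMeasure μ]

theorem measurable_tailFactor (hT : Measurable T) (hw : ∀ k, Measurable (w k)) (k : ℕ) :
    Measurable (tailFactor T w J k) :=
  (Finset.measurable_sum _ fun j _ => (hw (k + j)).comp (hT.iterate j)).neg.exp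

theorem integrable_tailFactor (hT : Measurable T) (hw : ∀ k, Measurable (w k))
    (hw0 : ∀ k x, 0 ≤ w k x) (k : ℕ) : Integrable (tailFactor T w J k) μ :=
  Integrable.of_bound (measurable_tailFactor hT hw k).aestronglyMeasurable 1
    (ae_of_all _ (abs_tailFactor_le hw0 k))

/-- Splitting off the visit at time `k`, and the visits up to time `k + t`. -/
theorem integral_tailFactor_succ_sub (hT : MeasurePreserving T μ μ) (hw : ∀ k, Measurable (w k))
    (hw0 : ∀ k x, 0 ≤ w k x) (hJ : ∀ k, J ≤ k → w k = 0) (k : ℕ) {t : ℕ} (ht : 1 ≤ t) :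
    ∫ x, tailFactor T w J (k + 1) x ∂μ - ∫ x, tailFactor T w J k x ∂μ =
      ∫ x, ((1 - Real.exp (-w k x)) * Real.exp (-∑ j ∈ Finset.Ico 1 t, w (k + j) (T^[j] x))) *
        tailFactor T w J (k + t) (T^[t] x) ∂μ := by
  -- By invariance the future from time k + 1 may be started at T x; the two factors then follow the
  -- same orbit and differ only by the visit at time k.
  have h1 : ∫ x, tailFactor T w J (k + 1) x ∂μ = ∫ x, tailFactor T w J (k + 1) (T x) ∂μ := by
    conv_lhs => rw [← hT.map_eq]
    exact integral_map hT.measurable.aemeasurable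
      (measurable_tailFactor hT.measurable hw _).aestronglyMeasurable
  have hi := integrable_tailFactor (μ := μ) (J := J) hT.measurable hw hw0
  have hi' : Integrable (fun x => tailFactor T w J (k + 1) (T x)) μ :=
    hT.integrable_comp_of_integrable (hi (k + 1))
  rw [h1, ← integral_sub hi' (hi k)]
  refine integral_congr_ae (ae_of_all _ fun x => ?_)
  have e1 := tailFactor_eq_mul (T := T) hJ k 1 x
  have e2 := tailFactor_eq_mul (T := T) hJ k t x
  have e3 : Real.exp (-∑ j ∈ Finset.range t, w (k + j) (T^[j] x)) = Real.exp (-w k x) *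
      Real.exp (-∑ j ∈ Finset.Ico 1 t, w (k + j) (T^[j] x)) := by
    rw [← Real.exp_add, Finset.range_eq_Ico, Finset.sum_eq_sum_Ico_succ_bot (by omega)]
    congr 1
    simp; ring
  simp only [Finset.range_one, Finset.sum_singleton, add_zero, Function.iterate_zero, id,
    Function.iterate_one] at e1
  have e4 : tailFactor T w J (k + 1) (T x) = Real.exp (-∑ j ∈ Finset.Ico 1 t, w (k + j) (T^[j] x)) *
      tailFactor T w J (k + t) (T^[t] x) := by
    have hp := Real.exp_pos (-w k x)
    refine mul_left_cancel₀ hp.ne' ?_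
    rw [← e1, e2, e3, mul_assoc]
  simp only []
  rw [e1, e4]
  ring

/-- Moving the starting time by one step matters only on the event of a visit, of mass at most μ(D).
-/
theorem abs_integral_tailFactor_add_sub_le (hT : MeasurePreserving T μ μ)
    (hw : ∀ k, Measurable (w k)) (hw0 : ∀ k x, 0 ≤ w k x) (hJ : ∀ k, J ≤ k → w k = 0)
    {D : Set X} (hD : MeasurableSet D) (hwD : ∀ k x, w k x ≠ 0 → x ∈ D) (k m : ℕ) :
    |∫ x, tailFactor T w J (k + m) x ∂μ - ∫ x, tailFactor T w J k x ∂μ| ≤ m * μ.real D := by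
  induction m with
  | zero => simp
  | succ m ih =>
    have h1 : |∫ x, tailFactor T w J (k + m + 1) x ∂μ - ∫ x, tailFactor T w J (k + m) x ∂μ| ≤
        μ.real D := by
      rw [integral_tailFactor_succ_sub hT hw hw0 hJ (k + m) le_rfl, ← integral_indicator_one hD,
        ← Real.norm_eq_abs]
      refine norm_integral_le_of_norm_le ((integrable_const (1 : ℝ)).indicator hD)
        (ae_of_all _ fun x => ?_)
      by_cases hx : x ∈ D
      · rw [indicator_of_mem hx, norm_mul]
        refine mul_le_one₀ ?_ (norm_nonneg _) (abs_tailFactor_le hw0 _ _)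
        simp only [Finset.Ico_self, Finset.sum_empty, neg_zero, Real.exp_zero, mul_one]
        have h2 := Real.exp_pos (-w (k + m) x)
        have h3 : Real.exp (-w (k + m) x) ≤ 1 := Real.exp_le_one_iff.2 (by linarith [hw0 (k + m) x])
        rw [Real.norm_eq_abs, abs_le]
        constructor <;> linarith
      · have : w (k + m) x = 0 := by
          by_contra hne; exact hx (hwD _ _ hne)
        simp [hx, this]
    have h2 := abs_add_le (∫ x, tailFactor T w J (k + m + 1) x ∂μ -
      ∫ x, tailFactor T w J (k + m) x ∂μ) (∫ x, tailFactor T w J (k + m) x ∂μ -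
        ∫ x, tailFactor T w J k x ∂μ)
    rw [sub_add_sub_cancel] at h2
    rw [← add_assoc]
    push_cast
    linarith

end Recursion

/-! ### Weights along orbits of the linear map. -/

section Pile

variable {d : ℕ} (L : EuclideanSpace ℝ (Fin d) →ₗ[ℝ] EuclideanSpace ℝ (Fin d))
  (f : ℝ → EuclideanSpace ℝ (Fin d) → ℝ)

/-- The exponential of minus the weights along the first `M` points of a linear orbit. -/
def pileFactor (M : ℕ) (s : ℝ) (v : EuclideanSpace ℝ (Fin d)) : ℝ :=
  Real.exp (-∑ ℓ ∈ Finset.range M, f s ((L ^ ℓ) v))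

/-- The contribution of a pile that starts at `v`. -/
def headFactor (M : ℕ) (s : ℝ) (v : EuclideanSpace ℝ (Fin d)) : ℝ :=
  (1 - Real.exp (-f s v)) * pileFactor L f M s (L v)

/-- The rate at which piles contribute at time `s`. -/
def pileRate (M : ℕ) (s : ℝ) : ℝ := ∫ v, headFactor L f M s v

variable {L f}

/-- The head telescopes into a pile quantity at L v minus one at v. After integration over v the
Jacobian of L turns this difference into the factor θ. -/
theorem headFactor_eq_sub (M : ℕ) (s : ℝ) (v : EuclideanSpace ℝ (Fin d)) :
    headFactor L f M s v = pileFactor L f M s (L v) - pileFactor L f (M + 1) s v := by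
  have : pileFactor L f (M + 1) s v = Real.exp (-f s v) * pileFactor L f M s (L v) := by
    rw [pileFactor, pileFactor, ← Real.exp_add, Finset.sum_range_succ']
    congr 1
    simp only [pow_succ, Module.End.mul_apply, pow_zero, Module.End.one_apply]
    ring
  rw [headFactor, this]; ring

theorem pileFactor_mem (hf : ∀ s v, 0 ≤ f s v) (M : ℕ) (s : ℝ) (v : EuclideanSpace ℝ (Fin d)) :
    0 ≤ pileFactor L f M s v ∧ pileFactor L f M s v ≤ 1 :=
  exp_neg_sum_mem fun _ _ => hf _ _

theorem headFactor_mem (hf : ∀ s v, 0 ≤ f s v) (M : ℕ) (s : ℝ) (v : EuclideanSpace ℝ (Fin d)) :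
    0 ≤ headFactor L f M s v ∧ headFactor L f M s v ≤ 1 := by
  have h1 : Real.exp (-f s v) ≤ 1 := Real.exp_le_one_iff.2 (by linarith [hf s v])
  have h2 := Real.exp_pos (-f s v)
  have h3 := pileFactor_mem (L := L) hf M s (L v)
  exact ⟨mul_nonneg (by linarith) h3.1, mul_le_one₀ (by linarith) h3.1 h3.2⟩

theorem uniformContinuous_pileFactor (hf : ∀ s v, 0 ≤ f s v)
    (hfu : UniformContinuous (Function.uncurry f)) (M : ℕ) :
    UniformContinuous (Function.uncurry (pileFactor L f M)) := by
  have hL : ∀ ℓ : ℕ, UniformContinuous fun v => (L ^ ℓ) v := fun ℓ =>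
    (LinearMap.toContinuousLinearMap (L ^ ℓ)).uniformContinuous
  have h1 : UniformContinuous fun q : ℝ × EuclideanSpace ℝ (Fin d) =>
      ∑ ℓ ∈ Finset.range M, f q.1 ((L ^ ℓ) q.2) := by
    have hg : ∀ ℓ, UniformContinuous fun q : ℝ × EuclideanSpace ℝ (Fin d) => f q.1 ((L ^ ℓ) q.2) :=
      fun ℓ => hfu.comp (uniformContinuous_fst.prodMk ((hL ℓ).comp uniformContinuous_snd))
    induction M with
    | zero => simpa using uniformContinuous_const
    | succ M ih => simpa only [Finset.sum_range_succ] using ih.add (hg M)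
  rw [Metric.uniformContinuous_iff] at h1 ⊢
  intro ε hε
  obtain ⟨δ, hδ, h⟩ := h1 ε hε
  refine ⟨δ, hδ, fun {a b} hab => ?_⟩
  refine lt_of_le_of_lt ?_ (h hab)
  exact abs_exp_neg_sub_le (Finset.sum_nonneg fun _ _ => hf _ _) (Finset.sum_nonneg fun _ _ => hf _ _)

theorem uniformContinuous_headFactor (hf : ∀ s v, 0 ≤ f s v)
    (hfu : UniformContinuous (Function.uncurry f)) (M : ℕ) :
    UniformContinuous (Function.uncurry (headFactor L f M)) := by
  have hL : UniformContinuous fun v => L v := (LinearMap.toContinuousLinearMap L).uniformContinuous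
  have h1 : UniformContinuous fun q : ℝ × EuclideanSpace ℝ (Fin d) =>
      pileFactor L f M q.1 (L q.2) :=
    (uniformContinuous_pileFactor hf hfu M).comp
      (uniformContinuous_fst.prodMk (hL.comp uniformContinuous_snd))
  have h2 := h1.sub (uniformContinuous_pileFactor (L := L) hf hfu (M + 1))
  convert h2 using 1
  ext q
  exact headFactor_eq_sub M q.1 q.2

theorem headFactor_eq_zero {M : ℕ} {s : ℝ} {v : EuclideanSpace ℝ (Fin d)} (h : f s v = 0) :
    headFactor L f M s v = 0 := by simp [headFactor, h]

end Pile

/-! ### The approximate differential equation for the Laplace functional. -/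

section Rate

set_option linter.unusedSectionVars false

variable {X : Type*} [MetricSpace X] [MeasurableSpace X] [BorelSpace X] {μ : Measure X}
  [IsProbabilityMeasure μ] {T : X → X} {C₁ : Type*} [NormedAddCommGroup C₁] [NormedSpace ℝ C₁]
  {ι : C₁ →ₗ[ℝ] (X →ₘ[μ] ℝ)} {H : ℕ → X → ℝ≥0∞} {p d : ℕ}
  {L : EuclideanSpace ℝ (Fin d) →ₗ[ℝ] EuclideanSpace ℝ (Fin d)} {U : Set X}
  {y : ℕ → X → EuclideanSpace ℝ (Fin d)} {ρ : ℕ → ℝ}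
  {w : ℕ → ℝ → X → ℝ} {f : ℝ → EuclideanSpace ℝ (Fin d) → ℝ} {R a : ℝ}

/-- The weights `w n s` of visits at time `s` are approximated by the function `f s` of the rescaled
position, have bounded support in the rescaled coordinates, and vanish after time `a`. -/
structure IsVisitWeight (U : Set X) (y : ℕ → X → EuclideanSpace ℝ (Fin d))
    (w : ℕ → ℝ → X → ℝ) (f : ℝ → EuclideanSpace ℝ (Fin d) → ℝ) (R a : ℝ) : Prop where
  nonneg : ∀ n s x, 0 ≤ w n s x
  measurable : ∀ n s, Measurable (w n s)
  limit_nonneg : ∀ s v, 0 ≤ f s v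
  uniformContinuous : UniformContinuous (Function.uncurry f)
  norm_le : ∀ s v, f s v ≠ 0 → ‖v‖ ≤ R
  mem : ∀ᶠ n in atTop, ∀ s x, w n s x ≠ 0 → x ∈ U ∧ ‖y n x‖ ≤ R
  close : ∀ R' ε : ℝ, 0 < ε → ∀ᶠ n in atTop, ∀ s, ∀ x ∈ U, ‖y n x‖ ≤ R' →
    |w n s x - f s (y n x)| ≤ ε
  eq_zero : ∀ n s x, a ≤ s → w n s x = 0
  limit_eq_zero : ∀ s v, a ≤ s → f s v = 0

/-- The time advances by p ℓ / n → 0 and the position is nearly that of the linear orbit; uniform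
continuity of f absorbs both errors, uniformly in k. -/
theorem IsScalingChart.eventually_return_close (h : IsScalingChart μ T ι H p L U y)
    (hw : IsVisitWeight U y w f R a) (R' : ℝ) (ℓ : ℕ) {ε : ℝ} (hε : 0 < ε) :
    ∀ᶠ n : ℕ in atTop, ∀ k : ℕ, ∀ x ∈ U, ‖y n x‖ ≤ R' →
      |w n (((k + p * ℓ : ℕ) : ℝ) / n) (T^[p * ℓ] x) - f ((k : ℝ) / n) ((L ^ ℓ) (y n x))| ≤ ε := by
  obtain ⟨δ, hδ, hδf⟩ := Metric.uniformContinuous_iff.1 hw.uniformContinuous (ε / 2) (half_pos hε)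
  set A := LinearMap.toContinuousLinearMap (L ^ ℓ)
  have hn1 : Tendsto (fun n : ℕ => ((p * ℓ : ℕ) : ℝ) / n) atTop (𝓝 0) :=
    tendsto_const_div_atTop_nhds_zero_nat _
  have hδ2 : 0 < min (δ / 2) 1 := by positivity
  filter_upwards [h.return_close R' (min (δ / 2) 1) ℓ hδ2,
    hw.close (‖A‖ * R' + 1) (ε / 2) (half_pos hε), hn1.eventually (gt_mem_nhds hδ)]
    with n h1 h2 h3 k x hx hxR
  obtain ⟨h4, h5⟩ := h1 x hx hxR
  have hA : ‖(L ^ ℓ) (y n x)‖ ≤ ‖A‖ * R' :=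
    (A.le_opNorm (y n x)).trans (by gcongr)
  have h6 : ‖y n (T^[p * ℓ] x)‖ ≤ ‖A‖ * R' + 1 := by
    have := norm_sub_norm_le (y n (T^[p * ℓ] x)) ((L ^ ℓ) (y n x))
    have := min_le_right (δ / 2) 1
    linarith
  have h7 := h2 (((k + p * ℓ : ℕ) : ℝ) / n) _ h4 h6
  have h8 : |f (((k + p * ℓ : ℕ) : ℝ) / n) (y n (T^[p * ℓ] x)) -
      f ((k : ℝ) / n) ((L ^ ℓ) (y n x))| < ε / 2 := by
    have := @hδf (((k + p * ℓ : ℕ) : ℝ) / n, y n (T^[p * ℓ] x)) ((k : ℝ) / n, (L ^ ℓ) (y n x)) ?_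
    · exact this
    · rw [Prod.dist_eq, max_lt_iff]
      constructor
      · simp only [Real.dist_eq]
        rw [Nat.cast_add, add_div, add_sub_cancel_left, abs_of_nonneg (by positivity)]
        exact h3
      · simp only [dist_eq_norm]
        exact lt_of_le_of_lt (h5.trans (min_le_left _ _)) (by linarith)
  have := abs_sub_le (w n (((k + p * ℓ : ℕ) : ℝ) / n) (T^[p * ℓ] x))
    (f (((k + p * ℓ : ℕ) : ℝ) / n) (y n (T^[p * ℓ] x))) (f ((k : ℝ) / n) ((L ^ ℓ) (y n x)))
  linarith

/-- Up to late returns, the weights collected before the gap are those of a linear pile. -/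
theorem IsScalingChart.eventually_head_close (h : IsScalingChart μ T ι H p L U y)
    (hw : IsVisitWeight U y w f R a) (hp : 0 < p) {t : ℕ → ℕ} (ht : Tendsto t atTop atTop)
    {c : EuclideanSpace ℝ (Fin d)} {r : ℝ} (hc : ∀ v, ‖v‖ ≤ R → v ∈ cube c r) (M : ℕ)
    {ε : ℝ} (hε : 0 < ε) :
    ∀ᶠ n : ℕ in atTop, ∀ (k : ℕ) (x : X),
      |(1 - Real.exp (-w n (k / n) x)) * Real.exp (-∑ j ∈ Finset.Ico 1 (t n),
          w n ((k + j : ℕ) / n) (T^[j] x)) -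
        U.indicator (fun x => headFactor L f M (k / n) (y n x)) x| ≤
      (U ∩ y n ⁻¹' cube c r).indicator (fun _ => ε) x + ∑ j ∈ Finset.Ioo (p * M) (t n),
        ((U ∩ y n ⁻¹' cube c r) ∩ T^[j] ⁻¹' (U ∩ y n ⁻¹' cube c r)).indicator 1 x := by
  obtain ⟨R', hR'⟩ : ∃ R', ∀ v ∈ cube c r, ‖v‖ ≤ R' := (isBounded_cube c r).exists_norm_le
  -- One share for the initial visit and one for each of the `M` returns.
  set η := ε / (M + 1) with hη
  have hη0 : 0 < η := by positivity
  have hret : ∀ᶠ n : ℕ in atTop, ∀ ℓ ∈ Finset.range (M + 1), ∀ k : ℕ, ∀ x ∈ U, ‖y n x‖ ≤ R' →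
      |w n (((k + p * ℓ : ℕ) : ℝ) / n) (T^[p * ℓ] x) - f ((k : ℝ) / n) ((L ^ ℓ) (y n x))| ≤ η :=
    (Finset.eventually_all _).2 fun ℓ _ => h.eventually_return_close hw R' ℓ hη0
  have hno : ∀ᶠ n : ℕ in atTop, ∀ j ∈ Finset.range (p * M + 1), ¬p ∣ j → ∀ x ∈ U, ‖y n x‖ ≤ R' →
      ¬(T^[j] x ∈ U ∧ ‖y n (T^[j] x)‖ ≤ R') :=
    (Finset.eventually_all _).2 fun j _ => by
      by_cases hj : p ∣ j
      · simp [hj]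
      · simpa [hj] using h.no_return R' j hj
  filter_upwards [hret, hno, hw.mem, ht.eventually_gt_atTop (p * M)] with n h1 h2 h3 h4 k x
  set D := U ∩ y n ⁻¹' cube c r with hD
  have hwD : ∀ s x, w n s x ≠ 0 → x ∈ D := fun s x hne =>
    ⟨(h3 s x hne).1, hc _ (h3 s x hne).2⟩
  have hsum0 : 0 ≤ ∑ j ∈ Finset.Ioo (p * M) (t n), (D ∩ T^[j] ⁻¹' D).indicator (1 : X → ℝ) x :=
    Finset.sum_nonneg fun j _ => indicator_nonneg (fun _ _ => zero_le_one) _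
  by_cases hx : x ∈ D
  swap
  · have e1 : w n (k / n) x = 0 := by by_contra hne; exact hx (hwD _ _ hne)
    have e2 : U.indicator (fun x => headFactor L f M (k / n) (y n x)) x = 0 := by
      by_cases hxU : x ∈ U
      · rw [indicator_of_mem hxU]
        refine headFactor_eq_zero ?_
        by_contra hne
        exact hx ⟨hxU, hc _ (hw.norm_le _ _ hne)⟩
      · exact indicator_of_notMem hxU _
    rw [e1, e2, indicator_of_notMem hx]
    simpa using hsum0
  rw [indicator_of_mem hx, indicator_of_mem hx.1]
  have hxR : ‖y n x‖ ≤ R' := hR' _ hx.2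
  set A := Real.exp (-∑ j ∈ Finset.Ico 1 (t n), w n ((k + j : ℕ) / n) (T^[j] x)) with hA
  have hA01 : 0 ≤ A ∧ A ≤ 1 := exp_neg_sum_mem fun j _ => hw.nonneg _ _ _
  have hw1 : 0 ≤ Real.exp (-w n (k / n) x) ∧ Real.exp (-w n (k / n) x) ≤ 1 :=
    ⟨(Real.exp_pos _).le, Real.exp_le_one_iff.2 (neg_nonpos.2 (hw.nonneg _ _ _))⟩
  have hH := headFactor_mem (L := L) hw.limit_nonneg M (k / n) (y n x)
  -- A late return is paid for by the sum of indicators on the right, since both quantities lie in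
  -- [0, 1].
  by_cases hret' : ∃ j ∈ Finset.Ioo (p * M) (t n), T^[j] x ∈ D
  · obtain ⟨j, hj, hjD⟩ := hret'
    have : 1 ≤ ∑ j ∈ Finset.Ioo (p * M) (t n), (D ∩ T^[j] ⁻¹' D).indicator (1 : X → ℝ) x := by
      refine le_trans (le_of_eq ?_) (Finset.single_le_sum (fun j _ =>
        indicator_nonneg (fun _ _ => zero_le_one) _) hj)
      rw [indicator_of_mem (show x ∈ D ∩ T^[j] ⁻¹' D from ⟨hx, hjD⟩)]
    have h5 : 0 ≤ (1 - Real.exp (-w n (k / n) x)) * A := mul_nonneg (by linarith) hA01.1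
    have h6 : (1 - Real.exp (-w n (k / n) x)) * A ≤ 1 := mul_le_one₀ (by linarith) hA01.1 hA01.2
    rw [abs_le]
    constructor <;> linarith [hH.1, hH.2]
  -- Without late returns, visits before the gap occur only at multiples of p up to p M, so the sum
  -- of weights runs along the linear orbit.
  · push Not at hret'
    have hinj : Function.Injective fun ℓ => p * (ℓ + 1) := fun a b hab => by
      have := Nat.eq_of_mul_eq_mul_left hp hab; omega
    have hsum : ∑ j ∈ Finset.Ico 1 (t n), w n ((k + j : ℕ) / n) (T^[j] x) =
        ∑ ℓ ∈ Finset.range M, w n ((k + p * (ℓ + 1) : ℕ) / n) (T^[p * (ℓ + 1)] x) := by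
      rw [← Finset.sum_image (f := fun j => w n ((k + j : ℕ) / n) (T^[j] x))
        (g := fun ℓ => p * (ℓ + 1)) (s := Finset.range M) (fun a _ b _ hab => hinj hab)]
      symm
      refine Finset.sum_subset (fun j hj => ?_) fun j hj hjn => ?_
      · obtain ⟨ℓ, hℓ, rfl⟩ := Finset.mem_image.1 hj
        have h5 : p * (ℓ + 1) ≤ p * M := Nat.mul_le_mul_left p (Finset.mem_range.1 hℓ)
        have h6 : 0 < p * (ℓ + 1) := by positivity
        exact Finset.mem_Ico.2 ⟨h6, by omega⟩
      · by_contra hne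
        have hTD := hwD _ _ hne
        rw [Finset.mem_Ico] at hj
        have hjM : j ≤ p * M := by
          by_contra hlt
          exact hret' j (Finset.mem_Ioo.2 ⟨by omega, hj.2⟩) hTD
        by_cases hpj : p ∣ j
        · obtain ⟨m, rfl⟩ := hpj
          have hm0 : m ≠ 0 := by rintro rfl; omega
          have hmM : m ≤ M := Nat.le_of_mul_le_mul_left hjM hp
          refine hjn (Finset.mem_image.2 ⟨m - 1, Finset.mem_range.2 (by omega), ?_⟩)
          congr 1; omega
        · exact h2 j (Finset.mem_range.2 (by omega)) hpj x hx.1 hxR ⟨hTD.1, hR' _ hTD.2⟩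
    have h0 : |w n (k / n) x - f (k / n) (y n x)| ≤ η := by
      simpa using h1 0 (by simp) k x hx.1 hxR
    have hAB : |A - pileFactor L f M (k / n) (L (y n x))| ≤ M * η := by
      rw [hA, hsum, pileFactor]
      refine (abs_exp_neg_sub_le (Finset.sum_nonneg fun _ _ => hw.nonneg _ _ _)
        (Finset.sum_nonneg fun _ _ => hw.limit_nonneg _ _)).trans ?_
      rw [← Finset.sum_sub_distrib]
      refine (Finset.abs_sum_le_sum_abs _ _).trans ((Finset.sum_le_sum (g := fun _ => η)
        fun ℓ hℓ => ?_).trans ?_)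
      · have := h1 (ℓ + 1) (Finset.mem_range.2 (by have := Finset.mem_range.1 hℓ; omega)) k x hx.1 hxR
        rw [pow_succ, Module.End.mul_apply] at this
        exact this
      · simp
    have hP := pileFactor_mem (L := L) hw.limit_nonneg M (k / n) (L (y n x))
    have h01 := abs_exp_neg_sub_le (hw.nonneg n (k / n) x) (hw.limit_nonneg (k / n) (y n x))
    have hε' : ε = (M + 1) * η := by rw [hη]; field_simp
    calc |(1 - Real.exp (-w n (k / n) x)) * A - headFactor L f M (k / n) (y n x)|
        = |(1 - Real.exp (-w n (k / n) x)) * (A - pileFactor L f M (k / n) (L (y n x))) -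
            (Real.exp (-w n (k / n) x) - Real.exp (-f (k / n) (y n x))) *
              pileFactor L f M (k / n) (L (y n x))| := by rw [headFactor]; congr 1; ring
      _ ≤ 1 * (M * η) + η * 1 := by
        refine (abs_sub _ _).trans ?_
        rw [abs_mul, abs_mul, abs_of_nonneg hP.1, abs_of_nonneg (sub_nonneg.2 hw1.2)]
        gcongr
        · linarith
        · exact hP.1
        · exact h01.trans h0
        · exact hP.2
      _ = ε := by rw [hε']; ring
      _ ≤ _ := le_add_of_nonneg_right hsum0

/-- The approximate differential equation for the Laplace functional. -/
theorem IsScalingChart.exists_forall_eventually_recursion (h : IsScalingChart μ T ι H p L U y)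
    (hw : IsVisitWeight U y w f R a) (hp : 0 < p) (hT : MeasurePreserving T μ μ)
    (hdecay : DecayAgainstL1 T ι ρ) (hρ : Summable ρ) {J : ℕ → ℕ} (hJ : ∀ n : ℕ, a * n ≤ J n)
    {ε : ℝ} (hε : 0 < ε) :
    ∃ M₀ : ℕ, ∀ M ≥ M₀, ∀ᶠ n : ℕ in atTop, ∀ k : ℕ,
      |n * (∫ x, tailFactor T (fun k => w n (k / n)) (J n) (k + 1) x ∂μ -
          ∫ x, tailFactor T (fun k => w n (k / n)) (J n) k x ∂μ) -
        pileRate L f M (k / n) *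
          ∫ x, tailFactor T (fun k => w n (k / n)) (J n) (k + 1) x ∂μ| ≤ ε := by
  obtain ⟨t, ht, htn, htρ⟩ := exists_gap hρ
  obtain ⟨c, r, hr, hc⟩ : ∃ (c : EuclideanSpace ℝ (Fin d)) (r : ℝ), 0 < r ∧
      ∀ v, ‖v‖ ≤ R → v ∈ cube c r := by
    refine ⟨WithLp.toLp 2 fun _ => -(|R| + 1), 2 * (|R| + 1), by positivity, fun v hv i => ?_⟩
    have h1 := abs_le.1 ((abs_apply_le_norm v i).trans (hv.trans (le_abs_self R)))
    simp only []
    constructor <;> linarith [h1.1, h1.2]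
  set vQ := volume.real (cube c r) with hvQ
  have hvQ0 : 0 ≤ vQ := measureReal_nonneg
  -- As p ≥ 1, every M ≥ m₀ satisfies p M ≥ m₀, so returns after the truncation of the pile are
  -- negligible.
  obtain ⟨m₀, hm₀⟩ := h.eventually_sum_returns_le hT hdecay hρ htn c hr (ε := ε / 4) (by positivity)
  refine ⟨m₀, fun M hM => ?_⟩
  set η := ε / (4 * (vQ + 1)) with hη
  have hη0 : 0 < η := by positivity
  have hmassQ := h.mass (cube c r) (isBounded_cube _ _) (measurableSet_cube _ _)
  have huc := uniformContinuous_headFactor (L := L) hw.limit_nonneg hw.uniformContinuous M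
  have hΨ : ∀ ε : ℝ, 0 < ε → ∃ δ : ℝ, 0 < δ ∧ ∀ s v v', ‖v - v'‖ ≤ δ →
      |headFactor L f M s v - headFactor L f M s v'| ≤ ε := by
    intro ε hε
    obtain ⟨δ, hδ, hδ'⟩ := Metric.uniformContinuous_iff.1 huc ε hε
    refine ⟨δ / 2, half_pos hδ, fun s v v' hvv' => ?_⟩
    have := @hδ' (s, v) (s, v') (by
      rw [Prod.dist_eq, dist_self, max_lt_iff, dist_eq_norm]
      exact ⟨hδ, by simp only []; linarith⟩)
    exact this.le
  have hhm : ∀ s v, |headFactor L f M s v| ≤ 1 := fun s v => by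
    have := headFactor_mem (L := L) hw.limit_nonneg M s v
    rw [abs_of_nonneg this.1]; exact this.2
  have hsupp : ∀ s, ∀ v ∉ cube c r, headFactor L f M s v = 0 := fun s v hv =>
    headFactor_eq_zero (by by_contra hne; exact hv (hc v (hw.norm_le s v hne)))
  have hhc : ∀ s, Continuous (headFactor L f M s) := fun s =>
    huc.continuous.comp (Continuous.prodMk_right s)
  have hrate : ∀ s, |pileRate L f M s| ≤ vQ := by
    intro s
    rw [pileRate, hvQ, ← integral_indicator_one (measurableSet_cube c r), ← Real.norm_eq_abs]
    refine norm_integral_le_of_norm_le ((integrable_indicator_iff (measurableSet_cube _ _)).2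
      (integrableOn_const (isBounded_cube c r).measure_lt_top.ne)) (ae_of_all _ fun v => ?_)
    by_cases hv : v ∈ cube c r
    · rw [indicator_of_mem hv]; exact hhm _ _
    · rw [indicator_of_notMem hv, hsupp s v hv, norm_zero]
  have hlim : Tendsto (fun n : ℕ => η * (n * μ.real (U ∩ y n ⁻¹' cube c r)) +
      vQ * ((t n : ℝ) / n * (n * μ.real (U ∩ y n ⁻¹' cube c r)))) atTop
        (𝓝 (η * vQ + vQ * (0 * vQ))) :=
    (hmassQ.const_mul η).add ((htn.mul hmassQ).const_mul vQ)
  have hlt : η * vQ + vQ * (0 * vQ) < ε / 4 := by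
    have : η * (4 * (vQ + 1)) = ε := by rw [hη]; field_simp
    nlinarith
  filter_upwards [hlim.eventually (gt_mem_nhds hlt),
    hm₀ (p * M) (hM.trans (Nat.le_mul_of_pos_left M hp)),
    h.eventually_head_close hw hp ht hc M hη0,
    h.eventually_integral_close hT hdecay ht htρ hhc hΨ hhm hr hsupp (ε := ε / 4) (by positivity),
    hw.mem, ht.eventually_ge_atTop 1, eventually_ge_atTop 1] with n h1 h2 h3 h4 h5 h6 h7 k
  have hn0 : (0 : ℝ) < n := by exact_mod_cast h7
  set D := U ∩ y n ⁻¹' cube c r with hD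
  have hDm : MeasurableSet D := h.measurableSet_inter (measurableSet_cube _ _) n
  set W : ℕ → X → ℝ := fun k => w n (k / n) with hW
  have hWm : ∀ k, Measurable (W k) := fun k => hw.measurable _ _
  have hW0 : ∀ k x, 0 ≤ W k x := fun k x => hw.nonneg _ _ _
  have hWJ : ∀ k, J n ≤ k → W k = 0 := fun k hk => by
    ext x
    refine hw.eq_zero n _ x ?_
    rw [le_div_iff₀ hn0]
    exact (hJ n).trans (by exact_mod_cast hk)
  have hWD : ∀ k x, W k x ≠ 0 → x ∈ D := fun k x hne =>
    ⟨(h5 _ x hne).1, hc _ (h5 _ x hne).2⟩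
  set E : ℕ → ℝ := fun k => ∫ x, tailFactor T W (J n) k x ∂μ with hE
  change |n * (E (k + 1) - E k) - pileRate L f M (k / n) * E (k + 1)| ≤ ε
  have hTm := hT.measurable
  set G : X → ℝ := fun x => tailFactor T W (J n) (k + t n) (T^[t n] x) with hG
  have hGm : Measurable G := (measurable_tailFactor hTm hWm _).comp (hTm.iterate _)
  have hG1 : ∀ x, |G x| ≤ 1 := fun x => abs_tailFactor_le hW0 _ _
  set A : X → ℝ := fun x => (1 - Real.exp (-W k x)) *
    Real.exp (-∑ j ∈ Finset.Ico 1 (t n), W (k + j) (T^[j] x)) with hA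
  set B : X → ℝ := fun x => U.indicator (fun x => headFactor L f M (k / n) (y n x)) x with hB
  have hAm : Measurable A := (measurable_const.sub (hWm k).neg.exp).mul
    (Finset.measurable_sum _ fun j _ => (hWm (k + j)).comp (hTm.iterate j)).neg.exp
  have hBm : Measurable B := ((hhc _).measurable.comp (h.measurable n)).indicator h.measurableSet
  have hA1 : ∀ x, |A x| ≤ 1 := fun x => by
    have e1 : 0 ≤ Real.exp (-W k x) ∧ Real.exp (-W k x) ≤ 1 :=
      ⟨(Real.exp_pos _).le, Real.exp_le_one_iff.2 (neg_nonpos.2 (hW0 k x))⟩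
    have e2 : 0 ≤ Real.exp (-∑ j ∈ Finset.Ico 1 (t n), W (k + j) (T^[j] x)) ∧
      Real.exp (-∑ j ∈ Finset.Ico 1 (t n), W (k + j) (T^[j] x)) ≤ 1 :=
      exp_neg_sum_mem fun j _ => hW0 _ _
    rw [hA, abs_of_nonneg (mul_nonneg (by linarith) e2.1)]
    exact mul_le_one₀ (by linarith) e2.1 e2.2
  have hB1 : ∀ x, |B x| ≤ 1 := fun x => by
    rw [hB, ← Real.norm_eq_abs, norm_indicator_eq_indicator_norm]
    exact indicator_apply_le' (fun _ => hhm _ _) fun _ => zero_le_one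
  have hint : ∀ F : X → ℝ, Measurable F → (∀ x, |F x| ≤ 1) → Integrable (fun x => F x * G x) μ :=
    fun F hF hF1 => Integrable.of_bound (hF.mul hGm).aestronglyMeasurable 1 (ae_of_all _ fun x => by
      rw [norm_mul]; exact mul_le_one₀ (hF1 x) (norm_nonneg _) (hG1 x))
  have e1 : E (k + 1) - E k = ∫ x, A x * G x ∂μ :=
    integral_tailFactor_succ_sub hT hWm hW0 hWJ k h6
  have e2 : |∫ x, A x * G x ∂μ - ∫ x, B x * G x ∂μ| ≤ η * μ.real D +
      ∑ j ∈ Finset.Ioo (p * M) (t n), μ.real (D ∩ T^[j] ⁻¹' D) := by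
    have hDj : ∀ j, MeasurableSet (D ∩ T^[j] ⁻¹' D) := fun j => hDm.inter (hTm.iterate j hDm)
    have hi1 : Integrable (D.indicator fun _ => η) μ := (integrable_const η).indicator hDm
    have hi2 : ∀ j, Integrable ((D ∩ T^[j] ⁻¹' D).indicator (1 : X → ℝ)) μ := fun j =>
      (integrable_const (1 : ℝ)).indicator (hDj j)
    rw [← integral_sub (hint A hAm hA1) (hint B hBm hB1), ← Real.norm_eq_abs]
    refine (norm_integral_le_of_norm_le (hi1.add (integrable_finsetSum (Finset.Ioo (p * M) (t n))
      fun j _ => hi2 j)) (ae_of_all _ fun x => ?_)).trans (le_of_eq ?_)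
    · rw [← sub_mul, norm_mul]
      refine (mul_le_of_le_one_right (norm_nonneg _) (hG1 x)).trans ?_
      exact h3 k x
    · rw [integral_add' hi1 (integrable_finsetSum _ fun j _ => hi2 j),
        integral_finsetSum _ fun j _ => hi2 j, integral_indicator_const _ hDm, smul_eq_mul, mul_comm]
      congr 1
      exact Finset.sum_congr rfl fun j _ => integral_indicator_one (hDj j)
  have e3 : |n * ∫ x, B x * G x ∂μ - pileRate L f M (k / n) * E (k + t n)| ≤ ε / 4 :=
    h4 (k / n) (tailFactor T W (J n) (k + t n)) (measurable_tailFactor hTm hWm _)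
      (abs_tailFactor_le hW0 _)
  have e4 : |E (k + t n) - E (k + 1)| ≤ t n * μ.real D := by
    have := abs_integral_tailFactor_add_sub_le (μ := μ) (J := J n) hT hWm hW0 hWJ hDm hWD (k + 1)
      (t n - 1)
    rw [show k + 1 + (t n - 1) = k + t n by omega] at this
    refine this.trans ?_
    gcongr
    omega
  -- Three errors: replacing the weights before the gap by a linear head, decoupling the state after
  -- the gap, and moving the starting time k + t n back to k + 1.
  calc |n * (E (k + 1) - E k) - pileRate L f M (k / n) * E (k + 1)|
      = |n * (∫ x, A x * G x ∂μ - ∫ x, B x * G x ∂μ) +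
          (n * ∫ x, B x * G x ∂μ - pileRate L f M (k / n) * E (k + t n)) +
          pileRate L f M (k / n) * (E (k + t n) - E (k + 1))| := by rw [e1]; congr 1; ring
    _ ≤ n * (η * μ.real D + ∑ j ∈ Finset.Ioo (p * M) (t n), μ.real (D ∩ T^[j] ⁻¹' D)) + ε / 4 +
          vQ * (t n * μ.real D) := by
        refine (abs_add_le _ _).trans (add_le_add ((abs_add_le _ _).trans (add_le_add ?_ e3)) ?_)
        · rw [abs_mul, abs_of_pos hn0]; gcongr
        · rw [abs_mul]; gcongr; exact hrate _
    _ = (η * (n * μ.real D) + vQ * ((t n : ℝ) / n * (n * μ.real D))) +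
          n * ∑ j ∈ Finset.Ioo (p * M) (t n), μ.real (D ∩ T^[j] ⁻¹' D) + ε / 4 := by
        field_simp; ring
    _ ≤ ε := by linarith

end Rate

end REPP

end

noncomputable section

namespace REPP

/-! ### Integrability of piles, emergence of the extremal index, and the limit of the Laplace
functionals. -/

section PileLimit

set_option linter.unusedSectionVars false

variable {d : ℕ} {L : EuclideanSpace ℝ (Fin d) →ₗ[ℝ] EuclideanSpace ℝ (Fin d)}
  {f : ℝ → EuclideanSpace ℝ (Fin d) → ℝ} {R a : ℝ}

variable (L) in
/-- The number of points of a linear orbit in a ball around the origin. -/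
def ballVisits (R : ℝ) (v : EuclideanSpace ℝ (Fin d)) : ℝ≥0∞ :=
  ∑' ℓ : ℕ, ((fun v => (L ^ ℓ) v) ⁻¹' Metric.closedBall 0 R).indicator 1 v

theorem measurable_pow_apply (ℓ : ℕ) : Measurable fun v => (L ^ ℓ) v :=
  (LinearMap.continuous_of_finiteDimensional (L ^ ℓ)).measurable

theorem measurable_ballVisits (R : ℝ) : Measurable (ballVisits L R) :=
  Measurable.tsum fun ℓ =>
    measurable_const.indicator (measurable_pow_apply ℓ Metric.isClosed_closedBall.measurableSet)

/-- The preimage of a ball under L^ℓ has |det L|^(-ℓ) times its volume, so the sum over ℓ is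
geometric. Uniform expansion in all directions is not needed. -/
theorem lintegral_ballVisits_lt_top (hL : 1 < |LinearMap.det L|) (R : ℝ) :
    ∫⁻ v, ballVisits L R v < ∞ := by
  have hdet : LinearMap.det L ≠ 0 := fun h => by rw [h, abs_zero] at hL; linarith
  have h1 : ∫⁻ v, ballVisits L R v = ∑' ℓ : ℕ, ENNReal.ofReal |LinearMap.det L|⁻¹ ^ ℓ *
      volume (Metric.closedBall (0 : EuclideanSpace ℝ (Fin d)) R) := by
    simp only [ballVisits]
    rw [lintegral_tsum fun ℓ => (measurable_one.indicator
      (measurable_pow_apply ℓ Metric.isClosed_closedBall.measurableSet)).aemeasurable]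
    refine tsum_congr fun ℓ => ?_
    rw [lintegral_indicator_one (measurable_pow_apply ℓ Metric.isClosed_closedBall.measurableSet)]
    have hdet' : LinearMap.det (L ^ ℓ) ≠ 0 := by rw [map_pow]; exact pow_ne_zero _ hdet
    rw [Measure.addHaar_preimage_linearMap volume hdet', map_pow, abs_inv, abs_pow, ← inv_pow,
      ENNReal.ofReal_pow (by positivity)]
  rw [h1, ENNReal.tsum_mul_right, ENNReal.tsum_geometric]
  refine ENNReal.mul_lt_top ?_ measure_closedBall_lt_top
  rw [ENNReal.inv_lt_top, tsub_pos_iff_lt, ← ENNReal.ofReal_one]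
  exact (ENNReal.ofReal_lt_ofReal_iff one_pos).2 (inv_lt_one_of_one_lt₀ hL)

theorem ae_ballVisits_lt_top (hL : 1 < |LinearMap.det L|) (R : ℝ) :
    ∀ᵐ v, ballVisits L R v < ∞ :=
  ae_lt_top (measurable_ballVisits R) (lintegral_ballVisits_lt_top hL R).ne

theorem finite_of_ballVisits_lt_top {v : EuclideanSpace ℝ (Fin d)} (h : ballVisits L R v < ∞) :
    {ℓ : ℕ | ‖(L ^ ℓ) v‖ ≤ R}.Finite := by
  refine (ENNReal.finite_const_le_of_tsum_ne_top h.ne one_ne_zero).subset fun ℓ hℓ => ?_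
  have : v ∈ (fun v => (L ^ ℓ) v) ⁻¹' Metric.closedBall 0 R := by
    simpa using hℓ
  exact le_of_eq (indicator_of_mem this (1 : EuclideanSpace ℝ (Fin d) → ℝ≥0∞)).symm

theorem integrable_ballVisits (hL : 1 < |LinearMap.det L|) (R : ℝ) :
    Integrable fun v => (ballVisits L R v).toReal :=
  integrable_toReal_of_lintegral_ne_top (measurable_ballVisits R).aemeasurable
    (lintegral_ballVisits_lt_top hL R).ne

theorem eq_zero_of_ballVisits_lt_one (hR : ∀ s v, f s v ≠ 0 → ‖v‖ ≤ R)
    {v : EuclideanSpace ℝ (Fin d)} (h : ballVisits L R v < 1) (s : ℝ) (ℓ : ℕ) :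
    f s ((L ^ ℓ) v) = 0 := by
  by_contra hne
  have hmem : v ∈ (fun v => (L ^ ℓ) v) ⁻¹' Metric.closedBall 0 R := by
    simpa using hR s _ hne
  have : (1 : ℝ≥0∞) ≤ ballVisits L R v := by
    refine le_trans (le_of_eq ?_) (ENNReal.le_tsum ℓ)
    rw [indicator_of_mem hmem]; rfl
  exact absurd h (not_lt.2 this)

/-- If the number of visits is below one the pile contributes nothing; otherwise the number exceeds
the trivial bound 1. This dominates the integrand uniformly in M and s. -/
theorem one_sub_pileFactor_le (hf : ∀ s v, 0 ≤ f s v) (hR : ∀ s v, f s v ≠ 0 → ‖v‖ ≤ R) (M : ℕ)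
    (s : ℝ) {v : EuclideanSpace ℝ (Fin d)} (hv : ballVisits L R v < ∞) :
    |1 - pileFactor L f M s v| ≤ (ballVisits L R v).toReal := by
  have h1 := pileFactor_mem (L := L) hf M s v
  rw [abs_of_nonneg (by linarith)]
  rcases lt_or_ge (ballVisits L R v) 1 with h | h
  · rw [pileFactor, Finset.sum_eq_zero fun ℓ _ => eq_zero_of_ballVisits_lt_one hR h s ℓ]
    simp
  · have : 1 ≤ (ballVisits L R v).toReal := by
      rw [← ENNReal.toReal_one]; exact ENNReal.toReal_mono hv.ne h
    linarith

variable (L f) in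
/-- The mean contribution of the piles that start at time `s`. -/
def pileIntegral (s : ℝ) : ℝ := ∫ v, (1 - Real.exp (-∑' ℓ : ℕ, f s ((L ^ ℓ) v)))

theorem measurable_pileFactor (hfu : UniformContinuous (Function.uncurry f))
    (hf : ∀ s v, 0 ≤ f s v) (M : ℕ) (s : ℝ) : Measurable (pileFactor L f M s) :=
  ((uniformContinuous_pileFactor hf hfu M).continuous.comp (Continuous.prodMk_right s)).measurable

theorem integrable_one_sub_pileFactor (hL : 1 < |LinearMap.det L|)
    (hfu : UniformContinuous (Function.uncurry f)) (hf : ∀ s v, 0 ≤ f s v)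
    (hR : ∀ s v, f s v ≠ 0 → ‖v‖ ≤ R) (M : ℕ) (s : ℝ) :
    Integrable fun v => 1 - pileFactor L f M s v :=
  (integrable_ballVisits hL R).mono'
    (measurable_const.sub (measurable_pileFactor hfu hf M s)).aestronglyMeasurable
    ((ae_ballVisits_lt_top hL R).mono fun _ hv => one_sub_pileFactor_le hf hR M s hv)

theorem tendsto_integral_pileFactor (hL : 1 < |LinearMap.det L|)
    (hfu : UniformContinuous (Function.uncurry f)) (hf : ∀ s v, 0 ≤ f s v)
    (hR : ∀ s v, f s v ≠ 0 → ‖v‖ ≤ R) (s : ℝ) :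
    Tendsto (fun M => ∫ v, (1 - pileFactor L f M s v)) atTop (𝓝 (pileIntegral L f s)) := by
  refine tendsto_integral_of_dominated_convergence (fun v => (ballVisits L R v).toReal)
    (fun M => (measurable_const.sub (measurable_pileFactor hfu hf M s)).aestronglyMeasurable)
    (integrable_ballVisits hL R)
    (fun M => (ae_ballVisits_lt_top hL R).mono fun _ hv => one_sub_pileFactor_le hf hR M s hv)
    ((ae_ballVisits_lt_top hL R).mono fun v hv => ?_)
  have hfin := finite_of_ballVisits_lt_top hv
  have hsum : Summable fun ℓ : ℕ => f s ((L ^ ℓ) v) :=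
    summable_of_hasFiniteSupport (hfin.subset fun ℓ hℓ => hR s _ hℓ)
  exact tendsto_const_nhds.sub ((Real.continuous_exp.tendsto _).comp
    hsum.hasSum.tendsto_sum_nat.neg)

/-- The telescoped head is integrated and the variable L v substituted. Both integrals tend to
`pileIntegral` as M → ∞, which leaves 1 - |det L|⁻¹. -/
theorem pileRate_eq (hL : 1 < |LinearMap.det L|) (hfu : UniformContinuous (Function.uncurry f))
    (hf : ∀ s v, 0 ≤ f s v) (hR : ∀ s v, f s v ≠ 0 → ‖v‖ ≤ R) (M : ℕ) (s : ℝ) :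
    pileRate L f M s = (∫ v, (1 - pileFactor L f (M + 1) s v)) -
      |LinearMap.det L|⁻¹ * ∫ v, (1 - pileFactor L f M s v) := by
  have hdet : LinearMap.det L ≠ 0 := fun h => by rw [h, abs_zero] at hL; linarith
  have hi := fun M => integrable_one_sub_pileFactor hL hfu hf hR M s
  have hmap := Measure.map_linearMap_addHaar_eq_smul_addHaar
    (volume : Measure (EuclideanSpace ℝ (Fin d))) hdet
  have hLm : Measurable L := (LinearMap.continuous_of_finiteDimensional L).measurable
  have hi' : Integrable (fun v => 1 - pileFactor L f M s (L v)) := by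
    have : Integrable (fun v => 1 - pileFactor L f M s v) (Measure.map L volume) := by
      rw [hmap]; exact (hi M).smul_measure ENNReal.ofReal_ne_top
    exact this.comp_measurable hLm
  have e1 : ∫ v, (1 - pileFactor L f M s (L v)) =
      |LinearMap.det L|⁻¹ * ∫ v, (1 - pileFactor L f M s v) := by
    rw [← integral_map (φ := L) (f := fun v => 1 - pileFactor L f M s v) hLm.aemeasurable
      (measurable_const.sub (measurable_pileFactor hfu hf M s)).aestronglyMeasurable, hmap,
      integral_smul_measure, ENNReal.toReal_ofReal (abs_nonneg _), abs_inv, smul_eq_mul]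
  rw [← e1, ← integral_sub (hi (M + 1)) hi', pileRate]
  refine integral_congr_ae (ae_of_all _ fun v => ?_)
  simp only [headFactor_eq_sub]
  ring

theorem abs_headFactor_le_indicator (hf : ∀ s v, 0 ≤ f s v) (hR : ∀ s v, f s v ≠ 0 → ‖v‖ ≤ R)
    (M : ℕ) (s : ℝ) (v : EuclideanSpace ℝ (Fin d)) :
    |headFactor L f M s v| ≤ (Metric.closedBall 0 R).indicator 1 v := by
  by_cases hv : v ∈ Metric.closedBall 0 R
  · rw [indicator_of_mem hv]
    have := headFactor_mem (L := L) hf M s v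
    rw [abs_of_nonneg this.1]; exact this.2
  · rw [indicator_of_notMem hv, headFactor_eq_zero, abs_zero]
    by_contra hne
    exact hv (by simpa using hR s v hne)

theorem integrable_closedBall_indicator (R c : ℝ) :
    Integrable ((Metric.closedBall (0 : EuclideanSpace ℝ (Fin d)) R).indicator fun _ => c) :=
  (integrable_indicator_iff Metric.isClosed_closedBall.measurableSet).2
    (integrableOn_const measure_closedBall_lt_top.ne)

theorem pileRate_nonneg (hf : ∀ s v, 0 ≤ f s v) (M : ℕ) (s : ℝ) : 0 ≤ pileRate L f M s :=
  integral_nonneg fun v => (headFactor_mem hf M s v).1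

theorem pileRate_le (hf : ∀ s v, 0 ≤ f s v) (hR : ∀ s v, f s v ≠ 0 → ‖v‖ ≤ R) (M : ℕ) (s : ℝ) :
    pileRate L f M s ≤ volume.real (Metric.closedBall (0 : EuclideanSpace ℝ (Fin d)) R) := by
  rw [← integral_indicator_one Metric.isClosed_closedBall.measurableSet]
  refine (le_abs_self _).trans ?_
  rw [← Real.norm_eq_abs, pileRate]
  exact norm_integral_le_of_norm_le (integrable_closedBall_indicator R 1)
    (ae_of_all _ fun v => abs_headFactor_le_indicator hf hR M s v)

theorem uniformContinuous_pileRate (hfu : UniformContinuous (Function.uncurry f))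
    (hf : ∀ s v, 0 ≤ f s v) (hR : ∀ s v, f s v ≠ 0 → ‖v‖ ≤ R) (M : ℕ) :
    UniformContinuous (pileRate L f M) := by
  set V := volume.real (Metric.closedBall (0 : EuclideanSpace ℝ (Fin d)) R)
  have hV : 0 ≤ V := measureReal_nonneg
  have huc := uniformContinuous_headFactor (L := L) hf hfu M
  have hm : ∀ s, Measurable (headFactor L f M s) := fun s =>
    (huc.continuous.comp (Continuous.prodMk_right s)).measurable
  have hi : ∀ s, Integrable (headFactor L f M s) := fun s =>
    (integrable_closedBall_indicator R 1).mono' (hm s).aestronglyMeasurable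
      (ae_of_all _ fun v => abs_headFactor_le_indicator hf hR M s v)
  rw [Metric.uniformContinuous_iff] at huc ⊢
  intro ε hε
  obtain ⟨δ, hδ, h⟩ := huc (ε / (V + 1)) (by positivity)
  refine ⟨δ, hδ, fun {s s'} hs => ?_⟩
  rw [Real.dist_eq, pileRate, pileRate, ← integral_sub (hi s) (hi s'), ← Real.norm_eq_abs]
  refine lt_of_le_of_lt (norm_integral_le_of_norm_le
    (integrable_closedBall_indicator R (ε / (V + 1))) (ae_of_all _ fun v => ?_)) ?_
  · by_cases hv : v ∈ Metric.closedBall 0 R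
    · rw [indicator_of_mem hv]
      have := @h (s, v) (s', v) (by rw [Prod.dist_eq, dist_self, max_lt_iff]; exact ⟨hs, hδ⟩)
      exact this.le
    · have h1 := abs_headFactor_le_indicator (L := L) hf hR M s v
      have h2 := abs_headFactor_le_indicator (L := L) hf hR M s' v
      rw [indicator_of_notMem hv] at h1 h2 ⊢
      rw [abs_nonpos_iff.1 h1, abs_nonpos_iff.1 h2]; simp
  · rw [integral_indicator_const _ Metric.isClosed_closedBall.measurableSet, smul_eq_mul]
    change V * (ε / (V + 1)) < ε
    rw [mul_div_assoc', div_lt_iff₀ (by positivity)]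
    nlinarith

theorem tendsto_integral_pileRate (hL : 1 < |LinearMap.det L|)
    (hfu : UniformContinuous (Function.uncurry f)) (hf : ∀ s v, 0 ≤ f s v)
    (hR : ∀ s v, f s v ≠ 0 → ‖v‖ ≤ R) :
    Tendsto (fun M => ∫ s in (0 : ℝ)..a, pileRate L f M s) atTop
      (𝓝 (∫ s in (0 : ℝ)..a, (1 - |LinearMap.det L|⁻¹) * pileIntegral L f s)) := by
  refine intervalIntegral.tendsto_integral_filter_of_dominated_convergence
    (fun _ => volume.real (Metric.closedBall (0 : EuclideanSpace ℝ (Fin d)) R))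
    (Eventually.of_forall fun M =>
      (uniformContinuous_pileRate hfu hf hR M).continuous.aestronglyMeasurable)
    (Eventually.of_forall fun M => ae_of_all _ fun s _ => ?_) (by simp) (ae_of_all _ fun s _ => ?_)
  · rw [Real.norm_eq_abs, abs_of_nonneg (pileRate_nonneg hf M s)]
    exact pileRate_le hf hR M s
  · have h1 := tendsto_integral_pileFactor hL hfu hf hR s
    have h2 := (h1.comp (tendsto_add_atTop_nat 1)).sub (h1.const_mul |LinearMap.det L|⁻¹)
    rw [sub_mul, one_mul]
    refine h2.congr fun M => ?_
    rw [pileRate_eq hL hfu hf hR]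
    rfl

variable {X : Type*} [MetricSpace X] [MeasurableSpace X] [BorelSpace X] {μ : Measure X}
  [IsProbabilityMeasure μ] {T : X → X} {C₁ : Type*} [NormedAddCommGroup C₁] [NormedSpace ℝ C₁]
  {ι : C₁ →ₗ[ℝ] (X →ₘ[μ] ℝ)} {H : ℕ → X → ℝ≥0∞} {p : ℕ} {U : Set X}
  {y : ℕ → X → EuclideanSpace ℝ (Fin d)} {ρ : ℕ → ℝ} {w : ℕ → ℝ → X → ℝ}

/-- Convergence of the Laplace functionals of rescaled visits. -/
theorem IsScalingChart.tendsto_laplace (h : IsScalingChart μ T ι H p L U y)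
    (hw : IsVisitWeight U y w f R a) (hp : 0 < p) (hT : MeasurePreserving T μ μ)
    (hdecay : DecayAgainstL1 T ι ρ) (hρ : Summable ρ) (hL : 1 < |LinearMap.det L|)
    {J : ℕ → ℕ} (hJ : ∀ n : ℕ, a * n ≤ J n) {b : ℝ} (hJb : ∀ᶠ n : ℕ in atTop, (J n : ℝ) ≤ b * n) :
    Tendsto (fun n : ℕ => ∫ x, Real.exp (-∑ j ∈ Finset.range (J n), w n (j / n) (T^[j] x)) ∂μ) atTop
      (𝓝 (Real.exp (-((1 - |LinearMap.det L|⁻¹) * ∫ s in (0 : ℝ)..a, pileIntegral L f s)))) := by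
  rw [← intervalIntegral.integral_const_mul, Metric.tendsto_nhds]
  intro ε hε
  set Λ := volume.real (Metric.closedBall (0 : EuclideanSpace ℝ (Fin d)) R)
  set η := ε / (4 * (|b| + 1)) with hη
  have hη0 : 0 < η := by positivity
  obtain ⟨M₀, hM₀⟩ := h.exists_forall_eventually_recursion hw hp hT hdecay hρ hJ hη0
  have hMlim := (Real.continuous_exp.tendsto _).comp
    (tendsto_integral_pileRate (a := a) hL hw.uniformContinuous hw.limit_nonneg hw.norm_le).neg
  -- The truncation is fixed here, large enough both for the recursion and for the exponential of
  -- the integrated rate; only then does n tend to infinity.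
  obtain ⟨M, hM, hMM₀⟩ := ((Metric.tendsto_nhds.1 hMlim (ε / 4) (by positivity)).and
    (eventually_ge_atTop M₀)).exists
  have huc := uniformContinuous_pileRate (L := L) hw.uniformContinuous hw.limit_nonneg hw.norm_le M
  have hzero : ∀ s, a ≤ s → pileRate L f M s = 0 := fun s hs => by
    rw [pileRate, integral_congr_ae (g := fun _ => (0 : ℝ)) (ae_of_all _ fun v =>
      headFactor_eq_zero (hw.limit_eq_zero s v hs)), integral_zero]
  have hRS := (Real.continuous_exp.tendsto _).comp
    (tendsto_riemannSum huc hzero (Eventually.of_forall hJ) hJb).neg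
  have hsmall : Tendsto (fun n : ℕ => |b| * Λ ^ 2 / n) atTop (𝓝 0) :=
    tendsto_const_div_atTop_nhds_zero_nat _
  filter_upwards [hM₀ M hMM₀, Metric.tendsto_nhds.1 hRS (ε / 4) (by positivity), hJb,
    hsmall.eventually (gt_mem_nhds (show 0 < ε / 4 by positivity)), eventually_ge_atTop 1,
    tendsto_natCast_atTop_atTop.eventually_ge_atTop Λ] with n h1 h2 h3 h4 h5 h6
  have hn0 : (0 : ℝ) < n := by exact_mod_cast h5
  set E : ℕ → ℝ := fun k => ∫ x, tailFactor T (fun k => w n (k / n)) (J n) k x ∂μ with hE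
  have hWJ : ∀ k : ℕ, J n ≤ k → w n (k / n) = 0 := fun k hk => by
    ext x
    refine hw.eq_zero n _ x ?_
    rw [le_div_iff₀ hn0]
    exact (hJ n).trans (by exact_mod_cast hk)
  have hEJ : E (J n) = 1 := by
    have : ∀ x, tailFactor T (fun k => w n (k / n)) (J n) (J n) x = 1 := fun x =>
      tailFactor_of_le hWJ le_rfl x
    simp [hE, this]
  have hrec := abs_sub_exp_le_of_recursion (l := fun k => pileRate L f M (k / n)) hn0 hEJ
    (fun k => pileRate_nonneg hw.limit_nonneg M _)
    (fun k => pileRate_le hw.limit_nonneg hw.norm_le M _) h6 h1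
  have hE0 : ∫ x, Real.exp (-∑ j ∈ Finset.range (J n), w n (j / n) (T^[j] x)) ∂μ = E 0 := by
    simp [hE, tailFactor]
  rw [hE0, Real.dist_eq]
  have hJ2 : (J n : ℝ) * (η / n + Λ ^ 2 / n ^ 2) ≤ ε / 4 + ε / 4 := by
    have h7 : (J n : ℝ) ≤ |b| * n := h3.trans (by gcongr; exact le_abs_self b)
    calc (J n : ℝ) * (η / n + Λ ^ 2 / n ^ 2) ≤ |b| * n * (η / n + Λ ^ 2 / n ^ 2) := by gcongr
      _ = |b| * η + |b| * Λ ^ 2 / n := by field_simp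
      _ ≤ (|b| + 1) * η + ε / 4 := by
        refine add_le_add ?_ h4.le
        gcongr; linarith
      _ = ε / 4 + ε / 4 := by rw [hη]; field_simp
  simp only [Function.comp_apply, Real.dist_eq] at h2 hM
  rw [neg_div] at hrec
  have t1 := abs_sub_le (E 0) (Real.exp (-((∑ k ∈ Finset.range (J n), pileRate L f M (k / n)) / n)))
    (Real.exp (-∫ s in (0 : ℝ)..a, pileRate L f M s))
  have t2 := abs_sub_le (E 0) (Real.exp (-∫ s in (0 : ℝ)..a, pileRate L f M s))
    (Real.exp (-∫ s in (0 : ℝ)..a, (1 - |LinearMap.det L|⁻¹) * pileIntegral L f s))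
  linarith

end PileLimit

end REPP

end

noncomputable section

namespace REPP

/-! ### Sums of Dirac masses and the empirical process -/

section DiracSums

variable {E : Type*} [TopologicalSpace E] [MeasurableSpace E]

theorem integral_sum_dirac [BorelSpace E] {ι : Type*} [Countable ι]
    (x : ι → E) {f : E → ℝ} (hf : Continuous f) (hf0 : ∀ e, 0 ≤ f e) :
    ∫ e, f e ∂(Measure.sum fun i => Measure.dirac (x i)) = ∑' i, f (x i) := by
  have hfm : Measurable f := hf.measurable
  rw [integral_eq_lintegral_of_nonneg_ae (ae_of_all _ hf0) hfm.aestronglyMeasurable,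
    lintegral_sum_measure]
  simp_rw [lintegral_dirac' _ hfm.ennreal_ofReal]
  rw [ENNReal.tsum_toReal_eq fun _ => ENNReal.ofReal_ne_top]
  exact tsum_congr fun i => ENNReal.toReal_ofReal (hf0 _)

/-- Realisations in a measurable null set containing the exceptional ones are replaced by the zero
measure, which gives an everywhere defined measurable version. -/
theorem isPointProcess_of_measurable [Nonempty E] {Ω : Type*} [MeasurableSpace Ω] {P : Measure Ω}
    {N : Ω → Measure E} (hN : Measurable N) (hr : ∀ᵐ ω ∂P, IsRadonPointMeasure (N ω)) :
    IsPointProcess P N := by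
  classical
  refine ⟨hr, ?_⟩
  set B := toMeasurable P {ω | ¬IsRadonPointMeasure (N ω)} with hB
  have hB0 : P B = 0 := by rw [hB, measure_toMeasurable]; exact hr
  have hBm : MeasurableSet B := measurableSet_toMeasurable _ _
  let N' : Ω → Measure E := B.piecewise (fun _ => 0) N
  have hN'm : Measurable N' := Measurable.piecewise hBm measurable_const hN
  have hN'r : ∀ ω, IsRadonPointMeasure (N' ω) := fun ω => by
    by_cases hω : ω ∈ B
    · simp only [N', piecewise_eq_of_mem _ _ _ hω]; exact isRadonPointMeasure_zero
    · simp only [N', piecewise_eq_of_notMem _ _ _ hω]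
      by_contra hcon
      exact hω (subset_toMeasurable P _ hcon)
  refine ⟨fun ω => toPointMeasure (N' ω), ?_, ?_⟩
  · refine measurable_comap_iff.2 ?_
    have : ((fun m : PointMeasure E => (m.1 : Measure E)) ∘ fun ω => toPointMeasure (N' ω)) = N' := by
      ext1 ω; exact congrArg Subtype.val (dif_pos (hN'r ω))
    rw [this]; exact hN'm
  · have : ∀ᵐ ω ∂P, ω ∉ B := measure_eq_zero_iff_ae_notMem.1 hB0
    filter_upwards [this] with ω hω
    simp only [N', piecewise_eq_of_notMem _ _ _ hω]

theorem exists_support_bound (f : C_c(ℝ≥0 × ℝ≥0, ℝ)) :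
    ∃ A : ℝ≥0, 0 < A ∧ ∀ q, f q ≠ 0 → q.1 < A ∧ q.2 < A := by
  obtain ⟨A, hA⟩ := (f.hasCompactSupport.isBounded).subset_ball (0 : ℝ≥0 × ℝ≥0)
  refine ⟨(max A 1).toNNReal, by simp, fun q hq => ?_⟩
  have h1 := hA (subset_tsupport _ hq)
  rw [Metric.mem_ball, Prod.dist_eq, max_lt_iff, NNReal.dist_eq, NNReal.dist_eq] at h1
  simp only [Prod.fst_zero, Prod.snd_zero, NNReal.coe_zero, sub_zero, NNReal.abs_eq] at h1
  have h2 := le_max_left A 1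
  constructor <;> rw [Real.lt_toNNReal_iff_coe_lt] <;> linarith [h1.1, h1.2]

theorem uniformContinuous_of_compactSupport (f : C_c(ℝ≥0 × ℝ≥0, ℝ)) : UniformContinuous f :=
  f.continuous.uniformContinuous_of_tendsto_cocompact f.hasCompactSupport.is_zero_at_infty

end DiracSums

/-! ### The empirical process as a sum of visit weights. -/

section Empirical

set_option linter.unusedSectionVars false

theorem measurable_levelInv (u : ℝ → ℝ) : Measurable (levelInv u) := by
  refine Antitone.measurable fun z z' hz => ?_
  exact le_iInf₂ fun τ hτ => iInf₂_le τ ⟨hτ.1, hτ.2.trans_le hz⟩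

/-- The weight `f` of a visit at time `s` to a point of finite height. -/
def visitWeight {X : Type*} (f : C_c(ℝ≥0 × ℝ≥0, ℝ)) (H : ℕ → X → ℝ≥0∞) (n : ℕ) (s : ℝ) (x : X) :
    ℝ :=
  (H n ⁻¹' {∞})ᶜ.indicator (fun x => f (s.toNNReal, (H n x).toNNReal)) x

/-- The weight `f` at time `s` and height `|B_‖v‖|`. -/
def limitWeight {d : ℕ} (f : C_c(ℝ≥0 × ℝ≥0, ℝ)) (s : ℝ) (v : EuclideanSpace ℝ (Fin d)) : ℝ :=
  f (s.toNNReal, ballVol v)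

theorem continuous_ballVol {d : ℕ} (hd : 0 < d) :
    Continuous (ballVol : EuclideanSpace ℝ (Fin d) → ℝ≥0) := by
  rw [NNReal.isEmbedding_coe.continuous_iff]
  have : ((↑) : ℝ≥0 → ℝ) ∘ (ballVol : EuclideanSpace ℝ (Fin d) → ℝ≥0) = fun v => radVol d ‖v‖ := by
    ext v; exact coe_ballVol hd v
  rw [this]
  exact (continuous_radVol d).comp continuous_norm

theorem exists_norm_le_of_ballVol_lt {d : ℕ} (hd : 0 < d) (A : ℝ≥0) :
    ∃ R : ℝ, ∀ v : EuclideanSpace ℝ (Fin d), ballVol v < A → ‖v‖ ≤ R := by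
  refine ⟨A / volume.real (Metric.ball (0 : EuclideanSpace ℝ (Fin d)) 1) + 1, fun v hv => ?_⟩
  by_contra! hcon
  have hB := unitBall_pos d
  have h0 : (0 : ℝ) ≤ A / volume.real (Metric.ball (0 : EuclideanSpace ℝ (Fin d)) 1) := by positivity
  have h1 : (ballVol v : ℝ) < A := hv
  rw [coe_ballVol hd, radVol, ← lt_div_iff₀ hB] at h1
  have h2 : ‖v‖ ≤ ‖v‖ ^ d := le_self_pow₀ (by linarith) hd.ne'
  linarith

theorem uniformContinuous_limitWeight {d : ℕ} (hd : 0 < d) (f : C_c(ℝ≥0 × ℝ≥0, ℝ)) :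
    UniformContinuous
      (Function.uncurry (limitWeight f : ℝ → EuclideanSpace ℝ (Fin d) → ℝ)) := by
  obtain ⟨A, -, hA⟩ := exists_support_bound f
  obtain ⟨R, hR⟩ := exists_norm_le_of_ballVol_lt hd A
  let g : ℝ≥0 × EuclideanSpace ℝ (Fin d) → ℝ := fun q => f (q.1, ballVol q.2)
  have hg : Continuous g := f.continuous.comp
    (continuous_fst.prodMk ((continuous_ballVol hd).comp continuous_snd))
  have hgc : HasCompactSupport g := by
    refine HasCompactSupport.of_support_subset_isCompact
      ((isCompact_Icc (a := (0 : ℝ≥0)) (b := A)).prod (isCompact_closedBall 0 R)) fun q hq => ?_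
    have := hA _ hq
    exact ⟨⟨zero_le, this.1.le⟩, by simpa using hR _ this.2⟩
  have hgu : UniformContinuous g :=
    hg.uniformContinuous_of_tendsto_cocompact hgc.is_zero_at_infty
  exact hgu.comp ((Real.lipschitzWith_toNNReal.uniformContinuous.comp uniformContinuous_fst).prodMk
    uniformContinuous_snd)

variable {X : Type*} [MetricSpace X] [MeasurableSpace X] [BorelSpace X] {μ : Measure X}
  [IsProbabilityMeasure μ] {T : X → X} {C₁ : Type*} [NormedAddCommGroup C₁] [NormedSpace ℝ C₁]
  {ι : C₁ →ₗ[ℝ] (X →ₘ[μ] ℝ)} {H : ℕ → X → ℝ≥0∞} {p d : ℕ} {U : Set X}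
  {y : ℕ → X → EuclideanSpace ℝ (Fin d)}
  {L : EuclideanSpace ℝ (Fin d) →ₗ[ℝ] EuclideanSpace ℝ (Fin d)}

/-- Bounded heights force bounded rescaled positions, and uniform continuity of f turns closeness of
heights into closeness of weights, uniformly in time. -/
theorem IsScalingChart.exists_isVisitWeight (h : IsScalingChart μ T ι H p L U y) (hd : 0 < d)
    (hH : ∀ n, Measurable (H n)) {f : C_c(ℝ≥0 × ℝ≥0, ℝ)} (hf : 0 ≤ f) {A : ℝ≥0}
    (hA : ∀ q, f q ≠ 0 → q.1 < A ∧ q.2 < A) :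
    ∃ R, IsVisitWeight U y (visitWeight f H) (limitWeight f) R A := by
  obtain ⟨R₁, hR₁⟩ := exists_norm_le_of_ballVol_lt hd A
  obtain ⟨R₂, hR₂⟩ := h.height_lt A
  have hf0 : ∀ q, 0 ≤ f q := fun q => hf q
  have hfz : ∀ s : ℝ, ∀ r, (A : ℝ) ≤ s → f (s.toNNReal, r) = 0 := fun s r hs => by
    by_contra hne
    exact absurd (hA _ hne).1 (not_lt.2 (NNReal.le_toNNReal_of_coe_le hs))
  refine ⟨max R₁ R₂, ⟨fun n s x => indicator_nonneg (fun _ _ => hf0 _) _, fun n s => ?_,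
    fun s v => hf0 _, uniformContinuous_limitWeight hd f, fun s v hne => ?_, ?_, ?_,
    fun n s x hs => ?_, fun s v hs => hfz s _ hs⟩⟩
  · refine Measurable.indicator ?_ (hH n (measurableSet_singleton _)).compl
    exact f.continuous.measurable.comp (measurable_const.prodMk (hH n).ennreal_toNNReal)
  · exact (hR₁ v (hA _ hne).2).trans (le_max_left _ _)
  · filter_upwards [hR₂] with n hn s x hne
    have hx : x ∈ (H n ⁻¹' {∞})ᶜ := by
      by_contra hx; exact hne (indicator_of_notMem hx _)
    rw [visitWeight, indicator_of_mem hx] at hne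
    have h1 : H n x < A := by
      have hfin : H n x ≠ ∞ := hx
      rw [← ENNReal.coe_toNNReal hfin]
      exact_mod_cast (hA _ hne).2
    exact ⟨(hn x h1).1, (hn x h1).2.trans (le_max_right _ _)⟩
  · intro R' ε hε
    obtain ⟨δ, hδ, hδf⟩ := Metric.uniformContinuous_iff.1 (uniformContinuous_of_compactSupport f) ε hε
    filter_upwards [h.height R' (δ / 2) (half_pos hδ)] with n hn s x hx hxR
    obtain ⟨h1, h2⟩ := hn x hx hxR
    rw [visitWeight, indicator_of_mem (show x ∈ (H n ⁻¹' {∞})ᶜ from h1), limitWeight]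
    refine (hδf (?_ : dist (s.toNNReal, (H n x).toNNReal) (s.toNNReal, ballVol (y n x)) < δ)).le
    rw [Prod.dist_eq, dist_self, max_lt_iff, NNReal.dist_eq]
    exact ⟨hδ, lt_of_le_of_lt h2 (by linarith)⟩
  · by_cases hx : x ∈ (H n ⁻¹' {∞})ᶜ
    · rw [visitWeight, indicator_of_mem hx]; exact hfz s _ hs
    · exact indicator_of_notMem hx _

/-- Infinite heights are removed by the indicator in `visitWeight`, and times j / n ≥ A lie outside
the support of f. -/
theorem integral_empiricalREPP {f : C_c(ℝ≥0 × ℝ≥0, ℝ)} (hf : 0 ≤ f) {A : ℝ≥0}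
    (hA : ∀ q, f q ≠ 0 → q.1 < A ∧ q.2 < A) (φ : X → EReal) (u : ℕ → ℝ → ℝ) {n : ℕ} (hn : 1 ≤ n)
    {J : ℕ} (hJ : (A : ℝ) * n ≤ J) (x : X) :
    ∫ q, f q ∂(empiricalREPP T φ u n x) = ∑ j ∈ Finset.range J,
      visitWeight f (fun n x => levelInv (u n) (φ x)) n (j / n) (T^[j] x) := by
  have hn0 : (0 : ℝ) < n := by exact_mod_cast hn
  rw [empiricalREPP, integral_sum_dirac _ (map_continuous f) fun q => hf q]
  have h1 : ∑' j : {j : ℕ | levelInv (u n) (φ (T^[j] x)) ≠ ∞},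
      f (((j : ℕ) : ℝ≥0) / (n : ℝ≥0), (levelInv (u n) (φ (T^[(j : ℕ)] x))).toNNReal) =
      ∑' j : ℕ, visitWeight f (fun n x => levelInv (u n) (φ x)) n (j / n) (T^[j] x) := by
    rw [tsum_subtype {j : ℕ | levelInv (u n) (φ (T^[j] x)) ≠ ∞} fun j : ℕ =>
      f ((j : ℝ≥0) / (n : ℝ≥0), (levelInv (u n) (φ (T^[j] x))).toNNReal)]
    refine tsum_congr fun j => ?_
    have e : ((j : ℝ) / n).toNNReal = (j : ℝ≥0) / n := by
      rw [Real.toNNReal_div (Nat.cast_nonneg j)]; simp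
    simp only [visitWeight, e]
    rfl
  rw [h1]
  refine tsum_eq_sum fun j hj => ?_
  have hjJ : J ≤ j := not_lt.1 fun hlt => hj (Finset.mem_range.2 hlt)
  refine indicator_apply_eq_zero.2 fun _ => ?_
  by_contra hne
  have h2 := (hA _ hne).1
  have h3 : (j : ℝ) / n < A := by
    rw [Real.toNNReal_lt_iff_lt_coe (by positivity)] at h2
    exact h2
  rw [div_lt_iff₀ hn0] at h3
  have : (J : ℝ) ≤ j := by exact_mod_cast hjJ
  linarith

theorem measurable_empiricalREPP (hT : Measurable T) {φ : X → EReal} (hφ : Measurable φ)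
    (u : ℕ → ℝ → ℝ) (n : ℕ) : Measurable (empiricalREPP T φ u n) := by
  refine Measure.measurable_of_measurable_coe _ fun s hs => ?_
  have hH : ∀ j, Measurable fun x => levelInv (u n) (φ (T^[j] x)) := fun j =>
    (measurable_levelInv (u n)).comp (hφ.comp (hT.iterate j))
  have h1 : ∀ x, empiricalREPP T φ u n x s = ∑' j : ℕ,
      ({x | levelInv (u n) (φ (T^[j] x)) = ∞}ᶜ.indicator (fun x => s.indicator (1 : ℝ≥0 × ℝ≥0 → ℝ≥0∞)
        ((j : ℝ≥0) / (n : ℝ≥0), (levelInv (u n) (φ (T^[j] x))).toNNReal)) x) := by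
    intro x
    rw [empiricalREPP, Measure.sum_apply _ hs]
    simp_rw [Measure.dirac_apply' _ hs]
    rw [tsum_subtype {j : ℕ | levelInv (u n) (φ (T^[j] x)) ≠ ∞} fun j : ℕ =>
      s.indicator (1 : ℝ≥0 × ℝ≥0 → ℝ≥0∞)
        ((j : ℝ≥0) / (n : ℝ≥0), (levelInv (u n) (φ (T^[j] x))).toNNReal)]
    rfl
  simp_rw [h1]
  refine Measurable.tsum fun j => Measurable.indicator ?_ ((hH j) (measurableSet_singleton _)).compl
  exact (measurable_one.indicator hs).comp (measurable_const.prodMk (hH j).ennreal_toNNReal)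

theorem isRadonPointMeasure_empiricalREPP (φ : X → EReal) (u : ℕ → ℝ → ℝ) {n : ℕ} (hn : 1 ≤ n)
    (x : X) : IsRadonPointMeasure (empiricalREPP T φ u n x) := by
  refine ⟨fun K hK => ?_, {j : ℕ | levelInv (u n) (φ (T^[j] x)) ≠ ∞}, fun j =>
    ((j : ℝ≥0) / (n : ℝ≥0), (levelInv (u n) (φ (T^[j] x))).toNNReal), rfl⟩
  have hn0 : (0 : ℝ≥0) < n := by exact_mod_cast hn
  obtain ⟨A, hA⟩ := (hK.image continuous_fst).bddAbove
  rw [empiricalREPP, Measure.sum_apply _ hK.isClosed.measurableSet]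
  simp_rw [Measure.dirac_apply' _ hK.isClosed.measurableSet]
  obtain ⟨m, hm⟩ := exists_nat_gt (A * n)
  have hfin : {j : {j : ℕ | levelInv (u n) (φ (T^[j] x)) ≠ ∞} | (j : ℕ) < m}.Finite :=
    (finite_lt_nat m).preimage Subtype.val_injective.injOn
  rw [tsum_eq_sum (s := hfin.toFinset)]
  · refine ENNReal.sum_lt_top.2 fun j _ => ?_
    exact lt_of_le_of_lt (indicator_apply_le' (fun _ => le_rfl) fun _ => zero_le_one)
      ENNReal.one_lt_top
  · intro j hj
    refine indicator_of_notMem (fun hmem => hj ?_) _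
    have h1 : ((j : ℕ) : ℝ≥0) / n ≤ A := hA ⟨_, hmem, rfl⟩
    rw [div_le_iff₀ hn0] at h1
    have h2 : ((j : ℕ) : ℝ≥0) < m := h1.trans_lt hm
    simpa using (by exact_mod_cast h2 : (j : ℕ) < m)

end Empirical

end REPP

end

noncomputable section

namespace REPP

/-! ### Independent piles at exponential times -/

section Exponential

variable {θ : ℝ}

theorem integral_expMeasure (g : ℝ → ℝ) (hθ : 0 < θ) :
    ∫ t, g t ∂expMeasure θ = ∫ t in Ioi 0, θ * Real.exp (-(θ * t)) * g t := by
  have hm : Measurable (gammaPDF 1 θ) := (measurable_gammaPDFReal 1 θ).ennreal_ofReal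
  rw [expMeasure, gammaMeasure, integral_withDensity_eq_integral_toReal_smul hm
    (ae_of_all _ fun _ => ENNReal.ofReal_lt_top), ← integral_Ici_eq_integral_Ioi,
    ← integral_indicator measurableSet_Ici]
  refine integral_congr_ae (ae_of_all _ fun t => ?_)
  simp only [smul_eq_mul]
  have h1 : gammaPDF 1 θ t = exponentialPDF θ t := rfl
  by_cases ht : 0 ≤ t
  · rw [h1, exponentialPDF_of_nonneg ht, ENNReal.toReal_ofReal (by positivity),
      indicator_of_mem (show t ∈ Ici 0 from ht)]
  · rw [h1, exponentialPDF_of_neg (not_le.1 ht), indicator_of_notMem (show t ∉ Ici 0 from ht)]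
    simp

theorem expMeasure_Iio_zero (hθ : 0 < θ) : expMeasure θ (Iio 0) = 0 := by
  have : IsProbabilityMeasure (expMeasure θ) := isProbabilityMeasure_expMeasure hθ
  have h1 := cdf_expMeasure_eq hθ 0
  rw [cdf_eq_real] at h1
  simp only [le_refl, if_true, mul_zero, neg_zero, Real.exp_zero, sub_self] at h1
  exact measure_mono_null Iio_subset_Iic_self ((measureReal_eq_zero_iff).1 h1)

theorem expMeasure_Iic_lt_one (hθ : 0 < θ) (t : ℝ) : expMeasure θ (Iic t) < 1 := by
  have : IsProbabilityMeasure (expMeasure θ) := isProbabilityMeasure_expMeasure hθ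
  have h1 := cdf_expMeasure_eq hθ t
  rw [cdf_eq_real] at h1
  have h2 : (expMeasure θ).real (Iic t) < 1 := by
    rw [h1]
    split_ifs
    · linarith [Real.exp_pos (-(θ * t))]
    · exact one_pos
  rw [← ENNReal.toReal_lt_toReal (measure_ne_top _ _) ENNReal.one_ne_top, ENNReal.toReal_one]
  exact h2

/-- The Laplace functional of a Poisson process with intensity `θ q`, from time `s` on. -/
def poissonFactor (θ a : ℝ) (q : ℝ → ℝ) (s : ℝ) : ℝ := Real.exp (-(θ * ∫ r in s..a, q r))

variable {q : ℝ → ℝ} {a : ℝ}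

theorem poissonFactor_of_le (hqa : ∀ s, a ≤ s → q s = 0) {s : ℝ} (hs : a ≤ s) :
    poissonFactor θ a q s = 1 := by
  have : ∫ r in s..a, q r = 0 := by
    rw [intervalIntegral.integral_congr (g := fun _ => (0 : ℝ))]
    · simp
    · intro r hr
      rw [uIcc_of_ge hs] at hr
      exact hqa r hr.1
  rw [poissonFactor, this]; simp

theorem poissonFactor_mem (hθ : 0 < θ) (hq0 : ∀ s, 0 ≤ q s) (hqa : ∀ s, a ≤ s → q s = 0) (s : ℝ) :
    0 ≤ poissonFactor θ a q s ∧ poissonFactor θ a q s ≤ 1 := by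
  refine ⟨(Real.exp_pos _).le, ?_⟩
  rcases le_total s a with h | h
  · refine Real.exp_le_one_iff.2 (neg_nonpos.2 (mul_nonneg hθ.le ?_))
    exact intervalIntegral.integral_nonneg h fun r _ => hq0 r
  · rw [poissonFactor_of_le hqa h]

theorem hasDerivAt_poissonFactor (hq : Continuous q) (s : ℝ) :
    HasDerivAt (poissonFactor θ a q) (θ * q s * poissonFactor θ a q s) s := by
  have h1 : HasDerivAt (fun s => ∫ r in s..a, q r) (-q s) s :=
    intervalIntegral.integral_hasDerivAt_left (hq.intervalIntegrable _ _)
      (hq.stronglyMeasurableAtFilter _ _) hq.continuousAt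
  have h2 := ((h1.const_mul θ).neg).exp
  refine h2.congr_deriv ?_
  simp only [poissonFactor, Pi.neg_apply]
  ring

theorem continuous_poissonFactor (hq : Continuous q) : Continuous (poissonFactor θ a q) :=
  continuous_iff_continuousAt.2 fun s => (hasDerivAt_poissonFactor hq s).continuousAt

/-- The renewal equation of the Laplace functional. -/
theorem integral_poissonFactor (hθ : 0 < θ) (hq : Continuous q) (hq0 : ∀ s, 0 ≤ q s)
    (hq1 : ∀ s, q s ≤ 1) (hqa : ∀ s, a ≤ s → q s = 0) (s : ℝ) :
    ∫ t, (1 - q (s + t)) * poissonFactor θ a q (s + t) ∂expMeasure θ = poissonFactor θ a q s := by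
  rw [integral_expMeasure _ hθ]
  have hpm := poissonFactor_mem (θ := θ) hθ hq0 hqa
  -- As the Poisson factor G satisfies G' = θ q G, the integrand is an exact derivative, with
  -- primitive equal to -G(s) at 0 and tending to 0 at infinity.
  have hder : ∀ t ∈ Ici (0 : ℝ), HasDerivAt
      (fun t => -Real.exp (-(θ * t)) * poissonFactor θ a q (s + t))
      (θ * Real.exp (-(θ * t)) * ((1 - q (s + t)) * poissonFactor θ a q (s + t))) t := by
    intro t _
    have h1 : HasDerivAt (fun t => -Real.exp (-(θ * t))) (θ * Real.exp (-(θ * t))) t :=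
      hasDerivAt_neg_exp_mul_exp
    have h2 : HasDerivAt (fun t => poissonFactor θ a q (s + t))
        (θ * q (s + t) * poissonFactor θ a q (s + t)) t := by
      exact (hasDerivAt_poissonFactor (θ := θ) (a := a) hq (s + t)).comp_const_add s t
    refine (h1.mul h2).congr_deriv ?_
    ring
  have hexp : Tendsto (fun t : ℝ => Real.exp (-(θ * t))) atTop (𝓝 0) :=
    Real.tendsto_exp_neg_atTop_nhds_zero.comp (tendsto_id.const_mul_atTop hθ)
  have hlim : Tendsto (fun t => -Real.exp (-(θ * t)) * poissonFactor θ a q (s + t)) atTop (𝓝 0) := by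
    refine squeeze_zero_norm (fun t => ?_) hexp
    rw [norm_mul, norm_neg, Real.norm_eq_abs, Real.norm_eq_abs, abs_of_pos (Real.exp_pos _),
      abs_of_nonneg (hpm _).1]
    exact mul_le_of_le_one_right (Real.exp_pos _).le (hpm _).2
  have hint : IntegrableOn (fun t => θ * Real.exp (-(θ * t)) *
      ((1 - q (s + t)) * poissonFactor θ a q (s + t))) (Ioi 0) := by
    have h1 : IntegrableOn (fun t => θ * Real.exp (-θ * t)) (Ioi 0) :=
      (exp_neg_integrableOn_Ioi 0 hθ).const_mul θ
    have hc : Continuous fun t => θ * Real.exp (-(θ * t)) *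
        ((1 - q (s + t)) * poissonFactor θ a q (s + t)) := by
      have := continuous_poissonFactor (θ := θ) (a := a) hq
      fun_prop
    refine Integrable.mono' h1 hc.aestronglyMeasurable (ae_of_all _ fun t => ?_)
    have e : (0 : ℝ) ≤ θ * Real.exp (-(θ * t)) := by positivity
    rw [norm_mul, Real.norm_eq_abs, Real.norm_eq_abs, abs_of_nonneg e, neg_mul,
      abs_of_nonneg (mul_nonneg (by linarith [hq1 (s + t)]) (hpm _).1)]
    exact mul_le_of_le_one_right e (mul_le_one₀ (by linarith [hq0 (s + t)]) (hpm _).1 (hpm _).2)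
  rw [integral_Ioi_of_hasDerivAt_of_tendsto' hder hint hlim]
  simp

end Exponential

/-! ### Rows of piles: independence, martingale and Borel–Cantelli bounds. -/

section Piles

set_option linter.unusedSectionVars false

variable {Ω : Type*} [MeasurableSpace Ω] {P : Measure Ω} [IsProbabilityMeasure P]
  {V : Type*} [MeasurableSpace V] {θ a : ℝ} {ν : ℕ → Measure V} {Tbar : ℕ → ℕ → Ω → ℝ}
  {Z : ℕ → ℕ → Ω → V}

/-- Independent pairs of an exponential waiting time and a position, whose law depends only on the
row. -/
structure IsPileFamily (P : Measure Ω) (θ : ℝ) (ν : ℕ → Measure V) (Tbar : ℕ → ℕ → Ω → ℝ)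
    (Z : ℕ → ℕ → Ω → V) : Prop where
  measurable_time : ∀ i j, Measurable (Tbar i j)
  measurable_pos : ∀ i j, Measurable (Z i j)
  isProbabilityMeasure : ∀ i, IsProbabilityMeasure (ν i)
  law : ∀ i j, P.map (fun ω => (Tbar i j ω, Z i j ω)) = (expMeasure θ).prod (ν i)
  indep : iIndepFun (fun (q : ℕ × ℕ) (ω : Ω) => (Tbar q.1 q.2 ω, Z q.1 q.2 ω)) P

/-- The sum of the first `j` waiting times of row `i`. -/
def arrival (Tbar : ℕ → ℕ → Ω → ℝ) (i j : ℕ) (ω : Ω) : ℝ := ∑ k ∈ Finset.range j, Tbar i k ω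

/-- The σ-algebra generated by the pairs with index in `A`. -/
abbrev pairSigma (Tbar : ℕ → ℕ → Ω → ℝ) (Z : ℕ → ℕ → Ω → V) (A : Set (ℕ × ℕ)) : MeasurableSpace Ω :=
  ⨆ q ∈ A, MeasurableSpace.comap (fun ω => (Tbar q.1 q.2 ω, Z q.1 q.2 ω)) inferInstance

theorem measurable_pair_pairSigma {A : Set (ℕ × ℕ)} {i j : ℕ} (h : (i, j) ∈ A) :
    Measurable[pairSigma Tbar Z A] fun ω => (Tbar i j ω, Z i j ω) :=
  (comap_measurable (fun ω => (Tbar i j ω, Z i j ω))).mono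
    (le_iSup₂_of_le (f := fun (q : ℕ × ℕ) (_ : q ∈ A) =>
      MeasurableSpace.comap (fun ω => (Tbar q.1 q.2 ω, Z q.1 q.2 ω)) inferInstance) (i, j) h le_rfl)
    le_rfl

theorem measurable_arrival_pairSigma {A : Set (ℕ × ℕ)} {i j : ℕ} (h : ∀ k < j, (i, k) ∈ A) :
    Measurable[pairSigma Tbar Z A] (arrival Tbar i j) :=
  Finset.measurable_sum _ fun k hk =>
    measurable_fst.comp (measurable_pair_pairSigma (h k (Finset.mem_range.1 hk)))

theorem pairSigma_le (h : IsPileFamily P θ ν Tbar Z) (A : Set (ℕ × ℕ)) :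
    pairSigma Tbar Z A ≤ ‹MeasurableSpace Ω› :=
  iSup₂_le fun q _ => ((h.measurable_time q.1 q.2).prodMk (h.measurable_pos q.1 q.2)).comap_le

theorem pairSigma_mono {A B : Set (ℕ × ℕ)} (h : A ⊆ B) :
    pairSigma Tbar Z A ≤ pairSigma Tbar Z B :=
  biSup_mono fun _ hq => h hq

theorem IsPileFamily.indepFun (h : IsPileFamily P θ ν Tbar Z) {A : Set (ℕ × ℕ)} {i j : ℕ}
    (hij : (i, j) ∉ A) {β : Type*} [MeasurableSpace β] {Y : Ω → β}
    (hY : Measurable[pairSigma Tbar Z A] Y) :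
    IndepFun Y (fun ω => (Tbar i j ω, Z i j ω)) P := by
  have h1 := indep_iSup_of_disjoint (S := A) (T := {(i, j)}) (fun q : ℕ × ℕ =>
    ((h.measurable_time q.1 q.2).prodMk (h.measurable_pos q.1 q.2)).comap_le) h.indep
    (disjoint_singleton_right.2 hij)
  rw [IndepFun_iff_Indep]
  refine indep_of_indep_of_le_right (indep_of_indep_of_le_left h1 hY.comap_le) ?_
  simp

/-- Integrating out a pair that is independent of the past. -/
theorem IsPileFamily.integral_mul (h : IsPileFamily P θ ν Tbar Z) (hθ : 0 < θ) {A : Set (ℕ × ℕ)}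
    {i j : ℕ} (hij : (i, j) ∉ A) {Y S : Ω → ℝ} (hY : Measurable[pairSigma Tbar Z A] Y)
    (hS : Measurable[pairSigma Tbar Z A] S) (hY1 : ∀ ω, |Y ω| ≤ 1) {G : ℝ × ℝ × V → ℝ}
    (hG : Measurable G) (hG1 : ∀ e, |G e| ≤ 1) :
    ∫ ω, Y ω * G (S ω, Tbar i j ω, Z i j ω) ∂P =
      ∫ ω, Y ω * ∫ e, G (S ω, e) ∂((expMeasure θ).prod (ν i)) ∂P := by
  have := isProbabilityMeasure_expMeasure hθ
  have := h.isProbabilityMeasure i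
  have hYS : Measurable[pairSigma Tbar Z A] fun ω => (Y ω, S ω) := hY.prodMk hS
  have hYSm : Measurable fun ω => (Y ω, S ω) := hYS.mono (pairSigma_le h A) le_rfl
  have hpm := (h.measurable_time i j).prodMk (h.measurable_pos i j)
  have hind := (indepFun_iff_map_prod_eq_prod_map_map hYSm.aemeasurable hpm.aemeasurable).1
    (h.indepFun hij hYS)
  rw [h.law] at hind
  set F : (ℝ × ℝ) × ℝ × V → ℝ := fun e => e.1.1 * G (e.1.2, e.2) with hF
  have hFm : Measurable F := by
    refine (measurable_fst.comp measurable_fst).mul (hG.comp ?_)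
    exact (measurable_snd.comp measurable_fst).prodMk measurable_snd
  have e1 : ∫ ω, Y ω * G (S ω, Tbar i j ω, Z i j ω) ∂P =
      ∫ e, F e ∂(P.map fun ω => ((Y ω, S ω), (Tbar i j ω, Z i j ω))) :=
    (integral_map (hYSm.prodMk hpm).aemeasurable hFm.aestronglyMeasurable).symm
  have hFi : Integrable F ((P.map fun ω => (Y ω, S ω)).prod ((expMeasure θ).prod (ν i))) := by
    rw [← hind, integrable_map_measure hFm.aestronglyMeasurable (hYSm.prodMk hpm).aemeasurable]
    refine Integrable.of_bound (hFm.comp (hYSm.prodMk hpm)).aestronglyMeasurable 1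
      (ae_of_all _ fun ω => ?_)
    simp only [Function.comp_apply, hF, norm_mul]
    exact mul_le_one₀ (hY1 ω) (norm_nonneg _) (hG1 _)
  have hYSp : IsProbabilityMeasure (P.map fun ω => (Y ω, S ω)) :=
    Measure.isProbabilityMeasure_map hYSm.aemeasurable
  rw [e1, hind, integral_prod F hFi]
  rw [integral_map hYSm.aemeasurable
    (hFm.stronglyMeasurable.integral_prod_right').aestronglyMeasurable]
  simp only [hF]
  exact integral_congr_ae (ae_of_all _ fun ω => integral_const_mul _ _)

variable {F : ℝ → V → ℝ}

/-- The product of the weights `exp (-F)` over the first `m` piles of row `i`. -/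
def rowFactor (F : ℝ → V → ℝ) (Tbar : ℕ → ℕ → Ω → ℝ) (Z : ℕ → ℕ → Ω → V) (i m : ℕ) (ω : Ω) : ℝ :=
  Real.exp (-∑ j ∈ Finset.range m, F (arrival Tbar i (j + 1) ω) (Z i j ω))

theorem rowFactor_mem (hF0 : ∀ s v, 0 ≤ F s v) (i m : ℕ) (ω : Ω) :
    0 ≤ rowFactor F Tbar Z i m ω ∧ rowFactor F Tbar Z i m ω ≤ 1 :=
  exp_neg_sum_mem fun _ _ => hF0 _ _

theorem measurable_rowFactor_pairSigma (hF : Measurable (Function.uncurry F)) {A : Set (ℕ × ℕ)}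
    {i m : ℕ} (h : ∀ k < m, (i, k) ∈ A) :
    Measurable[pairSigma Tbar Z A] (rowFactor F Tbar Z i m) := by
  refine Measurable.exp (Measurable.neg (Finset.measurable_sum _ fun j hj => ?_))
  have hj' := Finset.mem_range.1 hj
  have h1 : Measurable[pairSigma Tbar Z A] fun ω => (arrival Tbar i (j + 1) ω, Z i j ω) :=
    (measurable_arrival_pairSigma fun k hk => h k (by omega)).prodMk
      (measurable_snd.comp (measurable_pair_pairSigma (h j hj')))
  exact hF.comp h1

/-- The probability that a pile of row `i` that starts at time `s` is counted. -/
def rowRate (F : ℝ → V → ℝ) (ν : ℕ → Measure V) (i : ℕ) (s : ℝ) : ℝ :=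
  ∫ v, (1 - Real.exp (-F s v)) ∂ν i

theorem exp_neg_mem {x : ℝ} (hx : 0 ≤ x) : 0 ≤ Real.exp (-x) ∧ Real.exp (-x) ≤ 1 :=
  ⟨(Real.exp_pos _).le, Real.exp_le_one_iff.2 (by linarith)⟩

theorem rowRate_mem (hF0 : ∀ s v, 0 ≤ F s v) (i : ℕ) [IsProbabilityMeasure (ν i)] (s : ℝ) :
    0 ≤ rowRate F ν i s ∧ rowRate F ν i s ≤ 1 := by
  have h := fun v => exp_neg_mem (hF0 s v)
  refine ⟨integral_nonneg fun v => sub_nonneg.2 (h v).2, ?_⟩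
  refine (le_abs_self _).trans ?_
  rw [← Real.norm_eq_abs]
  refine (norm_integral_le_of_norm_le_const (C := 1) (ae_of_all _ fun v => ?_)).trans (by simp)
  rw [Real.norm_eq_abs, abs_le]
  constructor <;> linarith [(h v).1, (h v).2]

theorem rowRate_eq_zero (hFa : ∀ s v, a ≤ s → F s v = 0) (i : ℕ) {s : ℝ} (hs : a ≤ s) :
    rowRate F ν i s = 0 := by
  simp [rowRate, hFa s _ hs]

/-- The row martingale. -/
theorem IsPileFamily.integral_mul_rowFactor (h : IsPileFamily P θ ν Tbar Z) (hθ : 0 < θ)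
    (hF : Measurable (Function.uncurry F)) (hF0 : ∀ s v, 0 ≤ F s v)
    (hFa : ∀ s v, a ≤ s → F s v = 0) {i : ℕ} (hq : Continuous (rowRate F ν i))
    {A : Set (ℕ × ℕ)} (hA : ∀ q ∈ A, q.1 ≠ i) {Y : Ω → ℝ} (hY : Measurable[pairSigma Tbar Z A] Y)
    (hY1 : ∀ ω, |Y ω| ≤ 1) (m : ℕ) :
    ∫ ω, Y ω * (rowFactor F Tbar Z i m ω *
        poissonFactor θ a (rowRate F ν i) (arrival Tbar i m ω)) ∂P =
      (∫ ω, Y ω ∂P) * poissonFactor θ a (rowRate F ν i) 0 := by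
  have := isProbabilityMeasure_expMeasure hθ
  have := h.isProbabilityMeasure i
  have hpm := poissonFactor_mem (θ := θ) hθ (fun s => (rowRate_mem (ν := ν) hF0 i s).1)
    fun s hs => rowRate_eq_zero (ν := ν) hFa i hs
  have hpc := continuous_poissonFactor (θ := θ) (a := a) hq
  induction m with
  | zero => simp [rowFactor, arrival, integral_mul_const]
  | succ m ih =>
    rw [← ih]
    -- Pile m is integrated out given the pairs in `A` and the earlier piles of row i; the renewal
    -- equation then returns the Poisson factor at the previous arrival.
    set G : ℝ × ℝ × V → ℝ := fun e => Real.exp (-F (e.1 + e.2.1) e.2.2) *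
      poissonFactor θ a (rowRate F ν i) (e.1 + e.2.1) with hG
    have hsum : Measurable fun e : ℝ × ℝ × V => e.1 + e.2.1 :=
      measurable_fst.add (measurable_fst.comp measurable_snd)
    have hGm : Measurable G := by
      refine Measurable.mul (Measurable.exp (Measurable.neg ?_)) (hpc.measurable.comp hsum)
      exact hF.comp (hsum.prodMk (measurable_snd.comp measurable_snd))
    have hG1 : ∀ e, |G e| ≤ 1 := fun e => by
      have h1 := exp_neg_mem (hF0 (e.1 + e.2.1) e.2.2)
      have h2 := hpm (e.1 + e.2.1)
      simp only [hG]
      rw [abs_of_nonneg (mul_nonneg h1.1 h2.1)]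
      exact mul_le_one₀ h1.2 h2.1 h2.2
    set B : Set (ℕ × ℕ) := A ∪ {q | q.1 = i ∧ q.2 < m} with hB
    have hiB : (i, m) ∉ B := by
      rintro (hmem | hmem)
      · exact hA _ hmem rfl
      · exact lt_irrefl _ hmem.2
    have hkB : ∀ k < m, (i, k) ∈ B := fun k hk => Or.inr ⟨rfl, hk⟩
    have hYB : Measurable[pairSigma Tbar Z B] fun ω => Y ω * rowFactor F Tbar Z i m ω :=
      (hY.mono (pairSigma_mono subset_union_left) le_rfl).mul (measurable_rowFactor_pairSigma hF hkB)
    have hY1' : ∀ ω, |Y ω * rowFactor F Tbar Z i m ω| ≤ 1 := fun ω => by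
      have := rowFactor_mem (Tbar := Tbar) (Z := Z) hF0 i m ω
      rw [abs_mul, abs_of_nonneg this.1]
      exact mul_le_one₀ (hY1 ω) this.1 this.2
    have key := h.integral_mul hθ hiB hYB (measurable_arrival_pairSigma hkB) hY1' hGm hG1
    have e1 : ∀ ω, Y ω * (rowFactor F Tbar Z i (m + 1) ω *
        poissonFactor θ a (rowRate F ν i) (arrival Tbar i (m + 1) ω)) =
        (Y ω * rowFactor F Tbar Z i m ω) * G (arrival Tbar i m ω, Tbar i m ω, Z i m ω) := by
      intro ω
      have e2 : arrival Tbar i (m + 1) ω = arrival Tbar i m ω + Tbar i m ω :=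
        Finset.sum_range_succ _ _
      simp only [hG, rowFactor, Finset.sum_range_succ, neg_add, Real.exp_add, e2]
      ring
    have e3 : ∀ s, ∫ e, G (s, e) ∂((expMeasure θ).prod (ν i)) =
        poissonFactor θ a (rowRate F ν i) s := by
      intro s
      have hGs : Integrable (fun e => G (s, e)) ((expMeasure θ).prod (ν i)) :=
        Integrable.of_bound (hGm.comp measurable_prodMk_left).aestronglyMeasurable 1
          (ae_of_all _ fun e => hG1 _)
      rw [integral_prod _ hGs, ← integral_poissonFactor (a := a) hθ hq
        (fun s => (rowRate_mem (ν := ν) hF0 i s).1) (fun s => (rowRate_mem (ν := ν) hF0 i s).2)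
        (fun s hs => rowRate_eq_zero (ν := ν) hFa i hs) s]
      refine integral_congr_ae (ae_of_all _ fun t => ?_)
      simp only [hG, integral_mul_const]
      congr 1
      have hFs : Measurable fun v => F (s + t) v := hF.comp measurable_prodMk_left
      have hi : Integrable (fun v => Real.exp (-F (s + t) v)) (ν i) := by
        refine Integrable.of_bound hFs.neg.exp.aestronglyMeasurable 1 (ae_of_all _ fun v => ?_)
        have := exp_neg_mem (hF0 (s + t) v)
        rw [Real.norm_eq_abs, abs_of_nonneg this.1]; exact this.2
      rw [rowRate, integral_sub (integrable_const 1) hi]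
      simp
    simp only [e1]
    rw [key]
    simp only [e3, mul_assoc]

/-- Several rows at once. -/
theorem IsPileFamily.integral_prod_rowFactor (h : IsPileFamily P θ ν Tbar Z) (hθ : 0 < θ)
    (hF : Measurable (Function.uncurry F)) (hF0 : ∀ s v, 0 ≤ F s v)
    (hFa : ∀ s v, a ≤ s → F s v = 0) (hq : ∀ i, Continuous (rowRate F ν i)) (n m : ℕ) :
    ∫ ω, ∏ i ∈ Finset.range n, (rowFactor F Tbar Z i m ω *
        poissonFactor θ a (rowRate F ν i) (arrival Tbar i m ω)) ∂P =
      ∏ i ∈ Finset.range n, poissonFactor θ a (rowRate F ν i) 0 := by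
  have hpm := fun i => poissonFactor_mem (θ := θ) (q := rowRate F ν i) hθ
    (fun s => by have := h.isProbabilityMeasure i; exact (rowRate_mem (ν := ν) hF0 i s).1)
    fun s hs => rowRate_eq_zero (ν := ν) hFa i hs
  induction n with
  | zero => simp
  | succ n ih =>
    rw [Finset.prod_range_succ, ← ih]
    simp only [Finset.prod_range_succ]
    -- The product over the rows before n plays the role of the independent factor `Y`, so rows are
    -- removed one at a time.
    refine h.integral_mul_rowFactor hθ hF hF0 hFa (hq n) (A := {q | q.1 < n})
      (fun q hq => ne_of_lt hq) ?_ (fun ω => ?_) m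
    · refine Finset.measurable_prod _ fun i hi => ?_
      have hi' : ∀ k < m, (i, k) ∈ {q : ℕ × ℕ | q.1 < n} := fun k _ => Finset.mem_range.1 hi
      exact (measurable_rowFactor_pairSigma hF hi').mul
        ((continuous_poissonFactor (hq i)).measurable.comp (measurable_arrival_pairSigma hi'))
    · rw [Finset.abs_prod]
      refine Finset.prod_le_one (fun _ _ => abs_nonneg _) fun i _ => ?_
      have h1 := rowFactor_mem (Tbar := Tbar) (Z := Z) hF0 i m ω
      have h2 := hpm i (arrival Tbar i m ω)
      rw [abs_of_nonneg (mul_nonneg h1.1 h2.1)]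
      exact mul_le_one₀ h1.2 h2.1 h2.2

theorem IsPileFamily.ae_nonneg (h : IsPileFamily P θ ν Tbar Z) (hθ : 0 < θ) :
    ∀ᵐ ω ∂P, ∀ i j, 0 ≤ Tbar i j ω := by
  have := isProbabilityMeasure_expMeasure hθ
  refine ae_all_iff.2 fun i => ae_all_iff.2 fun j => ?_
  have := h.isProbabilityMeasure i
  have hmap : P.map (Tbar i j) = expMeasure θ := by
    have h1 : P.map (Tbar i j) = (P.map fun ω => (Tbar i j ω, Z i j ω)).map Prod.fst := by
      rw [Measure.map_map measurable_fst ((h.measurable_time i j).prodMk (h.measurable_pos i j))]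
      rfl
    rw [h1, h.law]
    exact measurePreserving_fst.map_eq
  have h2 : P (Tbar i j ⁻¹' Iio 0) = 0 := by
    rw [← Measure.map_apply (h.measurable_time i j) measurableSet_Iio, hmap, expMeasure_Iio_zero hθ]
  filter_upwards [measure_eq_zero_iff_ae_notMem.1 h2] with ω hω
  exact not_lt.1 hω

theorem measurable_arrival (h : IsPileFamily P θ ν Tbar Z) (i j : ℕ) :
    Measurable (arrival Tbar i j) :=
  Finset.measurable_sum _ fun k _ => h.measurable_time i k

/-- The past up to pile `j` of row `i` is independent of that pile. -/
theorem IsPileFamily.measure_arrival_le_inter (h : IsPileFamily P θ ν Tbar Z) (i j : ℕ)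
    (t : ℝ) {B : Set (ℝ × V)} (hB : MeasurableSet B) :
    P ({ω | arrival Tbar i j ω ≤ t} ∩ {ω | (Tbar i j ω, Z i j ω) ∈ B}) =
      P {ω | arrival Tbar i j ω ≤ t} * (expMeasure θ).prod (ν i) B := by
  have h1 := (h.indepFun (A := {q | q.1 = i ∧ q.2 < j}) (i := i) (j := j)
    (fun hmem => lt_irrefl _ hmem.2) (measurable_arrival_pairSigma (Tbar := Tbar) (Z := Z)
      fun k hk => ⟨rfl, hk⟩)).measure_inter_preimage_eq_mul _ _ (measurableSet_Iic (a := t)) hB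
  rw [← h.law i j, Measure.map_apply ((h.measurable_time i j).prodMk (h.measurable_pos i j)) hB]
  exact h1

/-- A sum of nonnegative waiting times is at most t only if each of them is; independence gives
geometric decay in j. -/
theorem IsPileFamily.measure_arrival_le (h : IsPileFamily P θ ν Tbar Z) (hθ : 0 < θ) (i j : ℕ)
    {t : ℝ} : P {ω | arrival Tbar i j ω ≤ t} ≤ expMeasure θ (Iic t) ^ j := by
  have := isProbabilityMeasure_expMeasure hθ
  have := h.isProbabilityMeasure i
  induction j with
  | zero => simpa using prob_le_one
  | succ j ih =>
    have hB : MeasurableSet (Iic t ×ˢ (univ : Set V)) := measurableSet_Iic.prod MeasurableSet.univ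
    have h1 := h.measure_arrival_le_inter i j t hB
    rw [Measure.prod_prod, measure_univ, mul_one] at h1
    have h2 : P {ω | arrival Tbar i (j + 1) ω ≤ t} ≤
        P ({ω | arrival Tbar i j ω ≤ t} ∩ {ω | (Tbar i j ω, Z i j ω) ∈ Iic t ×ˢ (univ : Set V)}) := by
      refine measure_mono_ae ?_
      filter_upwards [h.ae_nonneg hθ] with ω hω hle
      have e2 : arrival Tbar i (j + 1) ω = arrival Tbar i j ω + Tbar i j ω :=
        Finset.sum_range_succ _ _
      have e3 : 0 ≤ arrival Tbar i j ω := Finset.sum_nonneg fun k _ => hω i k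
      have hle' : arrival Tbar i (j + 1) ω ≤ t := hle
      have e4 := hω i j
      exact ⟨show arrival Tbar i j ω ≤ t by linarith, show Tbar i j ω ≤ t by linarith, mem_univ _⟩
    calc P {ω | arrival Tbar i (j + 1) ω ≤ t}
        ≤ P {ω | arrival Tbar i j ω ≤ t} * expMeasure θ (Iic t) := h2.trans h1.le
      _ ≤ expMeasure θ (Iic t) ^ j * expMeasure θ (Iic t) := by gcongr
      _ = _ := (pow_succ _ _).symm

theorem tsum_expMeasure_pow_lt_top (hθ : 0 < θ) (t : ℝ) :
    ∑' j : ℕ, expMeasure θ (Iic t) ^ j < ∞ := by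
  rw [ENNReal.tsum_geometric, ENNReal.inv_lt_top, tsub_pos_iff_lt]
  exact expMeasure_Iic_lt_one hθ t

theorem IsPileFamily.ae_eventually_lt_arrival (h : IsPileFamily P θ ν Tbar Z) (hθ : 0 < θ) (t : ℝ) :
    ∀ᵐ ω ∂P, ∀ i, ∀ᶠ j in atTop, t < arrival Tbar i j ω := by
  refine ae_all_iff.2 fun i => ?_
  have h1 : ∑' j, P {ω | arrival Tbar i j ω ≤ t} ≠ ∞ :=
    ((ENNReal.tsum_le_tsum fun j => h.measure_arrival_le hθ i j).trans_lt
      (tsum_expMeasure_pow_lt_top hθ t)).ne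
  filter_upwards [ae_eventually_notMem h1] with ω hω
  exact hω.mono fun j hj => not_le.1 hj

end Piles

end REPP

end

noncomputable section

namespace REPP

/-! ### The process of piles -/

section PileProcess

set_option linter.unusedSectionVars false

theorem isRadonPointMeasure_sum_dirac {E : Type*} [TopologicalSpace E] [MeasurableSpace E]
    [T2Space E] [BorelSpace E] {ι : Type*} [Denumerable ι] (x : ι → E)
    (hx : ∀ K : Set E, IsCompact K → {i | x i ∈ K}.Finite) :
    IsRadonPointMeasure (Measure.sum fun i => Measure.dirac (x i)) := by
  refine ⟨fun K hK => ?_, univ, fun k => x ((Denumerable.eqv ι).symm k), ?_⟩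
  · have hKm := hK.isClosed.measurableSet
    rw [Measure.sum_apply _ hKm]
    simp_rw [Measure.dirac_apply' _ hKm]
    rw [tsum_eq_sum (s := (hx K hK).toFinset)]
    · refine ENNReal.sum_lt_top.2 fun j _ => ?_
      exact lt_of_le_of_lt (indicator_apply_le' (fun _ => le_rfl) fun _ => zero_le_one)
        ENNReal.one_lt_top
    · intro i hi
      refine indicator_of_notMem (fun hmem => hi ?_) _
      simpa using hmem
  · ext s hs
    rw [Measure.sum_apply _ hs, Measure.sum_apply _ hs]
    exact (((Equiv.Set.univ ℕ).trans (Denumerable.eqv ι).symm).tsum_eq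
      (fun i => Measure.dirac (x i) s)).symm

variable {Ω : Type*} [MeasurableSpace Ω] {P : Measure Ω} [IsProbabilityMeasure P] {d : ℕ}
  {θ a : ℝ} {ν : ℕ → Measure (EuclideanSpace ℝ (Fin d))} {Tbar : ℕ → ℕ → Ω → ℝ}
  {Z : ℕ → ℕ → Ω → EuclideanSpace ℝ (Fin d)}
  {L : EuclideanSpace ℝ (Fin d) →ₗ[ℝ] EuclideanSpace ℝ (Fin d)}

/-- The point of pile `(i, j)` at level `ℓ`, where `q = (i, j, ℓ)`. -/
def pilePoint (L : EuclideanSpace ℝ (Fin d) →ₗ[ℝ] EuclideanSpace ℝ (Fin d))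
    (Tbar : ℕ → ℕ → Ω → ℝ) (Z : ℕ → ℕ → Ω → EuclideanSpace ℝ (Fin d)) (ω : Ω) (q : ℕ × ℕ × ℕ) :
    ℝ≥0 × ℝ≥0 :=
  ((arrival Tbar q.1 (q.2.1 + 1) ω).toNNReal, ballVol ((L ^ q.2.2) (Z q.1 q.2.1 ω)))

/-- Borel–Cantelli: since the row laws add up to Lebesgue measure, the sum of the probabilities is
at most a geometric series times the mean number of ball visits. Only waiting times before that of
pile j are used, so the time is independent of the position. -/
theorem IsPileFamily.ae_finite (h : IsPileFamily P θ ν Tbar Z) (hθ : 0 < θ)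
    (hν : Measure.sum ν = volume) (hL : 1 < |LinearMap.det L|) (t R : ℝ) :
    ∀ᵐ ω ∂P, {q : ℕ × ℕ × ℕ | arrival Tbar q.1 q.2.1 ω ≤ t ∧
      ‖(L ^ q.2.2) (Z q.1 q.2.1 ω)‖ ≤ R}.Finite := by
  have := isProbabilityMeasure_expMeasure hθ
  set B : ℕ → Set (EuclideanSpace ℝ (Fin d)) := fun ℓ =>
    (fun v => (L ^ ℓ) v) ⁻¹' Metric.closedBall 0 R with hB
  have hBm : ∀ ℓ, MeasurableSet (B ℓ) := fun ℓ =>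
    measurable_pow_apply ℓ Metric.isClosed_closedBall.measurableSet
  let s : ℕ × ℕ × ℕ → Set Ω := fun q => {ω | arrival Tbar q.1 q.2.1 ω ≤ t} ∩
    {ω | (Tbar q.1 q.2.1 ω, Z q.1 q.2.1 ω) ∈ (univ : Set ℝ) ×ˢ B q.2.2}
  have hs : ∀ i j ℓ, P (s (i, j, ℓ)) ≤ expMeasure θ (Iic t) ^ j * ν i (B ℓ) := by
    intro i j ℓ
    have := h.isProbabilityMeasure i
    have h1 := h.measure_arrival_le_inter i j t (MeasurableSet.univ.prod (hBm ℓ))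
    rw [Measure.prod_prod, measure_univ, one_mul] at h1
    refine h1.le.trans ?_
    gcongr
    exact h.measure_arrival_le hθ i j
  have hsum : ∑' q, P (s q) ≠ ∞ := by
    have h1 : ∑' q, P (s q) ≤ ∑' i, ∑' j, ∑' ℓ, expMeasure θ (Iic t) ^ j * ν i (B ℓ) := by
      rw [ENNReal.tsum_prod']
      refine ENNReal.tsum_le_tsum fun i => ?_
      rw [ENNReal.tsum_prod']
      exact ENNReal.tsum_le_tsum fun j => ENNReal.tsum_le_tsum fun ℓ => hs i j ℓ
    have h2 : ∑' i, ∑' j, ∑' ℓ, expMeasure θ (Iic t) ^ j * ν i (B ℓ) =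
        (∑' j : ℕ, expMeasure θ (Iic t) ^ j) * ∫⁻ v, ballVisits L R v := by
      simp_rw [ENNReal.tsum_mul_left, ENNReal.tsum_mul_right, ENNReal.tsum_mul_left]
      rw [ENNReal.tsum_comm]
      congr 1
      simp only [ballVisits]
      rw [lintegral_tsum fun ℓ => (measurable_one.indicator (hBm ℓ)).aemeasurable]
      refine tsum_congr fun ℓ => ?_
      rw [lintegral_indicator_one (hBm ℓ), ← hν, Measure.sum_apply _ (hBm ℓ)]
    rw [h2] at h1
    exact (h1.trans_lt (ENNReal.mul_lt_top (tsum_expMeasure_pow_lt_top hθ t)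
      (lintegral_ballVisits_lt_top hL R))).ne
  filter_upwards [ae_finite_setOfPred_mem hsum] with ω hω
  refine hω.subset fun q hq => ⟨hq.1, mem_univ _, ?_⟩
  simpa [hB] using hq.2

theorem IsPileFamily.ae_finite_pilePoint (h : IsPileFamily P θ ν Tbar Z) (hθ : 0 < θ) (hd : 0 < d)
    (hν : Measure.sum ν = volume) (hL : 1 < |LinearMap.det L|) :
    ∀ᵐ ω ∂P, ∀ A : ℕ, {q | (pilePoint L Tbar Z ω q).1 ≤ A ∧ (pilePoint L Tbar Z ω q).2 < A}.Finite := by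
  refine ae_all_iff.2 fun A => ?_
  obtain ⟨R, hR⟩ := exists_norm_le_of_ballVol_lt hd (A : ℝ≥0)
  filter_upwards [h.ae_finite hθ hν hL A R, h.ae_nonneg hθ] with ω hω hpos
  refine hω.subset fun q hq => ⟨?_, hR _ hq.2⟩
  have h1 : arrival Tbar q.1 (q.2.1 + 1) ω ≤ A := by
    simpa using Real.toNNReal_le_iff_le_coe.1 hq.1
  have h2 : arrival Tbar q.1 (q.2.1 + 1) ω = arrival Tbar q.1 q.2.1 ω + Tbar q.1 q.2.1 ω :=
    Finset.sum_range_succ _ _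
  linarith [hpos q.1 q.2.1]

theorem measurable_pilePoint (h : IsPileFamily P θ ν Tbar Z) (hd : 0 < d) (q : ℕ × ℕ × ℕ) :
    Measurable fun ω => pilePoint L Tbar Z ω q :=
  (measurable_arrival h _ _).real_toNNReal.prodMk ((continuous_ballVol hd).measurable.comp
    ((measurable_pow_apply q.2.2).comp (h.measurable_pos _ _)))

theorem IsPileFamily.isPointProcess_pilePoint (h : IsPileFamily P θ ν Tbar Z) (hθ : 0 < θ) (hd : 0 < d)
    (hν : Measure.sum ν = volume) (hL : 1 < |LinearMap.det L|) :
    IsPointProcess P fun ω => Measure.sum fun q => Measure.dirac (pilePoint L Tbar Z ω q) := by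
  refine isPointProcess_of_measurable (Measure.measurable_of_measurable_coe _ fun s hs => ?_) ?_
  · simp_rw [Measure.sum_apply _ hs, Measure.dirac_apply' _ hs]
    exact Measurable.tsum fun q => (measurable_one.indicator hs).comp (measurable_pilePoint h hd q)
  · filter_upwards [h.ae_finite_pilePoint hθ hd hν hL] with ω hω
    refine isRadonPointMeasure_sum_dirac _ fun K hK => ?_
    obtain ⟨A₁, hA₁⟩ := (hK.image continuous_fst).bddAbove
    obtain ⟨A₂, hA₂⟩ := (hK.image continuous_snd).bddAbove
    obtain ⟨A, hA⟩ := exists_nat_gt (max A₁ A₂)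
    refine (hω A).subset fun q hq => ⟨?_, ?_⟩
    · exact (hA₁ ⟨_, hq, rfl⟩).trans ((le_max_left _ _).trans hA.le)
    · exact lt_of_le_of_lt (hA₂ ⟨_, hq, rfl⟩) ((le_max_right _ _).trans_lt hA)

variable (L) in
/-- The sum of the weights of a pile. -/
def pileSum (f : C_c(ℝ≥0 × ℝ≥0, ℝ)) (s : ℝ) (v : EuclideanSpace ℝ (Fin d)) : ℝ :=
  ∑' ℓ : ℕ, limitWeight f s ((L ^ ℓ) v)

variable {f : C_c(ℝ≥0 × ℝ≥0, ℝ)}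

theorem continuous_limitWeight_pow (hd : 0 < d) (ℓ : ℕ) :
    Continuous fun q : ℝ × EuclideanSpace ℝ (Fin d) => limitWeight f q.1 ((L ^ ℓ) q.2) :=
  (uniformContinuous_limitWeight hd f).continuous.comp (continuous_fst.prodMk
    ((LinearMap.continuous_of_finiteDimensional (L ^ ℓ)).comp continuous_snd))

theorem measurable_pileSum (hd : 0 < d) : Measurable (Function.uncurry (pileSum L f)) :=
  Measurable.tsum fun ℓ => (continuous_limitWeight_pow hd ℓ).measurable

theorem pileSum_nonneg (hf : 0 ≤ f) (s : ℝ) (v : EuclideanSpace ℝ (Fin d)) : 0 ≤ pileSum L f s v :=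
  tsum_nonneg fun _ => hf _

section Bounded

variable {R : ℝ}

theorem continuous_pileSum (hR : ∀ (s : ℝ) (v : EuclideanSpace ℝ (Fin d)),
    limitWeight f s v ≠ 0 → ‖v‖ ≤ R) (hd : 0 < d) {v : EuclideanSpace ℝ (Fin d)}
    (hv : ballVisits L R v < ∞) : Continuous fun s => pileSum L f s v := by
  have hfin := finite_of_ballVisits_lt_top hv
  have : (fun s => pileSum L f s v) = fun s => ∑ ℓ ∈ hfin.toFinset, limitWeight f s ((L ^ ℓ) v) := by
    ext s
    refine tsum_eq_sum fun ℓ hℓ => ?_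
    by_contra hne
    exact hℓ (by simpa using hR s _ hne)
  rw [this]
  exact continuous_finsetSum _ fun ℓ _ =>
    (continuous_limitWeight_pow hd ℓ).comp (Continuous.prodMk_left v)

theorem abs_one_sub_exp_pileSum_le (hR : ∀ (s : ℝ) (v : EuclideanSpace ℝ (Fin d)),
    limitWeight f s v ≠ 0 → ‖v‖ ≤ R) (hf : 0 ≤ f) (s : ℝ) {v : EuclideanSpace ℝ (Fin d)}
    (hv : ballVisits L R v < ∞) :
    |1 - Real.exp (-pileSum L f s v)| ≤ (ballVisits L R v).toReal := by
  have h1 := exp_neg_mem (pileSum_nonneg (L := L) hf s v)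
  rw [abs_of_nonneg (by linarith)]
  rcases lt_or_ge (ballVisits L R v) 1 with h | h
  · have : pileSum L f s v = 0 := by
      rw [pileSum, tsum_congr fun ℓ => eq_zero_of_ballVisits_lt_one hR h s ℓ, tsum_zero]
    simp [this]
  · have : 1 ≤ (ballVisits L R v).toReal := by
      rw [← ENNReal.toReal_one]; exact ENNReal.toReal_mono hv.ne h
    linarith

end Bounded

/-- The row laws add up to Lebesgue measure, so the row rates add up to `pileIntegral`; the partial
sums are dominated by the mean number of ball visits. -/
theorem tendsto_prod_poissonFactor (hd : 0 < d) (hν : Measure.sum ν = volume)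
    (hν1 : ∀ i, IsProbabilityMeasure (ν i))
    (hL : 1 < |LinearMap.det L|) (hf : 0 ≤ f) {R : ℝ}
    (hR : ∀ (s : ℝ) (v : EuclideanSpace ℝ (Fin d)), limitWeight f s v ≠ 0 → ‖v‖ ≤ R)
    (hq : ∀ i, Continuous (rowRate (pileSum L f) ν i)) :
    Tendsto (fun n => ∏ i ∈ Finset.range n, poissonFactor θ a (rowRate (pileSum L f) ν i) 0) atTop
      (𝓝 (Real.exp (-(θ * ∫ s in (0 : ℝ)..a, pileIntegral L (limitWeight f) s)))) := by
  have hint : ∀ s, Integrable fun v => 1 - Real.exp (-pileSum L f s v) := fun s => by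
    have hm : Measurable fun v => pileSum L f s v :=
      (measurable_pileSum hd).comp measurable_prodMk_left
    exact (integrable_ballVisits hL R).mono' (measurable_const.sub hm.neg.exp).aestronglyMeasurable
      ((ae_ballVisits_lt_top hL R).mono fun v hv => abs_one_sub_exp_pileSum_le hR hf s hv)
  have hsum : ∀ s, HasSum (fun i => rowRate (pileSum L f) ν i s)
      (pileIntegral L (limitWeight f) s) := fun s => by
    have h1 := hint s
    rw [← hν] at h1
    have h2 := hasSum_integral_measure h1
    rw [hν] at h2
    exact h2
  have hnn : ∀ i s, 0 ≤ rowRate (pileSum L f) ν i s := fun i s =>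
    (rowRate_mem (pileSum_nonneg hf) i s).1
  have hle : ∀ s, pileIntegral L (limitWeight f) s ≤ ∫ v, (ballVisits L R v).toReal := fun s =>
    (le_abs_self _).trans (norm_integral_le_of_norm_le (integrable_ballVisits hL R)
      ((ae_ballVisits_lt_top hL R).mono fun v hv => abs_one_sub_exp_pileSum_le hR hf s hv) :
        ‖∫ v, (1 - Real.exp (-pileSum L f s v))‖ ≤ _)
  have hlim : Tendsto (fun n => ∫ s in (0 : ℝ)..a, ∑ i ∈ Finset.range n,
      rowRate (pileSum L f) ν i s) atTop
      (𝓝 (∫ s in (0 : ℝ)..a, pileIntegral L (limitWeight f) s)) := by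
    refine intervalIntegral.tendsto_integral_filter_of_dominated_convergence
      (fun _ => ∫ v, (ballVisits L R v).toReal) (Eventually.of_forall fun n =>
        (continuous_finsetSum _ fun i _ => hq i).aestronglyMeasurable)
      (Eventually.of_forall fun n => ae_of_all _ fun s _ => ?_) (by simp)
      (ae_of_all _ fun s _ => (hsum s).tendsto_sum_nat)
    rw [Real.norm_eq_abs, abs_of_nonneg (Finset.sum_nonneg fun i _ => hnn i s)]
    exact (sum_le_hasSum _ (fun i _ => hnn i s) (hsum s)).trans (hle s)
  refine ((Real.continuous_exp.tendsto _).comp (hlim.const_mul θ).neg).congr fun n => ?_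
  simp only [Function.comp_apply, poissonFactor]
  rw [← Real.exp_sum, intervalIntegral.integral_finsetSum fun i _ => (hq i).intervalIntegrable _ _,
    Finset.mul_sum, Finset.sum_neg_distrib]

/-- The Laplace functional of the process of piles. -/
theorem IsPileFamily.integral_exp_neg (h : IsPileFamily P θ ν Tbar Z) (hθ : 0 < θ) (hd : 0 < d)
    (hν : Measure.sum ν = volume) (hL : 1 < |LinearMap.det L|) (hf : 0 ≤ f) {A : ℝ≥0}
    (hA : ∀ q, f q ≠ 0 → q.1 < A ∧ q.2 < A) :
    ∫ ω, Real.exp (-∫ q, f q ∂(Measure.sum fun q => Measure.dirac (pilePoint L Tbar Z ω q))) ∂P =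
      Real.exp (-(θ * ∫ s in (0 : ℝ)..A, pileIntegral L (limitWeight f) s)) := by
  obtain ⟨R, hR'⟩ := exists_norm_le_of_ballVol_lt hd A
  have hR : ∀ (s : ℝ) (v : EuclideanSpace ℝ (Fin d)), limitWeight f s v ≠ 0 → ‖v‖ ≤ R :=
    fun s v hne => hR' v (hA _ hne).2
  have hν1 := h.isProbabilityMeasure
  set F : ℝ → EuclideanSpace ℝ (Fin d) → ℝ := pileSum L f with hF
  have hFm : Measurable (Function.uncurry F) := measurable_pileSum hd
  have hF0 : ∀ s v, 0 ≤ F s v := pileSum_nonneg hf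
  have hfz : ∀ s : ℝ, ∀ v : EuclideanSpace ℝ (Fin d), (A : ℝ) ≤ s → limitWeight f s v = 0 :=
    fun s v hs => by
      by_contra hne
      exact absurd (hA _ hne).1 (not_lt.2 (NNReal.le_toNNReal_of_coe_le hs))
  have hFa : ∀ s v, (A : ℝ) ≤ s → F s v = 0 := fun s v hs => by
    rw [hF, pileSum, tsum_congr fun ℓ => hfz s _ hs, tsum_zero]
  have hFs : ∀ s, Measurable fun v => F s v := fun s => hFm.comp measurable_prodMk_left
  have hq : ∀ i, Continuous (rowRate F ν i) := fun i => by
    refine continuous_of_dominated (bound := fun _ => (1 : ℝ))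
      (fun s => (measurable_const.sub (hFs s).neg.exp).aestronglyMeasurable)
      (fun s => ae_of_all _ fun v => ?_) (integrable_const 1) ?_
    · have := exp_neg_mem (hF0 s v)
      rw [Real.norm_eq_abs, abs_le]
      constructor <;> linarith [this.1, this.2]
    -- Piles are finite sums only for Lebesgue-almost every v; this transfers to each row because
    -- its law is bounded by Lebesgue measure.
    · have hac : ν i ≪ volume := by
        rw [← hν]; exact Measure.absolutelyContinuous_of_le (Measure.le_sum _ i)
      filter_upwards [hac.ae_le (ae_ballVisits_lt_top hL R)] with v hv
      exact continuous_const.sub (Real.continuous_exp.comp (continuous_pileSum hR hd hv).neg)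
  -- all piles of finitely many rows
  have hrow : ∀ n, ∫ ω, ∏ i ∈ Finset.range n,
      Real.exp (-∑' j, F (arrival Tbar i (j + 1) ω) (Z i j ω)) ∂P =
      ∏ i ∈ Finset.range n, poissonFactor θ A (rowRate F ν i) 0 := by
    intro n
    have hpm := fun i => poissonFactor_mem (θ := θ) (q := rowRate F ν i) hθ
      (fun s => (rowRate_mem (ν := ν) hF0 i s).1) fun s hs => rowRate_eq_zero (ν := ν) hFa i hs
    have hlim : Tendsto (fun m => ∫ ω, ∏ i ∈ Finset.range n, (rowFactor F Tbar Z i m ω *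
        poissonFactor θ A (rowRate F ν i) (arrival Tbar i m ω)) ∂P) atTop
        (𝓝 (∫ ω, ∏ i ∈ Finset.range n,
          Real.exp (-∑' j, F (arrival Tbar i (j + 1) ω) (Z i j ω)) ∂P)) := by
      refine tendsto_integral_of_dominated_convergence (fun _ => 1) (fun m => ?_)
        (integrable_const 1) (fun m => ae_of_all _ fun ω => ?_) ?_
      · refine (Finset.measurable_prod _ fun i _ => ?_).aestronglyMeasurable
        have hm1 : Measurable (rowFactor F Tbar Z i m) :=
          (measurable_rowFactor_pairSigma (A := univ) hFm fun _ _ => mem_univ _).mono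
            (pairSigma_le h _) le_rfl
        exact hm1.mul ((continuous_poissonFactor (hq i)).measurable.comp (measurable_arrival h i m))
      · rw [Real.norm_eq_abs, Finset.abs_prod]
        refine Finset.prod_le_one (fun _ _ => abs_nonneg _) fun i _ => ?_
        have h1 := rowFactor_mem (Tbar := Tbar) (Z := Z) hF0 i m ω
        have h2 := hpm i (arrival Tbar i m ω)
        rw [abs_of_nonneg (mul_nonneg h1.1 h2.1)]
        exact mul_le_one₀ h1.2 h2.1 h2.2
      · filter_upwards [h.ae_eventually_lt_arrival hθ A] with ω hω
        refine tendsto_finsetProd _ fun i _ => ?_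
        -- The arrivals eventually pass `A`, where the Poisson factor equals 1, so the martingale
        -- converges to the weight of the complete row.
        have h1 : Tendsto (fun m => poissonFactor θ A (rowRate F ν i) (arrival Tbar i m ω)) atTop
            (𝓝 1) := by
          refine tendsto_const_nhds.congr' ?_
          filter_upwards [hω i] with m hm
          exact (poissonFactor_of_le (fun s hs => rowRate_eq_zero hFa i hs) hm.le).symm
        have hsum : Summable fun j => F (arrival Tbar i (j + 1) ω) (Z i j ω) := by
          obtain ⟨N, hN⟩ := eventually_atTop.1 (hω i)
          refine summable_of_hasFiniteSupport ((finite_lt_nat N).subset fun j hj => ?_)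
          by_contra hcon
          exact hj (hFa _ _ (hN (j + 1) (by have : ¬j < N := hcon; omega)).le)
        have h2 := ((Real.continuous_exp.tendsto _).comp hsum.hasSum.tendsto_sum_nat.neg).mul h1
        rw [mul_one] at h2
        exact h2
    refine tendsto_nhds_unique hlim ?_
    simp only [h.integral_prod_rowFactor hθ hFm hF0 hFa hq n]
    exact tendsto_const_nhds
  -- all rows
  have hall : Tendsto (fun n => ∫ ω, ∏ i ∈ Finset.range n,
      Real.exp (-∑' j, F (arrival Tbar i (j + 1) ω) (Z i j ω)) ∂P) atTop
      (𝓝 (∫ ω, Real.exp (-∫ q, f q ∂(Measure.sum fun q =>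
        Measure.dirac (pilePoint L Tbar Z ω q))) ∂P)) := by
    refine tendsto_integral_of_dominated_convergence (fun _ => 1) (fun n => ?_)
      (integrable_const 1) (fun n => ae_of_all _ fun ω => ?_) ?_
    · refine (Finset.measurable_prod _ fun i _ => ?_).aestronglyMeasurable
      exact (Measurable.tsum fun j =>
        hFm.comp ((measurable_arrival h i (j + 1)).prodMk (h.measurable_pos i j))).neg.exp
    · rw [Real.norm_eq_abs, Finset.abs_prod]
      refine Finset.prod_le_one (fun _ _ => abs_nonneg _) fun i _ => ?_
      have h1 := exp_neg_mem (x := ∑' j, F (arrival Tbar i (j + 1) ω) (Z i j ω))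
        (tsum_nonneg fun j => hF0 _ _)
      rw [abs_of_nonneg h1.1]; exact h1.2
    · filter_upwards [h.ae_finite_pilePoint hθ hd hν hL] with ω hω
      obtain ⟨A', hA'⟩ := exists_nat_gt A
      rw [integral_sum_dirac _ (map_continuous f) fun q => hf q]
      have hsum : Summable fun q => f (pilePoint L Tbar Z ω q) :=
        summable_of_hasFiniteSupport ((hω A').subset fun q hq =>
          ⟨((hA _ hq).1.trans hA').le, (hA _ hq).2.trans hA'⟩)
      have e1 : ∀ i, ∑' q : ℕ × ℕ, f (pilePoint L Tbar Z ω (i, q)) =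
          ∑' j, F (arrival Tbar i (j + 1) ω) (Z i j ω) := fun i =>
        (hsum.prod_factor i).tsum_prod
      have h2 := hsum.prod.hasSum.tendsto_sum_nat
      rw [← hsum.tsum_prod] at h2
      refine ((Real.continuous_exp.tendsto _).comp h2.neg).congr fun n => ?_
      simp only [Function.comp_apply, e1]
      rw [← Real.exp_sum, Finset.sum_neg_distrib]
  refine tendsto_nhds_unique hall ?_
  simp only [hrow]
  exact tendsto_prod_poissonFactor hd hν hν1 hL hf hR hq

end PileProcess

end REPP

end

noncomputable section

namespace REPP

/-! ### Polar coordinates -/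

section Polar

set_option linter.unusedSectionVars false

variable {d : ℕ} {S : Type*} [MeasurableSpace S] {κ : Measure S}
  {vec : S → EuclideanSpace ℝ (Fin d)}

/-- The vector of direction `vec e.2` such that the ball it spans has volume `e.1`. -/
def polarPos (vec : S → EuclideanSpace ℝ (Fin d)) (e : ℝ × S) : EuclideanSpace ℝ (Fin d) :=
  (e.1 / volume.real (Metric.ball (0 : EuclideanSpace ℝ (Fin d)) 1)) ^ (1 / (d : ℝ)) • vec e.2

/-- `vec` has the uniform law on the unit sphere, in the sense that integrals can be computed in
polar coordinates. -/
def IsPolarLaw (κ : Measure S) (vec : S → EuclideanSpace ℝ (Fin d)) : Prop :=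
  ∀ g : EuclideanSpace ℝ (Fin d) → ℝ≥0∞, Measurable g →
    ∫⁻ σ, (∫⁻ r in Ioi (0 : ℝ), ENNReal.ofReal
      (volume.real (Metric.ball (0 : EuclideanSpace ℝ (Fin d)) 1) * (d * r ^ (d - 1))) *
        g (r • vec σ)) ∂κ = ∫⁻ v, g v

theorem measurable_polarPos (hvec : Measurable vec) : Measurable (polarPos vec) := by
  unfold polarPos
  fun_prop

/-- The substitution w = c r^d: for c the volume of the unit ball, w is the volume of the ball of
radius r. -/
theorem lintegral_Ioi_rpow_div (hd : d ≠ 0) {c : ℝ} (hc : 0 < c) (G : ℝ → ℝ≥0∞) :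
    ∫⁻ w in Ioi (0 : ℝ), G ((w / c) ^ (1 / (d : ℝ))) =
      ∫⁻ r in Ioi (0 : ℝ), ENNReal.ofReal (c * (d * r ^ (d - 1))) * G r := by
  have himg : (fun r : ℝ => c * r ^ d) '' Ioi 0 = Ioi 0 := by
    ext w
    refine ⟨?_, fun hw => ⟨(w / c) ^ (1 / (d : ℝ)), ?_, ?_⟩⟩
    · rintro ⟨r, hr, rfl⟩
      exact mul_pos hc (pow_pos hr d)
    · exact Real.rpow_pos_of_pos (div_pos hw hc) _
    · simp only [one_div]
      rw [Real.rpow_inv_natCast_pow (div_pos hw hc).le hd, mul_div_cancel₀ _ hc.ne']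
  have hinj : InjOn (fun r : ℝ => c * r ^ d) (Ioi 0) := fun r hr s hs hrs =>
    (pow_left_inj₀ (le_of_lt hr) (le_of_lt hs) hd).1 (mul_left_cancel₀ hc.ne' hrs)
  have h := lintegral_image_eq_lintegral_abs_deriv_mul (s := Ioi (0 : ℝ))
    (f' := fun r => c * (d * r ^ (d - 1))) measurableSet_Ioi
    (fun r _ => ((hasDerivAt_pow d r).const_mul c).hasDerivWithinAt) hinj
    (fun w => G ((w / c) ^ (1 / (d : ℝ))))
  rw [himg] at h
  rw [h]
  refine setLIntegral_congr_fun measurableSet_Ioi fun r hr => ?_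
  have hr0 : 0 ≤ r := le_of_lt hr
  simp only [one_div]
  rw [abs_of_nonneg (by positivity), mul_div_cancel_left₀ _ hc.ne',
    Real.pow_rpow_inv_natCast hr0 hd]

theorem IsPolarLaw.map_polarPos [SFinite κ] (h : IsPolarLaw κ vec) (hd : 0 < d)
    (hvec : Measurable vec) :
    Measure.map (polarPos vec) (((volume : Measure ℝ).restrict (Ioi 0)).prod κ) = volume := by
  refine Measure.ext_of_lintegral _ fun g hg => ?_
  rw [lintegral_map hg (measurable_polarPos hvec),
    lintegral_prod_symm' (fun e => g (polarPos vec e)) (hg.comp (measurable_polarPos hvec)), ← h g hg]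
  exact lintegral_congr fun σ =>
    lintegral_Ioi_rpow_div hd.ne' (unitBall_pos d) fun r => g (r • vec σ)

theorem Ioi_zero_eq_iUnion_Ioc : Ioi (0 : ℝ) = ⋃ i : ℕ, Ioc (i : ℝ) (i + 1) := by
  ext x
  simp only [mem_Ioi, mem_iUnion, mem_Ioc]
  refine ⟨fun hx => ?_, fun ⟨i, hi, _⟩ => lt_of_le_of_lt i.cast_nonneg hi⟩
  have hpos := Nat.ceil_pos.2 hx
  refine ⟨⌈x⌉₊ - 1, ?_, ?_⟩
  · exact Nat.lt_ceil.1 (Nat.sub_lt hpos one_pos)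
  · rw [Nat.cast_pred hpos, sub_add_cancel]
    exact Nat.le_ceil x

theorem sum_restrict_Ioc_natCast :
    Measure.sum (fun i : ℕ => (volume : Measure ℝ).restrict (Ioc (i : ℝ) (i + 1))) =
      volume.restrict (Ioi 0) := by
  rw [Ioi_zero_eq_iUnion_Ioc, Measure.restrict_iUnion _ fun i => measurableSet_Ioc]
  intro i j hij
  have := pairwise_disjoint_Ioc_intCast ℝ (show (i : ℤ) ≠ j by exact_mod_cast hij)
  simpa [Function.onFun] using this

variable {Ω : Type*} [MeasurableSpace Ω] {P : Measure Ω} [IsProbabilityMeasure P] {θ : ℝ}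
  {Tbar U : ℕ → ℕ → Ω → ℝ} {D : ℕ → ℕ → Ω → S}

/-- The law of the bottom points of the piles of row `i`. -/
def rowLaw (κ : Measure S) (vec : S → EuclideanSpace ℝ (Fin d)) (i : ℕ) :
    Measure (EuclideanSpace ℝ (Fin d)) :=
  Measure.map (polarPos vec) (((volume : Measure ℝ).restrict (Ioc (i : ℝ) (i + 1))).prod κ)

/-- The intervals (i, i + 1] tile the half-line of ball volumes, so together the rows cover the
whole space in polar coordinates. -/
theorem IsPolarLaw.sum_rowLaw [SFinite κ] (h : IsPolarLaw κ vec) (hd : 0 < d)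
    (hvec : Measurable vec) : Measure.sum (rowLaw κ vec) = volume := by
  rw [← h.map_polarPos hd hvec, ← sum_restrict_Ioc_natCast, Measure.prod_sum_left,
    Measure.map_sum (measurable_polarPos hvec).aemeasurable]
  rfl

theorem IsMarkFamily.isPileFamily [IsProbabilityMeasure κ] (h : IsMarkFamily P θ κ Tbar U D)
    (hvec : Measurable vec) :
    IsPileFamily P θ (rowLaw κ vec) Tbar fun i j ω => polarPos vec (U i j ω, D i j ω) := by
  have hpm := measurable_polarPos hvec
  have hprob : ∀ i : ℕ, IsProbabilityMeasure
      ((volume : Measure ℝ).restrict (Ioc (i : ℝ) (i + 1))) := fun i =>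
    ⟨by simp⟩
  have hUD : ∀ i j, Measurable fun ω => (U i j ω, D i j ω) := fun i j =>
    (h.measurable_unif i j).prodMk (h.measurable_dir i j)
  have hlaw : ∀ i j, P.map (fun ω => (U i j ω, D i j ω)) =
      ((volume : Measure ℝ).restrict (Ioc (i : ℝ) (i + 1))).prod κ := by
    intro i j
    rw [(indepFun_iff_map_prod_eq_prod_map_map (h.measurable_unif i j).aemeasurable
      (h.measurable_dir i j).aemeasurable).1 (h.indep_dir i j), h.law_dir i j]
    congr 1
    rw [show P.map (U i j) = ProbabilityTheory.cond volume (Ioc (i : ℝ) (i + 1)) from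
      h.law_unif i j, ProbabilityTheory.cond]
    simp
  refine ⟨h.measurable_time, fun i j => hpm.comp (hUD i j), fun i => ?_, fun i j => ?_, ?_⟩
  · exact Measure.isProbabilityMeasure_map hpm.aemeasurable
  · have hind : IndepFun (Tbar i j) (fun ω => polarPos vec (U i j ω, D i j ω)) P :=
      (h.indep_time i j).comp measurable_id hpm
    rw [(indepFun_iff_map_prod_eq_prod_map_map (h.measurable_time i j).aemeasurable
      (show Measurable fun ω => polarPos vec (U i j ω, D i j ω) from
        hpm.comp (hUD i j)).aemeasurable).1 hind, h.law_time i j]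
    congr 1
    rw [rowLaw, ← hlaw i j, Measure.map_map hpm (hUD i j)]
    rfl
  · exact h.indep_triples.comp (fun _ (e : ℝ × ℝ × S) => (e.1, polarPos vec e.2))
      fun _ => measurable_fst.prodMk (hpm.comp measurable_snd)

theorem isProbabilityMeasure_uniformSphere (hd : 0 < d) :
    IsProbabilityMeasure (uniformSphere d) := by
  have : Nonempty (Fin d) := ⟨⟨0, hd⟩⟩
  refine cond_isProbabilityMeasure ?_
  rw [Ne, Measure.measure_univ_eq_zero]
  exact Measure.toSphere_ne_zero _

theorem isPolarLaw_uniformSphere (hd : 0 < d) :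
    IsPolarLaw (uniformSphere d)
      (fun σ : Metric.sphere (0 : EuclideanSpace ℝ (Fin d)) 1 =>
        (σ : EuclideanSpace ℝ (Fin d))) := by
  intro g hg
  have : Nonempty (Fin d) := ⟨⟨0, hd⟩⟩
  set c := volume.real (Metric.ball (0 : EuclideanSpace ℝ (Fin d)) 1) with hc
  have hc0 : 0 < c := unitBall_pos d
  set τ := (volume : Measure (EuclideanSpace ℝ (Fin d))).toSphere with hτ
  -- The total mass d |B₁| of the sphere is precisely the constant in the radial density of
  -- `IsPolarLaw`.
  have hτu : τ univ = ENNReal.ofReal (c * d) := by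
    rw [hτ, Measure.toSphere_apply_univ, finrank_euclideanSpace_fin, mul_comm c,
      ENNReal.ofReal_mul (Nat.cast_nonneg _), ENNReal.ofReal_natCast, hc, ofReal_measureReal]
  have hdc : 0 < c * d := mul_pos hc0 (Nat.cast_pos.2 hd)
  have hpolar : ∫⁻ v, g v = ∫⁻ σ, (∫⁻ r in Ioi (0 : ℝ), ENNReal.ofReal (r ^ (d - 1)) *
      g (r • (σ : EuclideanSpace ℝ (Fin d)))) ∂τ := by
    have hm := (volume : Measure (EuclideanSpace ℝ (Fin d))).measurePreserving_homeomorphUnitSphereProd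
    have h1 := hm.lintegral_comp_emb (Homeomorph.measurableEmbedding _)
      (fun e => g ((e.2 : ℝ) • (e.1 : EuclideanSpace ℝ (Fin d))))
    have h2 : ∀ v : ({0}ᶜ : Set (EuclideanSpace ℝ (Fin d))),
        (((homeomorphUnitSphereProd _ v).2 : ℝ) •
          ((homeomorphUnitSphereProd _ v).1 : EuclideanSpace ℝ (Fin d))) = v := fun v => by
      rw [← homeomorphUnitSphereProd_symm_apply_coe, Homeomorph.symm_apply_apply]
    simp only [h2] at h1
    rw [lintegral_subtype_comap (measurableSet_singleton _).compl, restrict_compl_singleton,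
      finrank_euclideanSpace_fin] at h1
    have hmeas : Measurable fun e : Metric.sphere (0 : EuclideanSpace ℝ (Fin d)) 1 × Ioi (0 : ℝ) =>
        g ((e.2 : ℝ) • (e.1 : EuclideanSpace ℝ (Fin d))) :=
      hg.comp ((measurable_subtype_coe.comp measurable_snd).smul
        (measurable_subtype_coe.comp measurable_fst))
    rw [h1, lintegral_prod _ hmeas.aemeasurable]
    refine lintegral_congr fun σ => ?_
    rw [Measure.volumeIoiPow, lintegral_withDensity_eq_lintegral_mul
      (g := fun r : Ioi (0 : ℝ) => g ((r : ℝ) • (σ : EuclideanSpace ℝ (Fin d)))) _ (by fun_prop)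
      (hmeas.comp measurable_prodMk_left)]
    exact lintegral_subtype_comap measurableSet_Ioi
      (fun r : ℝ => ENNReal.ofReal (r ^ (d - 1)) * g (r • (σ : EuclideanSpace ℝ (Fin d))))
  have hpull : ∀ σ : Metric.sphere (0 : EuclideanSpace ℝ (Fin d)) 1,
      ∫⁻ r in Ioi (0 : ℝ), ENNReal.ofReal (c * (d * r ^ (d - 1))) *
        g (r • (σ : EuclideanSpace ℝ (Fin d))) =
      ENNReal.ofReal (c * d) * ∫⁻ r in Ioi (0 : ℝ), ENNReal.ofReal (r ^ (d - 1)) *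
        g (r • (σ : EuclideanSpace ℝ (Fin d))) := fun σ => by
    rw [← lintegral_const_mul' _ _ ENNReal.ofReal_ne_top]
    refine lintegral_congr fun r => ?_
    rw [← mul_assoc c, ENNReal.ofReal_mul hdc.le, mul_assoc]
  simp_rw [hpull]
  rw [lintegral_const_mul' _ _ ENNReal.ofReal_ne_top, uniformSphere, ProbabilityTheory.cond,
    Measure.restrict_univ, lintegral_smul_measure, ← hτ, hτu, smul_eq_mul, ← mul_assoc,
    ENNReal.mul_inv_cancel (by simpa using hdc) ENNReal.ofReal_ne_top, one_mul, hpolar]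

theorem isProbabilityMeasure_uniformAngle : IsProbabilityMeasure uniformAngle := by
  refine cond_isProbabilityMeasure_of_finite ?_ ?_
  · simp [Real.pi_pos]
  · exact measure_Ico_lt_top.ne

theorem measurable_angleVec (d : ℕ) : Measurable (angleVec d) := by
  refine (PiLp.continuous_toLp 2 _).measurable.comp (measurable_pi_lambda _ fun k => ?_)
  split_ifs
  · exact Real.measurable_cos
  · exact Real.measurable_sin

theorem isPolarLaw_uniformAngle : IsPolarLaw uniformAngle (angleVec 2) := by
  intro g hg
  have hc : volume.real (Metric.ball (0 : EuclideanSpace ℝ (Fin 2)) 1) = Real.pi := by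
    rw [measureReal_def, EuclideanSpace.volume_ball_fin_two]
    simp [Real.pi_pos.le]
  have h2π : 0 < 2 * Real.pi := by positivity
  set E : ℝ × ℝ → EuclideanSpace ℝ (Fin 2) :=
    fun p => WithLp.toLp 2 (MeasurableEquiv.finTwoArrow.symm p) with hE
  have hEmp : MeasurePreserving E volume volume :=
    (PiLp.volume_preserving_toLp (Fin 2)).comp (volume_preserving_finTwoArrow ℝ).symm
  have hEp : ∀ p : ℝ × ℝ, E (polarCoord.symm p) = p.1 • angleVec 2 p.2 := by
    intro p
    ext k
    fin_cases k <;> simp [hE, angleVec, polarCoord, MeasurableEquiv.finTwoArrow]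
  set G : ℝ → ℝ≥0∞ := fun t => ∫⁻ r in Ioi (0 : ℝ), ENNReal.ofReal r * g (r • angleVec 2 t)
  have hper : ∀ (z : AddSubgroup.zmultiples (2 * Real.pi)) (t : ℝ), G (z +ᵥ t) = G t := by
    rintro ⟨_, k, rfl⟩ t
    have : angleVec 2 (k • (2 * Real.pi) + t) = angleVec 2 t := by
      ext i
      fin_cases i <;> simp [angleVec, add_comm _ t]
    show G (k • (2 * Real.pi) + t) = G t
    simp only [G, this]
  have hmeas : Measurable fun p : ℝ × ℝ => ENNReal.ofReal p.1 * g (p.1 • angleVec 2 p.2) :=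
    (ENNReal.measurable_ofReal.comp measurable_fst).mul
      (hg.comp (measurable_fst.smul ((measurable_angleVec 2).comp measurable_snd)))
  have hpolar : ∫⁻ v, g v = ∫⁻ t in Ico 0 (2 * Real.pi), G t := by
    rw [← hEmp.lintegral_comp hg, ← lintegral_comp_polarCoord_symm]
    simp only [hEp, smul_eq_mul, polarCoord_target]
    rw [Measure.volume_eq_prod, ← Measure.prod_restrict,
      lintegral_prod_symm' _ hmeas]
    -- Polar coordinates use angles between -π and π, the uniform law those in [0, 2π); periodicity
    -- identifies the integrals.
    have hdom := (isAddFundamentalDomain_Ioc h2π (-Real.pi)).setLIntegral_eq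
      (isAddFundamentalDomain_Ioc h2π 0) G hper
    rw [show -Real.pi + 2 * Real.pi = Real.pi by ring, zero_add] at hdom
    rw [setLIntegral_congr Ico_ae_eq_Ioc, ← hdom, ← setLIntegral_congr Ioo_ae_eq_Ioc]
  rw [hpolar, hc]
  have hpull : ∀ t : ℝ, ∫⁻ r in Ioi (0 : ℝ),
      ENNReal.ofReal (Real.pi * ((2 : ℕ) * r ^ (2 - 1))) * g (r • angleVec 2 t) =
      ENNReal.ofReal (2 * Real.pi) * G t := fun t => by
    rw [← lintegral_const_mul' _ _ ENNReal.ofReal_ne_top]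
    refine lintegral_congr fun r => ?_
    rw [← mul_assoc (ENNReal.ofReal (2 * Real.pi)), ← ENNReal.ofReal_mul h2π.le]
    congr 2
    push_cast
    ring
  simp_rw [hpull]
  rw [lintegral_const_mul' _ _ ENNReal.ofReal_ne_top, uniformAngle, ProbabilityTheory.cond,
    lintegral_smul_measure, Real.volume_Ico, sub_zero, smul_eq_mul, ← mul_assoc,
    ENNReal.mul_inv_cancel (by simpa using Real.pi_pos) ENNReal.ofReal_ne_top, one_mul]

end Polar

end REPP

end

noncomputable section

namespace REPP

/-! ### Convergence to the process of piles -/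

section Convergence

set_option linter.unusedSectionVars false

theorem euclideanHausdorffMeasure_univ_lt_top {F : Type*} [NormedAddCommGroup F] [NormedSpace ℝ F]
    [FiniteDimensional ℝ F] {H : Type*} [TopologicalSpace H] (I : ModelWithCorners ℝ F H)
    {X : Type*} [MetricSpace X] [CompactSpace X] [MeasurableSpace X] [BorelSpace X]
    [ChartedSpace H X] [IsManifold I 1 X]
    [Bundle.RiemannianBundle (fun x : X => TangentSpace I x)]
    [IsContinuousRiemannianBundle F (fun x : X => TangentSpace I x)]
    [IsRiemannianManifold I X] {d : ℕ} (hd : Module.finrank ℝ F = d) :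
    (Measure.euclideanHausdorffMeasure d : Measure X) univ < ∞ := by
  choose V hV _ hfin using fun x : X =>
    exists_nhds_euclideanHausdorffMeasure_lt_top (X := X) I hd x
  obtain ⟨t, ht⟩ := isCompact_univ.elim_nhds_subcover V fun x _ => hV x
  exact (measure_mono ht.2).trans_lt
    ((measure_biUnion_finset_le t V).trans_lt (ENNReal.sum_lt_top.2 fun x _ => hfin x))

variable {F : Type*} [NormedAddCommGroup F] [NormedSpace ℝ F] [FiniteDimensional ℝ F]
  {H : Type*} [TopologicalSpace H] (I : ModelWithCorners ℝ F H)
  {X : Type*} [MetricSpace X] [ChartedSpace H X] [IsManifold I 1 X]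
  [Bundle.RiemannianBundle (fun x : X => TangentSpace I x)]
  [IsContinuousRiemannianBundle F (fun x : X => TangentSpace I x)]
  [IsRiemannianManifold I X] {d : ℕ} {ζ : X}
  (Φ : EuclideanSpace ℝ (Fin d) ≃ₗᵢ[ℝ] TangentSpace I ζ) {T : X → X}
  {S : Type*} [MeasurableSpace S] {vec : S → EuclideanSpace ℝ (Fin d)}
  {Ω : Type*} [MeasurableSpace Ω] {P : Measure Ω} [IsProbabilityMeasure P]

theorem pileHeight_eq_ballVol (T : X → X) (vec : S → EuclideanSpace ℝ (Fin d)) (w : ℝ) (s : S)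
    (ℓ : ℕ) : pileHeight Φ (returnDeriv I T ζ) w (vec s) ℓ =
      ballVol ((returnMap I Φ T ^ ℓ) (polarPos vec (w, s))) := by
  rw [pileHeight, ballVol, polarPos, map_smul, returnMap_pow, ← map_smul, dist_zero_right,
    LinearIsometryEquiv.norm_map]

theorem limitREPP_eq_sum_dirac (T : X → X) (vec : S → EuclideanSpace ℝ (Fin d))
    (Tbar U : ℕ → ℕ → Ω → ℝ) (D : ℕ → ℕ → Ω → S) :
    limitREPP Φ (returnDeriv I T ζ) Tbar U (fun i j ω => vec (D i j ω)) = fun ω =>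
      Measure.sum fun q => Measure.dirac (pilePoint (returnMap I Φ T) Tbar
        (fun i j ω => polarPos vec (U i j ω, D i j ω)) ω q) := by
  funext ω
  simp only [limitREPP, pilePoint, arrival, pileHeight_eq_ballVol]

theorem isPointProcess_limitREPP (hd : Module.finrank ℝ F = d) (hd0 : 0 < d)
    (hζ : IsRepellingPeriodicPt I T ζ) {κ : Measure S} [IsProbabilityMeasure κ]
    (hvec : Measurable vec) (hκ : IsPolarLaw κ vec) {Tbar U : ℕ → ℕ → Ω → ℝ} {D : ℕ → ℕ → Ω → S}
    (hD : IsMarkFamily P (extremalIndex I T ζ) κ Tbar U D) :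
    IsPointProcess P (limitREPP Φ (returnDeriv I T ζ) Tbar U fun i j ω => vec (D i j ω)) := by
  have hdet := one_lt_abs_det_returnDeriv I hζ (hd ▸ hd0)
  rw [limitREPP_eq_sum_dirac]
  exact (hD.isPileFamily hvec).isPointProcess_pilePoint (sub_pos.2 (inv_lt_one_of_one_lt₀ hdet)) hd0
    (hκ.sum_rowLaw hd0 hvec) (by rwa [det_returnMap])

variable [MeasurableSpace X] [BorelSpace X]

theorem isPointProcess_empiricalREPP {μ : Measure X} (hT : Measurable T) {φ : X → EReal}
    (hφ : Measurable φ) (u : ℕ → ℝ → ℝ) {n : ℕ} (hn : 1 ≤ n) :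
    IsPointProcess μ (empiricalREPP T φ u n) :=
  isPointProcess_of_measurable (measurable_empiricalREPP hT hφ u n)
    (ae_of_all _ (isRadonPointMeasure_empiricalREPP φ u hn))

theorem tendsto_laplace_empiricalREPP [CompactSpace X] (hd : Module.finrank ℝ F = d)
    (hd0 : 0 < d) {μ : Measure X} [IsProbabilityMeasure μ] (hT : MeasurePreserving T μ μ)
    {C₁ : Type*} [NormedAddCommGroup C₁] [NormedSpace ℝ C₁] {ι : C₁ →ₗ[ℝ] (X →ₘ[μ] ℝ)}
    {ρ : ℕ → ℝ} (hρ : Summable ρ) (hdecay : DecayAgainstL1 T ι ρ)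
    (hC₁ : ControlsIndicators (Measure.euclideanHausdorffMeasure d) ι)
    (hζint : I.IsInteriorPoint ζ)
    (hdens : HasRegularDensityAt (Measure.euclideanHausdorffMeasure d) μ ζ)
    (hcont : ∀ k : ℕ, ContinuousAt T (T^[k] ζ)) (hζ : IsRepellingPeriodicPt I T ζ)
    {g : ℝ≥0 → EReal} (hg : IsPeakFunction g) (hφ : Measurable fun x : X => g (nndist x ζ))
    {u : ℕ → ℝ → ℝ} (hu : IsLevelSequence μ (fun x => g (nndist x ζ)) u)
    {f : C_c(ℝ≥0 × ℝ≥0, ℝ)} (hf : 0 ≤ f) {A : ℝ≥0} (hA : ∀ q, f q ≠ 0 → q.1 < A ∧ q.2 < A) :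
    Tendsto (fun n => ∫ x, Real.exp
        (-∫ q, f q ∂(empiricalREPP T (fun x => g (nndist x ζ)) u n x)) ∂μ) atTop
      (𝓝 (Real.exp (-(extremalIndex I T ζ *
        ∫ s in (0 : ℝ)..A, pileIntegral (returnMap I Φ T) (limitWeight f) s)))) := by
  have hchart : IsNormalChart ζ (normalChart I Φ) :=
    ⟨normalChart_self I Φ, fun ε hε => normalChart_bilipschitz I Φ hε,
      map_normalChart_nhds I Φ hζint⟩
  obtain ⟨V, y, hy⟩ := exists_isScalingChart hchart hd0
    (euclideanHausdorffMeasure_univ_lt_top I hd) hC₁ hdens hcont hg hu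
    (normalChart_iterate_isLittleO I Φ hζint hζ)
  obtain ⟨R, hw⟩ := hy.exists_isVisitWeight hd0
    (fun n => (measurable_levelInv (u n)).comp hφ) hf hA
  have hL : 1 < |LinearMap.det (returnMap I Φ T)| := by
    rw [det_returnMap]
    exact one_lt_abs_det_returnDeriv I hζ (hd ▸ hd0)
  have hlim := hy.tendsto_laplace hw
    (Function.minimalPeriod_pos_of_mem_periodicPts hζ.periodic) hT hdecay hρ hL
    -- This horizon covers all times below `A` and is at most (A + 1) n.
    (J := fun n => ⌈(A : ℝ) * n⌉₊) (fun n => Nat.le_ceil _) (b := A + 1) (by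
      filter_upwards [eventually_ge_atTop 1] with n hn
      have h1 : (1 : ℝ) ≤ n := by exact_mod_cast hn
      have h2 := Nat.ceil_lt_add_one (show (0 : ℝ) ≤ A * n by positivity)
      rw [add_mul, one_mul]
      linarith)
  rw [det_returnMap] at hlim
  refine hlim.congr' ?_
  filter_upwards [eventually_ge_atTop 1] with n hn
  refine integral_congr_ae (ae_of_all _ fun x => ?_)
  simp only
  rw [integral_empiricalREPP hf hA _ u hn (Nat.le_ceil _)]

/-- The empirical Laplace functionals converge to the closed expression that the piles have exactly.
The law of the directions enters only through the polar formula, so one argument serves spheres and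
angles. -/
theorem convergesWeakly_limitREPP [CompactSpace X] (hd : Module.finrank ℝ F = d)
    (hd0 : 0 < d) {μ : Measure X} [IsProbabilityMeasure μ] (hT : MeasurePreserving T μ μ)
    {C₁ : Type*} [NormedAddCommGroup C₁] [NormedSpace ℝ C₁] {ι : C₁ →ₗ[ℝ] (X →ₘ[μ] ℝ)}
    {ρ : ℕ → ℝ} (hρ : Summable ρ) (hdecay : DecayAgainstL1 T ι ρ)
    (hC₁ : ControlsIndicators (Measure.euclideanHausdorffMeasure d) ι)
    (hζint : I.IsInteriorPoint ζ)
    (hdens : HasRegularDensityAt (Measure.euclideanHausdorffMeasure d) μ ζ)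
    (hcont : ∀ k : ℕ, ContinuousAt T (T^[k] ζ)) (hζ : IsRepellingPeriodicPt I T ζ)
    {g : ℝ≥0 → EReal} (hg : IsPeakFunction g) (hφ : Measurable fun x : X => g (nndist x ζ))
    {u : ℕ → ℝ → ℝ} (hu : IsLevelSequence μ (fun x => g (nndist x ζ)) u)
    {κ : Measure S} [IsProbabilityMeasure κ] (hvec : Measurable vec) (hκ : IsPolarLaw κ vec)
    {Tbar U : ℕ → ℕ → Ω → ℝ} {D : ℕ → ℕ → Ω → S}
    (hD : IsMarkFamily P (extremalIndex I T ζ) κ Tbar U D) :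
    ConvergesWeakly μ (empiricalREPP T (fun x => g (nndist x ζ)) u) P
      (limitREPP Φ (returnDeriv I T ζ) Tbar U fun i j ω => vec (D i j ω)) := by
  refine convergesWeakly_of_laplace
    (fun n hn => isPointProcess_empiricalREPP hT.measurable hφ u hn)
    (isPointProcess_limitREPP I Φ hd hd0 hζ hvec hκ hD) fun f hf => ?_
  obtain ⟨A, _, hA⟩ := exists_support_bound f
  have hdet := one_lt_abs_det_returnDeriv I hζ (hd ▸ hd0)
  rw [limitREPP_eq_sum_dirac, (hD.isPileFamily hvec).integral_exp_neg
    (sub_pos.2 (inv_lt_one_of_one_lt₀ hdet)) hd0 (hκ.sum_rowLaw hd0 hvec)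
    (by rwa [det_returnMap]) hf hA]
  exact tendsto_laplace_empiricalREPP I Φ hd hd0 hT hρ hdecay hC₁ hζint hdens hcont hζ hg hφ hu
    hf hA

end Convergence

end REPP

end

/-! ### The main theorem, with planar angles and with directions on the sphere. -/

theorem mainTheorem3
    -- a compact `d`-dimensional Riemannian manifold `X`, possibly with boundary
    {F : Type*} [NormedAddCommGroup F] [NormedSpace ℝ F] [FiniteDimensional ℝ F]
    {H : Type*} [TopologicalSpace H] (I : ModelWithCorners ℝ F H)
    {X : Type*} [MetricSpace X] [CompactSpace X] [MeasurableSpace X] [BorelSpace X]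
    [ChartedSpace H X] [IsManifold I 1 X]
    [Bundle.RiemannianBundle (fun x : X => TangentSpace I x)]
    [IsContinuousRiemannianBundle F (fun x : X => TangentSpace I x)]
    [IsRiemannianManifold I X]
    (d : ℕ) (hd : Module.finrank ℝ F = d) (hd0 : 0 < d)
    -- the system
    (T : X → X) (μ : Measure X) [IsProbabilityMeasure μ] (hT : MeasurePreserving T μ μ)
    -- summable decay of correlations of a Banach space `C₁` against `L¹`
    {C₁ : Type*} [NormedAddCommGroup C₁] [NormedSpace ℝ C₁] [CompleteSpace C₁]
    (ι : C₁ →ₗ[ℝ] (X →ₘ[μ] ℝ)) (ρ : ℕ → ℝ) (hρ : Summable ρ)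
    (hdecay : REPP.DecayAgainstL1 T ι ρ)
    (hC₁ : REPP.ControlsIndicators (Measure.euclideanHausdorffMeasure d) ι)
    -- the point `ζ`
    (ζ : X) (hζint : I.IsInteriorPoint ζ)
    (hdens : REPP.HasRegularDensityAt (Measure.euclideanHausdorffMeasure d) μ ζ)
    (hcont : ∀ k : ℕ, ContinuousAt T (T^[k] ζ))
    (hζ : REPP.IsRepellingPeriodicPt I T ζ)
    -- the observable and the levels
    (g : ℝ≥0 → EReal) (hg : REPP.IsPeakFunction g)
    (hφ : Measurable fun x : X => g (nndist x ζ))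
    (u : ℕ → ℝ → ℝ) (hu : REPP.IsLevelSequence μ (fun x => g (nndist x ζ)) u)
    -- Euclidean coordinates on the tangent space at `ζ`
    (Φ : EuclideanSpace ℝ (Fin d) ≃ₗᵢ[ℝ] TangentSpace I ζ)
    -- the probability space on which the limit is defined
    {Ω : Type*} [MeasurableSpace Ω] (P : Measure Ω) [IsProbabilityMeasure P] :
    (∀ n : ℕ, 1 ≤ n →
      REPP.IsPointProcess μ (REPP.empiricalREPP T (fun x => g (nndist x ζ)) u n)) ∧
    -- two-dimensional phase space, directions `(cos Θ, sin Θ)`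
    (d = 2 → ∀ Tbar U Θ : ℕ → ℕ → Ω → ℝ,
      REPP.IsMarkFamily P (REPP.extremalIndex I T ζ) REPP.uniformAngle Tbar U Θ →
      REPP.IsPointProcess P (REPP.limitREPP Φ (REPP.returnDeriv I T ζ) Tbar U
        fun i j ω => REPP.angleVec d (Θ i j ω)) ∧
      REPP.ConvergesWeakly μ (REPP.empiricalREPP T (fun x => g (nndist x ζ)) u) P
        (REPP.limitREPP Φ (REPP.returnDeriv I T ζ) Tbar U
          fun i j ω => REPP.angleVec d (Θ i j ω))) ∧
    -- any dimension, directions uniform on the unit sphere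
    (∀ (Tbar U : ℕ → ℕ → Ω → ℝ)
      (σ : ℕ → ℕ → Ω → Metric.sphere (0 : EuclideanSpace ℝ (Fin d)) 1),
      REPP.IsMarkFamily P (REPP.extremalIndex I T ζ) (REPP.uniformSphere d) Tbar U σ →
      REPP.IsPointProcess P (REPP.limitREPP Φ (REPP.returnDeriv I T ζ) Tbar U
        fun i j ω => (σ i j ω : EuclideanSpace ℝ (Fin d))) ∧
      REPP.ConvergesWeakly μ (REPP.empiricalREPP T (fun x => g (nndist x ζ)) u) P
        (REPP.limitREPP Φ (REPP.returnDeriv I T ζ) Tbar U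
          fun i j ω => (σ i j ω : EuclideanSpace ℝ (Fin d)))) := by
  refine ⟨fun n hn => REPP.isPointProcess_empiricalREPP hT.measurable hφ u hn, ?_, ?_⟩
  · intro hd2 Tbar U Θ hΘ
    subst hd2
    have := REPP.isProbabilityMeasure_uniformAngle
    exact ⟨REPP.isPointProcess_limitREPP I Φ hd hd0 hζ (REPP.measurable_angleVec 2)
        REPP.isPolarLaw_uniformAngle hΘ,
      REPP.convergesWeakly_limitREPP I Φ hd hd0 hT hρ hdecay hC₁ hζint hdens hcont hζ hg hφ hu
        (REPP.measurable_angleVec 2) REPP.isPolarLaw_uniformAngle hΘ⟩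
  · intro Tbar U σ hσ
    have := REPP.isProbabilityMeasure_uniformSphere hd0
    exact ⟨REPP.isPointProcess_limitREPP I Φ hd hd0 hζ measurable_subtype_coe
        (REPP.isPolarLaw_uniformSphere hd0) hσ,
      REPP.convergesWeakly_limitREPP I Φ hd hd0 hT hρ hdecay hC₁ hζint hdens hcont hζ hg hφ hu
        measurable_subtype_coe (REPP.isPolarLaw_uniformSphere hd0) hσ⟩
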